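/- Let $\mathsf V=\mathbb C^2$ be the natural module of $\mathsf{SU}_2$, with basis $\mathsf v_{-1}=(1,0)^t,\ \mathsf v_1=(0,1)^t$. Let $\mathsf G\subseteq \mathsf{SU}_2$ be one of the following groups: $\mathsf{SU}_2$ itself; $\mathbf C_n$ ($n\ge 3$), generated by $g=\mathrm{diag}(\zeta^{-1},\zeta)$ with $\zeta$ a primitive $n$th root of unity; $\mathbf D_n$ ($n\ge 2$), generated by $g=\mathrm{diag}(\zeta^{-1},\zeta)$ with $\zeta$ a primitive $2n$th root of unity and $h=\begin{pmatrix}0&i\\ i&0\end{pmatrix}$; a binary tetrahedral, octahedral or icosahedral group $\mathbf T,\mathbf O,\mathbf I$ (a subgroup containing $-1$ whose quotient by $\{1,-1\}$ is $A_4,S_4,A_5$, respectively); or $\mathbf C_\infty$, $\mathbf D_\infty$, which are generated by the same matrices as $\mathbf C_n$, $\mathbf D_n$ with $|\zeta|=1$ and $\zeta$ not a root of unity. Set $\tilde n=n/2$ for $n$ even and $\tilde n=n$ for $n$ odd, and let $$\begin{array}{c|cccccccc}\mathsf G&\mathsf{SU}_2&\mathbf C_n&\mathbf D_n&\mathbf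 T&\mathbf O&\mathbf I&\mathbf C_\infty&\mathbf D_\infty\\\hline \mathrm{diam}(\mathsf G)&\infty&\tilde n&n&4&6&7&\infty&\infty\\ \mathrm{br}(\mathsf G)&\text{none}&0&1&2&3&5&0&1\end{array}$$ Let $\mathsf Z_k=\mathrm{End}_{\mathsf G}(\mathsf V^{\otimes k})$, regarded as a subalgebra of $\mathsf Z_{k+1}$ through $a\mapsto a\otimes 1$. For $k\ge1$ let $\mathsf e_k=1-s_k\in\mathsf Z_{k+1}$, where $s_k$ exchanges the tensor factors $k$ and $k+1$ of $\mathsf V^{\otimes(k+1)}$, and put $\mathsf e_0=0$. Let $\mathsf Z_k\mathsf e_k\mathsf Z_k$ be the linear span of the products $a\mathsf e_kb$ with $a,b\in\mathsf Z_k$. Let $\Lambda(\mathsf G)$ be the set of isomorphism classes of irreducible $\mathsf G$-modules $\mathsf G^\lambda$ that occur in some $\mathsf V^{\otimes k}$, and $\Lambda_k$ the subset of those that occur in $\mathsf V^{\otimes k}$ ($\Lambda_{-1}=\emptyset$). The representation graph $\mathcal R$ has node set $\Lambda(\mathsf G)$, and $\lambda,\mu$ are joined by an edge if $\mathsf G^\mu$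 occurs in $\mathsf G^\lambda\otimes\mathsf V$; $0$ is the node of the trivial module. Let $\mathsf V^{\otimes(k+1)}_{\rm old}$ and $\mathsf V^{\otimes (k+1)}_{\rm new}$ be the sums of the isotypic components of $\mathsf V^{\otimes (k+1)}$ for the $\lambda$ in $\Lambda_{k-1}$ and in $\Lambda_{k+1}\setminus\Lambda_{k-1}$, respectively. The algebra $\mathrm{End}_{\mathsf G}(\mathsf V^{\otimes (k+1)}_{\rm new})$ is viewed in $\mathsf Z_{k+1}$ through extension by $0$ on $\mathsf V^{\otimes (k+1)}_{\rm old}$. For $\mu\in\Lambda_{k+1}\setminus\Lambda_{k-1}$, when $\mathsf G^\mu$ has multiplicity one in $\mathsf V^{\otimes(k+1)}$, let $\mathsf f_\mu$ be the projection of $\mathsf V^{\otimes(k+1)}$ onto this summand along all the other isotypic components. Finally $\langle\cdots\rangle$ denotes the generated unital subalgebra. If $\mathsf G$ is not $\mathbf C_n$ or $\mathbf C_\infty$, then $\mathsf Z_1=\mathbb C\mathbf 1\cong\mathsf Z_0$. Moreover: (a) If $1\le k<\mathrm{diam}(\mathsf G)$, and $k\ne\tilde n-1$ in the case $\mathsf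 G=\mathbf C_n$, then $\mathsf Z_{k+1}=\mathsf Z_k\mathsf e_k\mathsf Z_k\oplus\mathrm{End}_{\mathsf G}(\mathsf V^{\otimes(k+1)}_{\rm new})$ (a direct sum of algebras), where the second summand is commutative of dimension $|\Lambda_{k+1}\setminus\Lambda_{k-1}|$. This dimension is the number of nodes of $\mathcal R$ at distance $k+1$ from $0$, except possibly when $\mathsf G=\mathbf C_n$ with $n$ odd and $2(k+1)>n$. (b) If $k\ge\mathrm{diam}(\mathsf G)$, then $\mathsf Z_{k+1}=\mathsf Z_k\mathsf e_k\mathsf Z_k$. (c) If $1\le k<\mathrm{diam}(\mathsf G)$, $k\ne\mathrm{br}(\mathsf G)$, $k\ne\tilde n-1$ in the case $\mathsf G=\mathbf C_n$, and $k\neq n-1$ in the case $\mathsf G=\mathbf D_n$, then $\mathsf Z_{k+1}=\langle\mathsf Z_k,\mathsf e_k\rangle$. (d) If $k=\mathrm{br}(\mathsf G)$ and $\mathsf G\ne\mathbf D_2$, then $\Lambda_{k+1}\setminus\Lambda_{k-1}$ has exactly two elements, and for either of them, $\mu$, the projection $\mathsf f_\mu$ is defined and $\mathsf Z_{k+1}=\langle\mathsf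 Z_k,\mathsf e_k,\mathsf f_\mu\rangle$. (e) If $\mathsf G=\mathbf C_n$, then $\mathsf Z_{\tilde n}=\langle\mathsf Z_{\tilde n-1},\mathsf e_{\tilde n-1},\mathsf E_{\mathsf p,\mathsf q}\ (\mathsf p,\mathsf q\in\{-\underline{1},\underline{1}\})\rangle$, where $\underline 1=(1,\dots,1)$ has $\tilde n$ entries and $\mathsf E_{\mathsf p,\mathsf q}$ is the matrix unit of $\mathrm{End}(\mathsf V^{\otimes\tilde n})$ with $\mathsf E_{\mathsf p,\mathsf q}\mathsf v_{\mathsf t}=\delta_{\mathsf q,\mathsf t}\mathsf v_{\mathsf p}$, $\mathsf v_{\mathsf t}=\mathsf v_{t_1}\otimes\cdots\otimes\mathsf v_{t_{\tilde n}}$. (f) If $\mathsf G=\mathbf D_n$ with $2<n<\infty$, then $\Lambda_n\setminus\Lambda_{n-2}=\{(n),(n')\}$, consisting of the two distinct one-dimensional modules on which $g$ acts as $-1$ and $h$ as $i^n$ and $-i^n$, respectively; and for either of them, $\mu$, the projection $\mathsf f_\mu$ is defined and $\mathsf Z_n=\langle\mathsf Z_{n-1},\mathsf e_{n-1},\mathsf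 f_\mu\rangle$. (g) If $\mathsf G=\mathbf D_2$, then $\Lambda_2\setminus\Lambda_0=\{(0'),(2),(2')\}$, consisting of the three distinct one-dimensional modules on which $(g,h)$ acts as $(1,-1)$, $(-1,-1)$, $(-1,1)$, respectively; and for any two distinct elements $\mu_1,\mu_2$ of this set the projections are defined and $\mathsf Z_2=\langle\mathsf Z_1,\mathsf e_1,\mathsf f_{\mu_1},\mathsf f_{\mu_2}\rangle$. -/

import Mathlib

open scoped TensorProduct

noncomputable section

namespace McKay

/-! ### The group `SU₂`, its natural module and the tensor powers -/

/-- The special unitary group `SU₂`. -/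
abbrev SU2 : Type := Matrix.specialUnitaryGroup (Fin 2) ℂ

/-- The natural module `V = ℂ²`. The basis vector with index `0` is `v₋₁ = (1,0)ᵗ`,
the one with index `1` is `v₁ = (0,1)ᵗ`. -/
abbrev V : Type := Fin 2 → ℂ

/-- The tensor power `V^{⊗k}`. -/
abbrev TP (k : ℕ) : Type := ⨂[ℂ] (_ : Fin k), V

/-- The action of `G ≤ SU₂` on `V = ℂ²` by matrix multiplication. -/
def natRep (G : Subgroup SU2) : Representation ℂ G V where
  toFun g := Matrix.toLin' ((g : SU2) : Matrix (Fin 2) (Fin 2) ℂ)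
  map_one' := Matrix.toLin'_one
  map_mul' _ _ := Matrix.toLin'_mul _ _

/-- The diagonal action of `G ≤ SU₂` on `V^{⊗k}`. -/
def tensorRep (G : Subgroup SU2) (k : ℕ) : Representation ℂ G (TP k) where
  toFun g := PiTensorProduct.map fun _ => natRep G g
  map_one' := by
    simp only [map_one]
    exact PiTensorProduct.map_one
  map_mul' g h := by
    simp only [map_mul]
    exact PiTensorProduct.map_mul _ _

/-- The centralizer algebra `Z_k(G) = End_G(V^{⊗k})`. -/
def Z (G : Subgroup SU2) (k : ℕ) : Subalgebra ℂ (Module.End ℂ (TP k)) :=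
  Subalgebra.centralizer ℂ (Set.range (tensorRep G k))

/-- The embedding `a ↦ a ⊗ 1` of `End(V^{⊗k})` into `End(V^{⊗(k+1)})`; here
`V^{⊗k} ⊗ V^{⊗1}` is identified with `V^{⊗(k+1)}` by concatenation. -/
def embed (k : ℕ) : Module.End ℂ (TP k) →ₐ[ℂ] Module.End ℂ (TP (k + 1)) :=
  ((LinearEquiv.conjAlgEquiv ℂ
      (TensorPower.mulEquiv (R := ℂ) (M := V) (n := k) (m := 1))).toAlgHom).comp
    (Module.End.rTensorAlgHom ℂ (TP k) (TP 1))

/-- `Z_k(G)`, regarded as a subalgebra of `End(V^{⊗(k+1)})`. -/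
def Zin (G : Subgroup SU2) (k : ℕ) : Subalgebra ℂ (Module.End ℂ (TP (k + 1))) :=
  (Z G k).map (embed k)

/-- For `k ≥ 1`, the operator `e_k = 1 - s_k` on `V^{⊗(k+1)}`, where `s_k` exchanges the last two
tensor factors (those with the zero-based indices `k - 1` and `k`). For `k = 0` there is only one
tensor factor and the formula gives `e_0 = 0`. -/
def e (k : ℕ) : Module.End ℂ (TP (k + 1)) :=
  1 - (PiTensorProduct.reindex ℂ (fun _ : Fin (k + 1) => V)
    (Equiv.swap (⟨k - 1, by omega⟩ : Fin (k + 1)) (Fin.last k))).toLinearMap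

/-- `Z_k e_k Z_k`, the linear span of the products `a e_k b` with `a, b ∈ Z_k`. -/
def ZeZ (G : Subgroup SU2) (k : ℕ) : Submodule ℂ (Module.End ℂ (TP (k + 1))) :=
  Subalgebra.toSubmodule (Zin G k) * Submodule.span ℂ {e k} * Subalgebra.toSubmodule (Zin G k)

/-- The basis `v_r = v_{r₁} ⊗ ⋯ ⊗ v_{r_k}` of `V^{⊗k}`. -/
def tensorBasis (k : ℕ) : Module.Basis (Fin k → Fin 2) ℂ (TP k) :=
  Basis.piTensorProduct fun _ => Pi.basisFun ℂ (Fin 2)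

/-- The matrix unit `E_{r,s}`, which sends `v_t` to `δ_{s,t} v_r`. -/
def matrixUnit {k : ℕ} (r s : Fin k → Fin 2) : Module.End ℂ (TP k) :=
  Matrix.toLin (tensorBasis k) (tensorBasis k) (Matrix.single r s 1)

/-! ### The irreducible modules in the tensor powers and the representation graph -/

/-- An irreducible finite-dimensional `G`-module (in coordinates) that occurs in some `V^{⊗k}`. -/
structure IrrepIn (G : Subgroup SU2) where
  dim : ℕ
  ρ : Representation ℂ G (Fin dim → ℂ)
  irreducible : ρ.IsIrreducible
  occurs : ∃ (k : ℕ) (f : ρ.IntertwiningMap (tensorRep G k)), f ≠ 0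

/-- Isomorphism of `G`-modules. -/
instance IrrepIn.setoid (G : Subgroup SU2) : Setoid (IrrepIn G) where
  r X Y := Nonempty (X.ρ.Equiv Y.ρ)
  iseqv :=
    { refl := fun X => ⟨Representation.Equiv.refl X.ρ⟩
      symm := fun ⟨f⟩ => ⟨f.symm⟩
      trans := fun ⟨f⟩ ⟨g⟩ => ⟨f.trans g⟩ }

/-- The set `Λ(G)` of isomorphism classes of irreducible `G`-modules that occur in some
`V^{⊗k}`; these are the nodes of the representation graph. -/
def Node (G : Subgroup SU2) : Type := Quotient (IrrepIn.setoid G)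

/-- The irreducible module `G^μ` labelled by `μ ∈ Λ(G)`. -/
def Node.irrep {G : Subgroup SU2} (μ : Node G) : IrrepIn G := Quotient.out μ

/-- The action of `G` on `G^μ`. -/
abbrev Node.ρ {G : Subgroup SU2} (μ : Node G) :
    Representation ℂ G (Fin μ.irrep.dim → ℂ) := μ.irrep.ρ

theorem trivial_irreducible (G : Subgroup SU2) :
    (Representation.trivial ℂ G (Fin 1 → ℂ)).IsIrreducible := by
  have hfr : Module.finrank ℂ (Fin 1 → ℂ) = 1 := by simp
  have : IsSimpleModule ℂ (Fin 1 → ℂ) := (isSimpleModule_iff_finrank_eq_one).2 hfr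
  refine { exists_pair_ne := ⟨⊥, ⊤, ?_⟩, eq_bot_or_eq_top := ?_ }
  · intro h
    have h' := congrArg Subrepresentation.toSubmodule h
    exact bot_ne_top (α := Submodule ℂ (Fin 1 → ℂ)) h'
  · intro W
    rcases eq_bot_or_eq_top W.toSubmodule with h | h
    · exact Or.inl (Subrepresentation.toSubmodule_injective h)
    · exact Or.inr (Subrepresentation.toSubmodule_injective h)

theorem trivial_occurs (G : Subgroup SU2) :
    ∃ (k : ℕ) (f : (Representation.trivial ℂ G (Fin 1 → ℂ)).IntertwiningMap (tensorRep G k)),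
      f ≠ 0 := by
  refine ⟨0, ⟨(LinearMap.toSpanSingleton ℂ (TP 0)
    (PiTensorProduct.tprod ℂ fun _ : Fin 0 => (0 : V))).comp (LinearMap.proj 0), ?_⟩, ?_⟩
  · intro g
    ext
    simp [tensorRep]
  · intro h
    have h1 := congrArg (fun f => f.toLinearMap (fun _ => 1)) h
    have h2 : (PiTensorProduct.tprod ℂ fun _ : Fin 0 => (0 : V)) = 0 := by
      simpa using h1
    have h3 := congrArg (PiTensorProduct.isEmptyEquiv (R := ℂ) (s := fun _ : Fin 0 => V) (Fin 0)) h2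
    simp at h3

/-- The node `0`, i.e. the class of the trivial module. -/
def Node.zero (G : Subgroup SU2) : Node G :=
  Quotient.mk (IrrepIn.setoid G)
    ⟨1, Representation.trivial ℂ G (Fin 1 → ℂ), trivial_irreducible G, trivial_occurs G⟩

/-- The number `a_{μ,ν}` of edges from `μ` to `ν`, i.e. the multiplicity of `G^ν` in
`G^μ ⊗ V`. -/
def edgeMult {G : Subgroup SU2} (μ ν : Node G) : ℕ :=
  Module.finrank ℂ (ν.ρ.IntertwiningMap (μ.ρ.tprod (natRep G)))

/-- The representation graph (McKay graph) of `G` as a simple graph. -/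
def repGraph (G : Subgroup SU2) : SimpleGraph (Node G) :=
  SimpleGraph.fromRel fun μ ν => edgeMult μ ν ≠ 0

/-- `Λ_k(G)`: the irreducible modules that occur in `V^{⊗k}`. -/
def Lam (G : Subgroup SU2) (k : ℕ) : Set (Node G) :=
  {μ | ∃ f : μ.ρ.IntertwiningMap (tensorRep G k), f ≠ 0}

/-- `Λ_{k-2}(G)`, read as the empty set for `k < 2`. -/
def oldNodes (G : Subgroup SU2) (k : ℕ) : Set (Node G) :=
  {μ | ∃ j, j + 2 = k ∧ μ ∈ Lam G j}

/-- `Λ_k(G) \ Λ_{k-2}(G)`. -/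
def newNodes (G : Subgroup SU2) (k : ℕ) : Set (Node G) := Lam G k \ oldNodes G k

/-- The isotypic component of `V^{⊗k}` of type `G^μ`. -/
def isotypic (G : Subgroup SU2) (k : ℕ) (μ : Node G) : Submodule ℂ (TP k) :=
  ⨆ f : μ.ρ.IntertwiningMap (tensorRep G k), LinearMap.range f.toLinearMap

/-- `V^{⊗k}_old`. -/
def oldSpace (G : Subgroup SU2) (k : ℕ) : Submodule ℂ (TP k) :=
  ⨆ μ ∈ oldNodes G k, isotypic G k μ

/-- `V^{⊗k}_new`. -/
def newSpace (G : Subgroup SU2) (k : ℕ) : Submodule ℂ (TP k) :=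
  ⨆ μ ∈ newNodes G k, isotypic G k μ

/-- `End_G(V^{⊗k}_new)` inside `End_G(V^{⊗k})`: the `G`-endomorphisms that vanish on
`V^{⊗k}_old` and have their image in `V^{⊗k}_new`. -/
def endNew (G : Subgroup SU2) (k : ℕ) : NonUnitalSubalgebra ℂ (Module.End ℂ (TP k)) where
  carrier := {a | a ∈ Z G k ∧ (∀ x ∈ oldSpace G k, a x = 0) ∧ ∀ x, a x ∈ newSpace G k}
  zero_mem' := ⟨zero_mem _, fun _ _ => rfl, fun _ => zero_mem _⟩
  add_mem' := by
    rintro a b ⟨ha, ha', ha''⟩ ⟨hb, hb', hb''⟩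
    exact ⟨add_mem ha hb, fun x hx => by simp [ha' x hx, hb' x hx],
      fun x => add_mem (ha'' x) (hb'' x)⟩
  mul_mem' := by
    rintro a b ⟨ha, ha', ha''⟩ ⟨hb, hb', hb''⟩
    exact ⟨mul_mem ha hb, fun x hx => by simp [hb' x hx], fun x => ha'' (b x)⟩
  smul_mem' := by
    rintro c a ⟨ha, ha', ha''⟩
    exact ⟨Subalgebra.smul_mem _ ha c, fun x hx => by simp [ha' x hx],
      fun x => Submodule.smul_mem _ c (ha'' x)⟩

/-- `f` is the projection `f_μ` of `V^{⊗k}` onto a summand isomorphic to the irreducible module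
`G^μ`, along the sum of all the isotypic components of other types. -/
def IsProjOnto (G : Subgroup SU2) (k : ℕ) (μ : Node G) (f : Module.End ℂ (TP k)) : Prop :=
  IsIdempotentElem f ∧
  (∃ φ : μ.ρ.IntertwiningMap (tensorRep G k),
    Function.Injective φ ∧ LinearMap.range f = LinearMap.range φ.toLinearMap) ∧
  LinearMap.ker f = ⨆ ν ∈ {ν : Node G | ν ≠ μ}, isotypic G k ν

/-! ### The groups -/

/-- The diagonal matrix with entries `ζ⁻¹, ζ`. -/
def gElt (ζ : Circle) : SU2 :=
  ⟨!![((ζ⁻¹ : Circle) : ℂ), 0; 0, (ζ : ℂ)], by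
    rw [Matrix.mem_specialUnitaryGroup_iff, Matrix.mem_unitaryGroup_iff]
    have h : (ζ : ℂ) * (starRingEnd ℂ) (ζ : ℂ) = 1 := by
      rw [Complex.mul_conj, Circle.normSq_coe]; simp
    constructor
    · ext i j
      fin_cases i <;> fin_cases j <;>
        simp [Matrix.mul_apply, Fin.sum_univ_two, Matrix.star_apply, h, ← mul_inv]
    · simp [Matrix.det_fin_two]⟩

/-- The matrix with rows `(0, i)` and `(i, 0)`. -/
def hElt : SU2 :=
  ⟨!![0, Complex.I; Complex.I, 0], by
    rw [Matrix.mem_specialUnitaryGroup_iff, Matrix.mem_unitaryGroup_iff]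
    constructor
    · ext i j
      fin_cases i <;> fin_cases j <;>
        simp [Matrix.mul_apply, Fin.sum_univ_two, Matrix.star_apply]
    · simp [Matrix.det_fin_two]⟩

/-- `G` contains `1` and `-1`, and `G / {1, -1}` is isomorphic to `H`. -/
def IsDoubleCoverOf (G : Subgroup SU2) (H : Type) [Group H] : Prop :=
  ∃ π : G →* H, Function.Surjective π ∧
    (fun x : G => ((x : SU2) : Matrix (Fin 2) (Fin 2) ℂ)) '' {x : G | π x = 1} = {1, -1}

/-- The subgroups of `SU₂` under consideration: `SU₂` itself, the cyclic groups `C_n`, the binary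
dihedral groups `D_n`, the binary tetrahedral, octahedral and icosahedral groups
(`T/{±1} ≅ A₄`, `O/{±1} ≅ S₄`, `I/{±1} ≅ A₅`), and the infinite groups `C_∞` and `D_∞`.
The groups `C_1 = {1}` and `C_2 = {1, -1}` are excluded. -/
inductive McKayGroup : Type
  | SU : McKayGroup
  | C (n : ℕ) (ζ : Circle) (hn : 3 ≤ n) (hζ : IsPrimitiveRoot ζ n) : McKayGroup
  | D (n : ℕ) (ζ : Circle) (hn : 2 ≤ n) (hζ : IsPrimitiveRoot ζ (2 * n)) : McKayGroup
  | T (G : Subgroup SU2) (hG : IsDoubleCoverOf G (alternatingGroup (Fin 4))) : McKayGroup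
  | O (G : Subgroup SU2) (hG : IsDoubleCoverOf G (Equiv.Perm (Fin 4))) : McKayGroup
  | I (G : Subgroup SU2) (hG : IsDoubleCoverOf G (alternatingGroup (Fin 5))) : McKayGroup
  | Cinf (ζ : Circle) (hζ : ∀ m : ℕ, 0 < m → ζ ^ m ≠ 1) : McKayGroup
  | Dinf (ζ : Circle) (hζ : ∀ m : ℕ, 0 < m → ζ ^ m ≠ 1) : McKayGroup

/-- The subgroup of `SU₂`. -/
def McKayGroup.toSubgroup : McKayGroup → Subgroup SU2
  | .SU => ⊤
  | .C _ ζ _ _ => Subgroup.zpowers (gElt ζ)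
  | .D _ ζ _ _ => Subgroup.closure {gElt ζ, hElt}
  | .T G _ => G
  | .O G _ => G
  | .I G _ => G
  | .Cinf ζ _ => Subgroup.zpowers (gElt ζ)
  | .Dinf ζ _ => Subgroup.closure {gElt ζ, hElt}

/-- `ñ`, which is `n / 2` for even `n` and `n` for odd `n`. -/
def tilde (n : ℕ) : ℕ := if Even n then n / 2 else n

/-- The table of values of `diam(G)`. -/
def McKayGroup.diam : McKayGroup → ℕ∞
  | .SU => ⊤
  | .C n _ _ _ => (tilde n : ℕ∞)
  | .D n _ _ _ => (n : ℕ∞)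
  | .T _ _ => 4
  | .O _ _ => 6
  | .I _ _ => 7
  | .Cinf _ _ => ⊤
  | .Dinf _ _ => ⊤

/-- The table of values of `br(G)`; there is no branch node for `SU₂`. -/
def McKayGroup.br : McKayGroup → Option ℕ
  | .SU => none
  | .C _ _ _ _ => some 0
  | .D _ _ _ _ => some 1
  | .T _ _ => some 2
  | .O _ _ => some 3
  | .I _ _ => some 5
  | .Cinf _ _ => some 0
  | .Dinf _ _ => some 1

/-- `G` is one of the groups `C_n`, `n ≤ ∞`. -/
def McKayGroup.IsCyclicType : McKayGroup → Prop
  | .C _ _ _ _ => True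
  | .Cinf _ _ => True
  | _ => False

/-- `G^μ` is the one-dimensional module on which `gElt ζ` acts as the scalar `c` and `hElt` acts
as the scalar `d`. -/
def IsLine {G : Subgroup SU2} (ζ : Circle) (c d : ℂ) (μ : Node G) : Prop :=
  μ.irrep.dim = 1 ∧
  (∀ x : G, (x : SU2) = gElt ζ → ∀ v, μ.ρ x v = c • v) ∧
  (∀ x : G, (x : SU2) = hElt → ∀ v, μ.ρ x v = d • v)

end McKay

end

/-! Call a vector of V^{⊗(k+1)} old if it lies in the sum of the isotypic components of types that
already occur in V^{⊗(k-1)}. The symplectic form on V is invariant under SU₂, so V is self-dual and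
tensor factors can be bent: every G-map V^{⊗(k-1)} → V^{⊗(k+1)} is (a ⊗ 1) ∘ `cup` with a in Z_k,
and every G-map in the opposite direction is `cap` ∘ (b ⊗ 1) (`exists_bend`, `exists_bend'`). Since
e_k = `cup` ∘ `cap`, the span Z_k e_k Z_k consists of the sums of endomorphisms that factor through
V^{⊗(k-1)}, and these are exactly the elements of Z_{k+1} that vanish on the new part
(`mem_ZeZ_iff`). Hence Z_{k+1} = Z_k e_k Z_k ⊕ End_G(new part) for every subgroup G and every k, and
(b) says that nothing is new.

All the rest is information on the new part. When it is a sum of c pairwise non-isomorphic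
irreducibles (`MultFree`), its endomorphisms are spanned by c orthogonal idempotents. The unit of
Z_k e_k Z_k is the projection onto the old part, so the sum of these idempotents always lies in
⟨Z_k, e_k⟩. For c = 1 nothing else is needed, for c = 2 one idempotent or any element that is not
scalar on the new part, for c = 3 two idempotents.

The number c is found group by group. For cyclic and dihedral groups, words in the two basis vectors
are eigenvectors of g. From degree three on (for cyclic groups in every degree) all non-constant
words are old, and the constant words are new until the order of ζ² is reached
(`MultFree.of_vectors`). For SU₂ the new part is generated by v₁^{⊗k}. For the polyhedral groups dim
Hom_G(V^{⊗a}, V^{⊗b}) is an average of powers of traces, computed from the orders of elements in A₄,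
S₄, A₅. These dimensions are scalar products of multiplicity vectors, and removing the known nodes
degree by degree leaves the sum of the squares of the new multiplicities.

In (c) two families have c = 2: the cyclic groups, where a matrix unit of lower degree separates the
two lines, and the binary tetrahedral group at k = 3, where a dimension count shows that an
idempotent of Z_3 is not scalar on the new part of V^{⊗4} (`embed_proj_mul_newProj_ne_zero`).

As for distances, a node at distance d from 0 occurs in V^{⊗d}, V^{⊗(d+2)}, and so on. A new node of
degree k+1 therefore has distance k+1 unless it also occurs in V^{⊗k}. The element -1 forbids this,
and for cyclic groups a comparison of eigenvalues does. -/

noncomputable section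

namespace McKay

open scoped TensorProduct

/-! ### Tensor powers built up one factor at a time -/

section

/-! ### Instances on the tensor powers

`V` is also a ring, which makes `V^{⊗k}` a ring; the additive structure is fixed here to be the one
that comes from the module structure. -/

instance instAddCommGroupTP (k : ℕ) : AddCommGroup (TP k) := PiTensorProduct.instAddCommGroup
instance instAddCommMonoidTP (k : ℕ) : AddCommMonoid (TP k) :=
  PiTensorProduct.instAddCommMonoid fun _ => V
instance instAddGroupTP (k : ℕ) : AddGroup (TP k) := (instAddCommGroupTP k).toAddGroup
instance instSubNegMonoidTP (k : ℕ) : SubNegMonoid (TP k) := (instAddGroupTP k).toSubNegMonoid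
instance instAddMonoidTP (k : ℕ) : AddMonoid (TP k) := (instSubNegMonoidTP k).toAddMonoid
instance instAddTP (k : ℕ) : Add (TP k) := (instAddMonoidTP k).toAdd
instance instSubTP (k : ℕ) : Sub (TP k) := (instSubNegMonoidTP k).toSub
instance instNegTP (k : ℕ) : Neg (TP k) := (instSubNegMonoidTP k).toNeg
instance instZeroTP (k : ℕ) : Zero (TP k) := (instAddMonoidTP k).toZero

/-! ### Creation and annihilation of the last tensor factor -/

theorem tprod_ext {k : ℕ} {M : Type*} [AddCommGroup M] [Module ℂ M] {f g : TP k →ₗ[ℂ] M}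
    (h : ∀ a : Fin k → V, f (PiTensorProduct.tprod ℂ a) = g (PiTensorProduct.tprod ℂ a)) :
    f = g :=
  PiTensorProduct.ext (MultilinearMap.ext h)

/-- The map `x ↦ x ⊗ v`. -/
def snocMap (k : ℕ) : V →ₗ[ℂ] TP k →ₗ[ℂ] TP (k + 1) :=
  ((TensorProduct.mk ℂ (TP k) (TP 1)).flip ∘ₗ
    (PiTensorProduct.subsingletonEquiv (R := ℂ) (s := fun _ : Fin 1 => V) 0).symm.toLinearMap).compr₂
    (TensorPower.mulEquiv (R := ℂ) (M := V) (n := k) (m := 1)).toLinearMap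

/-- The map `x ↦ x ⊗ v_i`. -/
def cre {k : ℕ} (i : Fin 2) : TP k →ₗ[ℂ] TP (k + 1) := snocMap k (Pi.single i 1)

/-- The coordinate map `x ⊗ v ↦ v_i x`. -/
def ann {k : ℕ} (i : Fin 2) : TP (k + 1) →ₗ[ℂ] TP k :=
  (TensorProduct.rid ℂ (TP k)).toLinearMap ∘ₗ
    LinearMap.lTensor (TP k) ((LinearMap.proj i : V →ₗ[ℂ] ℂ) ∘ₗ
      (PiTensorProduct.subsingletonEquiv (R := ℂ) (s := fun _ : Fin 1 => V) 0).toLinearMap) ∘ₗ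
    (TensorPower.mulEquiv (R := ℂ) (M := V) (n := k) (m := 1)).symm.toLinearMap

theorem snocMap_tprod {k : ℕ} (v : V) (a : Fin k → V) :
    snocMap k v (PiTensorProduct.tprod ℂ a) =
      PiTensorProduct.tprod ℂ (Fin.snoc (α := fun _ => V) a v) := by
  have h := TensorPower.tprod_mul_tprod (R := ℂ) a (fun _ : Fin 1 => v)
  rw [TensorPower.gMul_def, Fin.append_right_eq_snoc] at h
  rw [← h]
  simp [snocMap]

theorem ann_snocMap {k : ℕ} (i : Fin 2) (v : V) (x : TP k) : ann i (snocMap k v x) = v i • x := by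
  simp [ann, snocMap]

theorem ann_cre {k : ℕ} (i j : Fin 2) :
    (ann i : TP (k + 1) →ₗ[ℂ] TP k) ∘ₗ cre j = if i = j then LinearMap.id else 0 := by
  refine LinearMap.ext fun x => ?_
  simp only [cre, LinearMap.comp_apply, ann_snocMap]
  split_ifs with h
  · subst h; simp
  · simp [h]

@[simp] theorem ann_cre_self {k : ℕ} (i : Fin 2) (x : TP k) : ann i (cre i x) = x := by
  simpa using LinearMap.congr_fun (ann_cre (k := k) i i) x

theorem ann_cre_ne {k : ℕ} {i j : Fin 2} (h : i ≠ j) (x : TP k) : ann i (cre j x) = 0 := by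
  simpa [h] using LinearMap.congr_fun (ann_cre (k := k) i j) x

@[simp] theorem ann_zero_cre_one {k : ℕ} (x : TP k) : ann 0 (cre 1 x) = 0 :=
  ann_cre_ne (by decide) x

@[simp] theorem ann_one_cre_zero {k : ℕ} (x : TP k) : ann 1 (cre 0 x) = 0 :=
  ann_cre_ne (by decide) x

theorem snocMap_eq {k : ℕ} (v : V) (x : TP k) :
    snocMap k v x = v 0 • cre 0 x + v 1 • cre 1 x := by
  have : v = v 0 • Pi.single 0 1 + v 1 • Pi.single 1 1 := by
    ext i; fin_cases i <;> simp
  conv_lhs => rw [this]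
  simp [cre]

/-- Together with `ann_cre` this presents V^{⊗(k+1)} as two copies of V^{⊗k}. Equivariance checks
thereby become computations with the entries of a 2 × 2 matrix, and inductions on the degree become
available. -/
theorem cre_ann {k : ℕ} (x : TP (k + 1)) : cre 0 (ann 0 x) + cre 1 (ann 1 x) = x := by
  have hs : (cre 0 ∘ₗ ann 0 + cre 1 ∘ₗ ann 1 : TP (k + 1) →ₗ[ℂ] TP (k + 1)) = LinearMap.id := by
    refine tprod_ext fun a => ?_
    have ha : a = Fin.snoc (α := fun _ => V) (Fin.init a) (a (Fin.last k)) := by simp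
    simp only [LinearMap.add_apply, LinearMap.comp_apply,
      LinearMap.id_apply]
    rw [ha, ← snocMap_tprod]
    simp only [ann_snocMap, map_smul]
    rw [snocMap_eq]
  simpa using LinearMap.congr_fun hs x

theorem tp_hom_ext {k : ℕ} {M : Type*} [AddCommGroup M] [Module ℂ M] {f g : TP (k + 1) →ₗ[ℂ] M}
    (h : ∀ i x, f (cre i x) = g (cre i x)) : f = g := by
  refine tprod_ext fun a => ?_
  rw [← cre_ann (PiTensorProduct.tprod ℂ a)]
  simp [h]

theorem tp_ext {k : ℕ} {x y : TP (k + 1)} (h : ∀ i, ann i x = ann i y) : x = y := by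
  rw [← cre_ann x, ← cre_ann y, h, h]

/-! ### The group action -/

/-- The matrix entries of an element of `SU₂`. -/
abbrev ent (g : SU2) (i j : Fin 2) : ℂ := (g : Matrix (Fin 2) (Fin 2) ℂ) i j

theorem ent_det (g : SU2) : ent g 0 0 * ent g 1 1 - ent g 0 1 * ent g 1 0 = 1 := by
  have := (Matrix.mem_specialUnitaryGroup_iff.1 g.2).2
  rwa [Matrix.det_fin_two] at this

theorem tensorRep_tprod {G : Subgroup SU2} {k : ℕ} (g : G) (a : Fin k → V) :
    tensorRep G k g (PiTensorProduct.tprod ℂ a) =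
      PiTensorProduct.tprod ℂ fun i => natRep G g (a i) := by
  simp [tensorRep]

theorem tensorRep_snocMap {G : Subgroup SU2} {k : ℕ} (g : G) (v : V) (x : TP k) :
    tensorRep G (k + 1) g (snocMap k v x) = snocMap k (natRep G g v) (tensorRep G k g x) := by
  have hs : tensorRep G (k + 1) g ∘ₗ snocMap k v =
      snocMap k (natRep G g v) ∘ₗ tensorRep G k g := by
    refine tprod_ext fun a => ?_
    simp only [LinearMap.comp_apply, snocMap_tprod,
      tensorRep_tprod]
    congr 1
    ext i : 1
    induction i using Fin.lastCases <;> simp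
  exact LinearMap.congr_fun hs x

theorem tensorRep_cre {G : Subgroup SU2} {k : ℕ} (g : G) (j : Fin 2) (x : TP k) :
    tensorRep G (k + 1) g (cre j x) =
      ent g 0 j • cre 0 (tensorRep G k g x) + ent g 1 j • cre 1 (tensorRep G k g x) := by
  rw [cre, tensorRep_snocMap, snocMap_eq]
  simp [natRep, ent]

theorem ann_tensorRep {G : Subgroup SU2} {k : ℕ} (g : G) (i : Fin 2) (x : TP (k + 1)) :
    ann i (tensorRep G (k + 1) g x) =
      ent g i 0 • tensorRep G k g (ann 0 x) + ent g i 1 • tensorRep G k g (ann 1 x) := by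
  conv_lhs => rw [← cre_ann x]
  simp only [map_add, tensorRep_cre, map_smul]
  fin_cases i <;> simp

theorem tensorRep_zero {G : Subgroup SU2} (g : G) (x : TP 0) : tensorRep G 0 g x = x := by
  have hs : tensorRep G 0 g = LinearMap.id := by
    refine tprod_ext fun a => ?_
    simp only [tensorRep_tprod, LinearMap.id_apply]
    congr 1
    ext i
    exact i.elim0
  rw [hs]; rfl

/-! ### The basis of words -/

theorem tensorBasis_apply {k : ℕ} (r : Fin k → Fin 2) :
    tensorBasis k r = PiTensorProduct.tprod ℂ fun i => (Pi.single (r i) 1 : V) := by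
  simp [tensorBasis, Basis.piTensorProduct_apply]

theorem cre_tensorBasis {k : ℕ} (i : Fin 2) (r : Fin k → Fin 2) :
    cre i (tensorBasis k r) = tensorBasis (k + 1) (Fin.snoc (α := fun _ => Fin 2) r i) := by
  rw [tensorBasis_apply, tensorBasis_apply, cre, snocMap_tprod]
  congr 1
  ext j : 1
  induction j using Fin.lastCases <;> simp

/-! ### The embedding and the operators `e k` -/

theorem embed_cre {k : ℕ} (a : Module.End ℂ (TP k)) (i : Fin 2) (x : TP k) :
    embed k a (cre i x) = cre i (a x) := by
  have h : embed k a = (TensorPower.mulEquiv (R := ℂ) (M := V) (n := k) (m := 1)).toLinearMap ∘ₗ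
      LinearMap.rTensor (TP 1) a ∘ₗ
      (TensorPower.mulEquiv (R := ℂ) (M := V) (n := k) (m := 1)).symm.toLinearMap := rfl
  simp [h, cre, snocMap]

theorem ann_embed {k : ℕ} (a : Module.End ℂ (TP k)) (i : Fin 2) (x : TP (k + 1)) :
    ann i (embed k a x) = a (ann i x) := by
  conv_lhs => rw [← cre_ann x]
  simp only [map_add, embed_cre]
  fin_cases i <;> simp

/-- The map `x ↦ x ⊗ (v₋₁ ⊗ v₁ - v₁ ⊗ v₋₁)`. -/
def cup {k : ℕ} : TP k →ₗ[ℂ] TP (k + 2) := cre 1 ∘ₗ cre 0 - cre 0 ∘ₗ cre 1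

/-- The contraction of the last two factors with the symplectic form. -/
def cap {k : ℕ} : TP (k + 2) →ₗ[ℂ] TP k := ann 0 ∘ₗ ann 1 - ann 1 ∘ₗ ann 0

theorem cup_apply {k : ℕ} (x : TP k) : cup x = cre 1 (cre 0 x) - cre 0 (cre 1 x) := rfl

theorem cap_apply {k : ℕ} (x : TP (k + 2)) : cap x = ann 0 (ann 1 x) - ann 1 (ann 0 x) := rfl

theorem snoc_snoc_swap {k : ℕ} (a : Fin k → V) (u v : V) (i : Fin (k + 2)) :
    Fin.snoc (α := fun _ => V) (Fin.snoc (α := fun _ => V) a u) v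
      (Equiv.swap (⟨k, by omega⟩ : Fin (k + 2)) (Fin.last (k + 1)) i) =
    Fin.snoc (α := fun _ => V) (Fin.snoc (α := fun _ => V) a v) u i := by
  have h1 : (⟨k, by omega⟩ : Fin (k + 2)) = (Fin.last k).castSucc := rfl
  rw [h1]
  induction i using Fin.lastCases with
  | last => simp
  | cast i =>
    induction i using Fin.lastCases with
    | last => simp
    | cast i =>
      rw [Equiv.swap_apply_of_ne_of_ne]
      · simp
      · exact fun h => (Fin.castSucc_lt_last i).ne (Fin.castSucc_injective _ h)
      · exact (Fin.castSucc_lt_last _).ne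

theorem e_snocMap {k : ℕ} (u v : V) (x : TP k) :
    e (k + 1) (snocMap (k + 1) v (snocMap k u x)) =
      snocMap (k + 1) v (snocMap k u x) - snocMap (k + 1) u (snocMap k v x) := by
  have hs : e (k + 1) ∘ₗ snocMap (k + 1) v ∘ₗ snocMap k u =
      snocMap (k + 1) v ∘ₗ snocMap k u - snocMap (k + 1) u ∘ₗ snocMap k v := by
    refine tprod_ext fun a => ?_
    simp only [LinearMap.comp_apply, snocMap_tprod,
      LinearMap.sub_apply, e, Module.End.one_apply, LinearEquiv.coe_coe,
      PiTensorProduct.reindex_tprod]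
    congr 2
    ext i : 1
    rw [Equiv.symm_swap]
    exact snoc_snoc_swap a u v i
  exact LinearMap.congr_fun hs x

theorem e_zero : e 0 = 0 := by
  -- The truncated index `0 - 1` is `0`, so the transposition is trivial.
  have : Equiv.swap (⟨0 - 1, by omega⟩ : Fin (0 + 1)) (Fin.last 0) = Equiv.refl _ :=
    Equiv.swap_self _
  rw [e, this, PiTensorProduct.reindex_refl]
  exact sub_self (1 : Module.End ℂ (TP (0 + 1)))

theorem e_cre {k : ℕ} (i j : Fin 2) (x : TP k) :
    e (k + 1) (cre j (cre i x)) = cre j (cre i x) - cre i (cre j x) :=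
  e_snocMap _ _ x

/-- On two factors the operator 1 - s has the antisymmetric line as its image, so it factors through
the symplectic form. -/
theorem e_succ (k : ℕ) : e (k + 1) = cup ∘ₗ cap := by
  refine tp_hom_ext fun j y => ?_
  have hs : e (k + 1) ∘ₗ cre j = (cup ∘ₗ cap) ∘ₗ cre j := by
    refine tp_hom_ext fun i x => ?_
    simp only [LinearMap.comp_apply, e_cre, cap_apply, cup_apply]
    fin_cases i <;> fin_cases j <;> simp [neg_add_eq_sub]
  exact LinearMap.congr_fun hs y

end

/-! ### Semisimplicity, Schur's lemma and decompositions into irreducibles -/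

section

/-! ### Complete reducibility -/

theorem hom_comm {G W U : Type*} [Group G] [AddCommGroup W] [Module ℂ W] [AddCommGroup U]
    [Module ℂ U] {σ : Representation ℂ G W} {τ : Representation ℂ G U} (f : σ.IntertwiningMap τ)
    (g : G) (x : W) : f (σ g x) = τ g (f x) :=
  LinearMap.congr_fun (f.isIntertwining' g) x

/-- The standard Hermitian form on `V^{⊗k}`. -/
def herm {k : ℕ} (x y : TP k) : ℂ :=
  ∑ r, starRingEnd ℂ ((tensorBasis k).repr x r) * (tensorBasis k).repr y r

theorem tensorBasis_repr_snoc {k : ℕ} (x : TP (k + 1)) (r : Fin k → Fin 2) (i : Fin 2) :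
    (tensorBasis (k + 1)).repr x (Fin.snoc (α := fun _ => Fin 2) r i) =
      (tensorBasis k).repr (ann i x) r := by
  have hs : ((tensorBasis (k + 1)).coord (Fin.snoc (α := fun _ => Fin 2) r i)) =
      (tensorBasis k).coord r ∘ₗ ann i := by
    refine (tensorBasis (k + 1)).ext fun s => ?_
    rw [← Fin.snoc_init_self s, ← cre_tensorBasis]
    simp only [LinearMap.comp_apply]
    rw [cre_tensorBasis]
    simp only [Module.Basis.coord_apply, Module.Basis.repr_self, Finsupp.single_apply]
    rw [← cre_tensorBasis]
    by_cases h : i = s (Fin.last k)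
    · subst h
      simp only [ann_cre_self, Module.Basis.repr_self, Finsupp.single_apply]
      congr 1
      exact propext ⟨fun h => (Fin.snoc_injective2 h).1, fun h => by rw [h]⟩
    · rw [ann_cre_ne h, map_zero, Finsupp.zero_apply, if_neg]
      intro h'
      have := congrFun h' (Fin.last k)
      simp at this
      exact h this.symm
  exact LinearMap.congr_fun hs x

theorem sum_words_succ {k : ℕ} {M : Type*} [AddCommMonoid M] (f : (Fin (k + 1) → Fin 2) → M) :
    ∑ r, f r = ∑ i, ∑ r : Fin k → Fin 2, f (Fin.snoc (α := fun _ => Fin 2) r i) := by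
  rw [← (Fin.snocEquiv fun _ => Fin 2).sum_comp, Fintype.sum_prod_type]
  rfl

theorem herm_succ {k : ℕ} (x y : TP (k + 1)) :
    herm x y = herm (ann 0 x) (ann 0 y) + herm (ann 1 x) (ann 1 y) := by
  simp only [herm]
  rw [sum_words_succ, Fin.sum_univ_two]
  simp only [tensorBasis_repr_snoc]

theorem herm_add_smul {k : ℕ} (a b c d : ℂ) (x y z w : TP k) :
    herm (a • x + b • y) (c • z + d • w) =
      starRingEnd ℂ a * c * herm x z + starRingEnd ℂ a * d * herm x w +
      starRingEnd ℂ b * c * herm y z + starRingEnd ℂ b * d * herm y w := by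
  simp only [herm, Finset.mul_sum, ← Finset.sum_add_distrib]
  refine Finset.sum_congr rfl fun r _ => ?_
  simp
  ring

theorem ent_star_mul (g : SU2) (j l : Fin 2) :
    starRingEnd ℂ (ent g 0 j) * ent g 0 l + starRingEnd ℂ (ent g 1 j) * ent g 1 l =
      if j = l then 1 else 0 := by
  have h := (Matrix.mem_specialUnitaryGroup_iff.1 g.2).1
  rw [Matrix.mem_unitaryGroup_iff'] at h
  have := congrFun (congrFun h j) l
  simpa [Matrix.mul_apply, Fin.sum_univ_two, Matrix.one_apply] using this

/-- Unitarity of g in the last factor reduces the claim to the four pairs of coordinates, where the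
induction hypothesis applies. -/
theorem herm_tensorRep {G : Subgroup SU2} {k : ℕ} (g : G) (x y : TP k) :
    herm (tensorRep G k g x) (tensorRep G k g y) = herm x y := by
  induction k with
  | zero => rw [tensorRep_zero, tensorRep_zero]
  | succ k ih =>
    have h00 := ent_star_mul g 0 0
    have h01 := ent_star_mul g 0 1
    have h10 := ent_star_mul g 1 0
    have h11 := ent_star_mul g 1 1
    simp at h00 h01 h10 h11
    rw [herm_succ, herm_succ x y]
    simp only [ann_tensorRep, herm_add_smul, ih]
    linear_combination (herm (ann 0 x) (ann 0 y)) * h00 + (herm (ann 0 x) (ann 1 y)) * h01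
      + (herm (ann 1 x) (ann 0 y)) * h10 + (herm (ann 1 x) (ann 1 y)) * h11

theorem tensorRep_mul_apply {G : Subgroup SU2} {k : ℕ} (g h : G) (x : TP k) :
    tensorRep G k g (tensorRep G k h x) = tensorRep G k (g * h) x := by
  rw [map_mul]; rfl

/-- Coordinates with respect to the basis of words, as a Euclidean space. -/
def euclid (k : ℕ) : TP k ≃ₗ[ℂ] EuclideanSpace ℂ (Fin k → Fin 2) :=
  (tensorBasis k).equivFun.trans (WithLp.linearEquiv 2 ℂ _).symm

theorem inner_euclid {k : ℕ} (x y : TP k) : inner ℂ (euclid k x) (euclid k y) = herm x y := by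
  simp [euclid, PiLp.inner_apply, herm, mul_comm]

instance finiteDimensional_tp (k : ℕ) : FiniteDimensional ℂ (TP k) :=
  Module.Finite.of_basis (tensorBasis k)

/-- The orthogonal complement of a stable subspace for an invariant Hermitian form is stable, so the
orthogonal projection commutes with the group. This argument also covers the infinite groups, where
a sum over the group makes no sense. -/
theorem exists_equivariant_projection {G : Subgroup SU2} {k : ℕ} (W : Submodule ℂ (TP k))
    (hW : ∀ g, ∀ x ∈ W, tensorRep G k g x ∈ W) :
    ∃ q : (tensorRep G k).IntertwiningMap (tensorRep G k),
      (∀ x, q x ∈ W) ∧ ∀ x ∈ W, q x = x := by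
  set W' : Submodule ℂ (TP k) := ((W.map (euclid k).toLinearMap)ᗮ).comap (euclid k).toLinearMap
    with hW'
  have hmem : ∀ y, y ∈ W' ↔ ∀ x ∈ W, herm x y = 0 := by
    intro y
    simp only [hW', Submodule.mem_comap, Submodule.mem_orthogonal, Submodule.mem_map]
    constructor
    · intro h x hx
      rw [← inner_euclid]
      exact h _ ⟨x, hx, rfl⟩
    · rintro h _ ⟨x, hx, rfl⟩
      simpa [inner_euclid] using h x hx
  have hinv : ∀ g, ∀ x ∈ W', tensorRep G k g x ∈ W' := by
    intro g y hy
    rw [hmem] at hy ⊢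
    intro x hx
    have h1 : x = tensorRep G k g (tensorRep G k g⁻¹ x) := by
      rw [tensorRep_mul_apply]; simp
    rw [h1, herm_tensorRep]
    exact hy _ (hW _ _ hx)
  have hc : IsCompl W W' := by
    have h1 := (W.map (euclid k).toLinearMap).isCompl_orthogonal
    have h2 := (Submodule.orderIsoMapComap (euclid k)).symm.isCompl h1
    have h3 : W = (W.map (euclid k).toLinearMap).comap (euclid k).toLinearMap :=
      (Submodule.comap_map_eq_of_injective (euclid k).injective W).symm
    rw [h3]
    exact h2
  have hp : ∀ x ∈ W, W.projection W' hc x = x := fun x hx =>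
    Submodule.projection_apply_left hc ⟨x, hx⟩
  have hp' : ∀ x ∈ W', W.projection W' hc x = 0 := fun x hx =>
    (Submodule.projection_apply_eq_zero_iff hc).2 hx
  refine ⟨⟨W.projection W' hc, fun g => ?_⟩, fun x => Submodule.projection_apply_mem hc x, hp⟩
  refine LinearMap.ext fun x => ?_
  obtain ⟨y, hy, z, hz, rfl⟩ := Submodule.mem_sup.1 (hc.sup_eq_top ▸ Submodule.mem_top (x := x))
  simp [hp y hy, hp' z hz, hp _ (hW g y hy), hp' _ (hinv g z hz)]

theorem exists_fin_equiv {M : Type*} [AddCommGroup M] [Module ℂ M] [FiniteDimensional ℂ M]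
    (W : Submodule ℂ M) : ∃ n, Nonempty ((Fin n → ℂ) ≃ₗ[ℂ] W) :=
  ⟨_, ⟨(Module.finBasis ℂ W).equivFun.symm⟩⟩

/-! ### Schur's lemma -/

variable {G : Subgroup SU2}

instance Node.isIrreducible (μ : Node G) : μ.ρ.IsIrreducible := μ.irrep.irreducible

theorem Node.eq_of_equiv {μ ν : Node G} (f : μ.ρ.Equiv ν.ρ) : μ = ν := by
  have : μ.irrep ≈ ν.irrep := ⟨f⟩
  rw [← Quotient.out_eq μ, ← Quotient.out_eq ν]
  exact Quotient.sound this

theorem Node.hom_eq_zero {μ ν : Node G} (h : μ ≠ ν) (f : μ.ρ.IntertwiningMap ν.ρ) : f = 0 := by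
  rcases Representation.IsIrreducible.bijective_or_eq_zero f with hf | hf
  · exact absurd (Node.eq_of_equiv (f.ofBijective hf)) h
  · exact hf

theorem Node.hom_scalar {μ : Node G} (f : μ.ρ.IntertwiningMap μ.ρ) : ∃ c : ℂ, ∀ x, f x = c • x := by
  obtain ⟨c, hc⟩ :=
    (Representation.IsIrreducible.algebraMap_intertwiningMap_bijective_of_isAlgClosed (ρ := μ.ρ)).2 f
  exact ⟨c, fun x => by rw [← hc]; simp⟩

theorem Node.nontrivial (μ : Node G) : ∃ x : Fin μ.irrep.dim → ℂ, x ≠ 0 := by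
  by_contra! h
  obtain ⟨A, B, hAB⟩ := (Node.isIrreducible μ).toNontrivial
  apply hAB
  ext x
  rw [h x]
  exact iff_of_true (zero_mem A.toSubmodule) (zero_mem B.toSubmodule)

/-- A decomposition of the projection `p` of a representation into projections onto irreducible
modules. -/
structure Decomp {W : Type} [AddCommGroup W] [Module ℂ W] (σ : Representation ℂ G W)
    (p : W → W) where
  I : Type
  fintype : Fintype I
  decEq : DecidableEq I
  μ : I → Node G
  ι : ∀ i, (μ i).ρ.IntertwiningMap σ
  π : ∀ i, σ.IntertwiningMap (μ i).ρ
  π_ι_self : ∀ i x, π i (ι i x) = x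
  π_ι_ne : ∀ i j x, i ≠ j → π i (ι j x) = 0
  sum_eq : ∀ x, ∑ i, ι i (π i x) = p x

attribute [instance] Decomp.fintype Decomp.decEq

theorem exists_factor {W : Type} [AddCommGroup W] [Module ℂ W] {σ : Representation ℂ G W}
    {U : Type} [AddCommGroup U] [Module ℂ U] {τ : Representation ℂ G U}
    (ι : τ.IntertwiningMap σ) (hι : Function.Injective ι) (q : σ.IntertwiningMap σ)
    (hq : ∀ x, q x ∈ LinearMap.range ι.toLinearMap) :
    ∃ π : σ.IntertwiningMap τ, ∀ x, ι (π x) = q x := by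
  let E := LinearEquiv.ofInjective ι.toLinearMap hι
  have h : ∀ x, ι (E.symm (q.toLinearMap.codRestrict _ hq x)) = q x := fun x =>
    congrArg Subtype.val (E.apply_symm_apply (q.toLinearMap.codRestrict _ hq x))
  refine ⟨⟨E.symm.toLinearMap ∘ₗ q.toLinearMap.codRestrict _ hq, fun g => ?_⟩, h⟩
  refine LinearMap.ext fun x => hι ?_
  simp only [LinearMap.comp_apply, LinearEquiv.coe_coe]
  rw [h, ι.isIntertwining, h, q.isIntertwining]

/-- Nodes are classes of modules in coordinates, so the action on W is transported to ℂⁿ. Minimality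
of W is irreducibility. -/
theorem exists_node_of_minimal {k : ℕ} (W : Submodule ℂ (TP k)) (hW0 : W ≠ ⊥)
    (hW : ∀ g, ∀ x ∈ W, tensorRep G k g x ∈ W)
    (hmin : ∀ U ≤ W, (∀ g, ∀ x ∈ U, tensorRep G k g x ∈ U) → U = ⊥ ∨ U = W) :
    ∃ (μ : Node G) (ι : μ.ρ.IntertwiningMap (tensorRep G k)),
      Function.Injective ι ∧ LinearMap.range ι.toLinearMap = W := by
  obtain ⟨n, ⟨ε⟩⟩ := exists_fin_equiv (M := TP k) W
  let R : Representation ℂ G W :=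
    (⟨W, hW⟩ : Subrepresentation (tensorRep G k)).toRepresentation
  let ρ : Representation ℂ G (Fin n → ℂ) :=
    { toFun := fun g => ε.symm.toLinearMap ∘ₗ R g ∘ₗ ε.toLinearMap
      map_one' := by refine LinearMap.ext fun x => ?_; simp
      map_mul' := fun g h => by refine LinearMap.ext fun x => ?_; simp }
  let f : ρ.IntertwiningMap (tensorRep G k) := ⟨W.subtype ∘ₗ ε.toLinearMap, fun g => by
    refine LinearMap.ext fun x => ?_
    simp only [ρ, LinearMap.comp_apply, LinearEquiv.coe_coe, MonoidHom.coe_mk, OneHom.coe_mk,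
      LinearEquiv.apply_symm_apply]
    rfl⟩
  have hf : Function.Injective f := W.injective_subtype.comp ε.injective
  have hfr : LinearMap.range f.toLinearMap = W := by
    change LinearMap.range (W.subtype ∘ₗ ε.toLinearMap) = W
    rw [LinearMap.range_comp_of_range_eq_top _ (LinearEquiv.range ε), Submodule.range_subtype]
  have hirr : ρ.IsIrreducible := by
    refine { exists_pair_ne := ⟨⊥, ⊤, ?_⟩, eq_bot_or_eq_top := ?_ }
    · intro h
      apply hW0
      rw [← hfr, LinearMap.range_eq_map]
      have h' : (⊥ : Submodule ℂ (Fin n → ℂ)) = ⊤ :=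
        congrArg Subrepresentation.toSubmodule h
      rw [← h', Submodule.map_bot]
    · intro U
      have hle : U.toSubmodule.map f.toLinearMap ≤ W :=
        LinearMap.map_le_range.trans hfr.le
      rcases hmin (U.toSubmodule.map f.toLinearMap) hle (by
        rintro g _ ⟨x, hx, rfl⟩
        exact ⟨ρ g x, U.apply_mem_toSubmodule g hx, hom_comm f g x⟩) with h | h
      · left
        apply Subrepresentation.toSubmodule_injective
        exact Submodule.map_injective_of_injective (f := f.toLinearMap) hf
          (h.trans (Submodule.map_bot f.toLinearMap).symm)
      · right
        apply Subrepresentation.toSubmodule_injective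
        apply Submodule.map_injective_of_injective (f := f.toLinearMap) hf
        rw [h, ← hfr, LinearMap.range_eq_map]
        rfl
  have hocc : ∃ (k : ℕ) (f : ρ.IntertwiningMap (tensorRep G k)), f ≠ 0 := by
    refine ⟨k, f, fun h => hW0 ?_⟩
    rw [← hfr, h]
    simp
  let X : IrrepIn G := ⟨_, ρ, hirr, hocc⟩
  let μ : Node G := Quotient.mk (IrrepIn.setoid G) X
  obtain ⟨φ⟩ : Nonempty (μ.irrep.ρ.Equiv X.ρ) := Quotient.mk_out X
  refine ⟨μ, f.comp φ.toIntertwiningMap, hf.comp φ.toLinearEquiv.injective, ?_⟩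
  refine Eq.trans ?_ hfr
  exact LinearMap.range_comp_of_range_eq_top f.toLinearMap
    (LinearMap.range_eq_top.2 φ.toLinearEquiv.surjective)

theorem exists_minimal_submodule {M : Type*} [AddCommGroup M] [Module ℂ M] [FiniteDimensional ℂ M]
    (P : Submodule ℂ M → Prop) (R : Submodule ℂ M) (hR : R ≠ ⊥) (hP : P R) :
    ∃ W, W ≠ ⊥ ∧ W ≤ R ∧ P W ∧ ∀ U ≤ W, P U → U = ⊥ ∨ U = W := by
  obtain ⟨W, ⟨h1, h2, h3⟩, h⟩ := (wellFounded_lt (α := Submodule ℂ M)).has_min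
    {W | W ≠ ⊥ ∧ W ≤ R ∧ P W} ⟨R, hR, le_rfl, hP⟩
  refine ⟨W, h1, h2, h3, fun U hU hPU => ?_⟩
  by_contra! hc
  exact h U ⟨hc.1, hU.trans h2, hPU⟩ (lt_of_le_of_ne hU hc.2)

/-- Induction on the rank of an equivariant idempotent p: a minimal stable subspace of its image is
split off, and p - ιπ is an equivariant idempotent of smaller rank. Working with idempotents keeps
the induction inside the fixed module V^{⊗k}. -/
theorem exists_decomp_of_idempotent {k : ℕ} : ∀ (n : ℕ)
    (p : (tensorRep G k).IntertwiningMap (tensorRep G k)), (∀ x, p (p x) = p x) →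
    Module.finrank ℂ (LinearMap.range p.toLinearMap) ≤ n → Nonempty (Decomp (tensorRep G k) p) := by
  have hzero : ∀ p : (tensorRep G k).IntertwiningMap (tensorRep G k),
      LinearMap.range p.toLinearMap = ⊥ → Nonempty (Decomp (tensorRep G k) p) := by
    intro p hp
    refine ⟨⟨Empty, inferInstance, inferInstance, Empty.elim, Empty.rec, Empty.rec,
      Empty.rec, Empty.rec, fun x => ?_⟩⟩
    have := LinearMap.congr_fun (LinearMap.range_eq_bot.1 hp) x
    simpa using this.symm
  intro n
  induction n with
  | zero =>
    intro p _ hp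
    exact hzero p (Submodule.finrank_eq_zero.1 (Nat.le_zero.1 hp))
  | succ n ih =>
    intro p hpp hp
    by_cases h0 : LinearMap.range p.toLinearMap = ⊥
    · exact hzero p h0
    obtain ⟨W, hW0, hWR, hW, hmin⟩ := exists_minimal_submodule (M := TP k)
      (fun W => ∀ g, ∀ x ∈ W, tensorRep G k g x ∈ W) _ h0 (by
        rintro g _ ⟨x, rfl⟩
        exact ⟨tensorRep G k g x, hom_comm p g x⟩)
    obtain ⟨μ, ι, hι, hιW⟩ := exists_node_of_minimal W hW0 hW hmin
    obtain ⟨q₀, hq₀W, hq₀⟩ := exists_equivariant_projection W hW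
    have hpW : ∀ x ∈ W, p x = x := fun x hx => by
      obtain ⟨y, rfl⟩ := hWR hx
      exact hpp y
    -- Composing with p makes π vanish on the kernel of p. This is what makes `q` below idempotent
    -- and its summands orthogonal to ι.
    obtain ⟨π, hπ⟩ := exists_factor ι hι (q₀.comp p) (fun x => hιW ▸ hq₀W (p x))
    have hιmem : ∀ y, ι y ∈ W := fun y => hιW ▸ ⟨y, rfl⟩
    have hπι : ∀ y, π (ι y) = y := fun y => hι (by
      rw [hπ]
      change q₀ (p (ι y)) = ι y
      rw [hpW _ (hιmem y), hq₀ _ (hιmem y)])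
    have hπp : ∀ x, π (p x) = π x := fun x => hι (by
      rw [hπ, hπ]
      change q₀ (p (p x)) = q₀ (p x)
      rw [hpp])
    let q : (tensorRep G k).IntertwiningMap (tensorRep G k) := p - ι.comp π
    have hq : ∀ x, q x = p x - ι (π x) := fun x => rfl
    have hqq : ∀ x, q (q x) = q x := fun x => by
      simp only [hq, map_sub, hpp, hπp, hπι, hpW _ (hιmem _)]
      simp
    have hlt : LinearMap.range q.toLinearMap < LinearMap.range p.toLinearMap := by
      refine lt_of_le_of_ne ?_ fun h => ?_
      · rintro _ ⟨x, rfl⟩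
        refine ⟨q x, ?_⟩
        change p (q x) = q x
        simp only [hq, map_sub, hpp, hpW _ (hιmem _)]
      · obtain ⟨y, hy⟩ := μ.nontrivial
        have h1 : ι y ∈ LinearMap.range q.toLinearMap := h ▸ hWR (hιmem y)
        obtain ⟨x, hx⟩ := h1
        have h2 : π (ι y) = π (q x) := congrArg π hx.symm
        rw [hπι, hq, map_sub, hπp, hπι, sub_self] at h2
        exact hy h2
    obtain ⟨D⟩ := ih q hqq (by have := Submodule.finrank_lt_finrank_of_lt hlt; omega)
    have hπq : ∀ i x, D.π i (q x) = D.π i x := fun i x => by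
      rw [← D.sum_eq, map_sum, Finset.sum_eq_single i]
      · rw [D.π_ι_self]
      · intro j _ hj
        exact D.π_ι_ne i j _ hj.symm
      · simp
    have hqι : ∀ i y, q (D.ι i y) = D.ι i y := fun i y => by
      rw [← D.sum_eq, Finset.sum_eq_single i]
      · rw [D.π_ι_self]
      · intro j _ hj
        rw [D.π_ι_ne j i _ hj, map_zero]
      · simp
    have hπD : ∀ j x, π (D.ι j x) = 0 := fun j x => by
      rw [← hqι, hq, map_sub, hπp, hπι, sub_self]
    have hDι : ∀ i x, D.π i (ι x) = 0 := fun i x => by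
      rw [← hπq, hq, hpW _ (hιmem x), hπι, sub_self, map_zero]
    refine ⟨⟨Option D.I, inferInstance, inferInstance, fun i => i.elim μ D.μ,
      fun i => match i with | none => ι | some i => D.ι i,
      fun i => match i with | none => π | some i => D.π i, ?_, ?_, ?_⟩⟩
    · rintro (_ | i) x
      · exact hπι x
      · exact D.π_ι_self i x
    · rintro (_ | i) (_ | j) x hij
      · exact absurd rfl hij
      · exact hπD j x
      · exact hDι i x
      · exact D.π_ι_ne i j x fun h => hij (h ▸ rfl)
    · intro x
      rw [Fintype.sum_option]
      change ι (π x) + ∑ i, D.ι i (D.π i x) = p x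
      rw [D.sum_eq, hq]
      abel

/-- A decomposition of `V^{⊗k}` into irreducible modules. -/
def dec (G : Subgroup SU2) (k : ℕ) : Decomp (tensorRep G k) id :=
  (exists_decomp_of_idempotent _ (.id _) (fun _ => rfl) le_rfl).some

theorem dec_sum {k : ℕ} (x : TP k) : ∑ i, (dec G k).ι i ((dec G k).π i x) = x :=
  (dec G k).sum_eq x

end

/-! ### Old and new parts, and the bending of tensor factors -/

section

variable {G : Subgroup SU2}

/-! ### Isotypic components in terms of a decomposition -/

theorem mem_Z_iff {k : ℕ} {a : Module.End ℂ (TP k)} :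
    a ∈ Z G k ↔ ∀ g x, a (tensorRep G k g x) = tensorRep G k g (a x) := by
  rw [Z, Subalgebra.mem_centralizer_iff]
  constructor
  · intro h g x
    exact (LinearMap.congr_fun (h _ ⟨g, rfl⟩) x).symm
  · rintro h _ ⟨g, rfl⟩
    exact LinearMap.ext fun x => (h g x).symm

theorem hom_mem_Z {k : ℕ} (f : (tensorRep G k).IntertwiningMap (tensorRep G k)) :
    f.toLinearMap ∈ Z G k :=
  mem_Z_iff.2 (hom_comm f)

/-- An element of `Z_k` as an intertwining map. -/
def homOfMemZ {k : ℕ} {a : Module.End ℂ (TP k)} (ha : a ∈ Z G k) :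
    (tensorRep G k).IntertwiningMap (tensorRep G k) :=
  ⟨a, fun g => LinearMap.ext fun x => mem_Z_iff.1 ha g x⟩

@[simp] theorem homOfMemZ_apply {k : ℕ} {a : Module.End ℂ (TP k)} (ha : a ∈ Z G k) (x : TP k) :
    homOfMemZ ha x = a x := rfl

theorem hom_ne_zero_iff {W U : Type*} [AddCommGroup W] [Module ℂ W] [AddCommGroup U] [Module ℂ U]
    {σ : Representation ℂ G W} {τ : Representation ℂ G U} (f : σ.IntertwiningMap τ) :
    f ≠ 0 ↔ ∃ x, f x ≠ 0 := by
  constructor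
  · intro h
    by_contra! hc
    exact h (Representation.IntertwiningMap.ext (LinearMap.ext hc))
  · rintro ⟨x, hx⟩ rfl
    exact hx rfl

theorem exists_π_ne_zero {k : ℕ} {x : TP k} (hx : x ≠ 0) : ∃ i, (dec G k).π i x ≠ 0 := by
  by_contra! h
  apply hx
  rw [← dec_sum (G := G) x]
  exact Finset.sum_eq_zero fun i _ => by rw [h i, map_zero]

theorem Node.eq_of_apply_ne_zero {μ ν : Node G} (f : μ.ρ.IntertwiningMap ν.ρ)
    {x : Fin μ.irrep.dim → ℂ} (hx : f x ≠ 0) : μ = ν := by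
  by_contra h
  rw [Node.hom_eq_zero h f] at hx
  exact hx rfl

theorem mem_Lam_iff {k : ℕ} {μ : Node G} : μ ∈ Lam G k ↔ ∃ i, (dec G k).μ i = μ := by
  constructor
  · rintro ⟨f, hf⟩
    obtain ⟨x, hx⟩ := (hom_ne_zero_iff f).1 hf
    obtain ⟨i, hi⟩ := exists_π_ne_zero (G := G) hx
    exact ⟨i, (Node.eq_of_apply_ne_zero (((dec G k).π i).comp f) hi).symm⟩
  · rintro ⟨i, rfl⟩
    obtain ⟨x, hx⟩ := ((dec G k).μ i).nontrivial
    refine ⟨(dec G k).ι i, (hom_ne_zero_iff _).2 ⟨x, fun h => hx ?_⟩⟩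
    rw [← (dec G k).π_ι_self i x, h, map_zero]

theorem μ_mem_Lam {k : ℕ} (i : (dec G k).I) : (dec G k).μ i ∈ Lam G k := mem_Lam_iff.2 ⟨i, rfl⟩

theorem finite_Lam (G : Subgroup SU2) (k : ℕ) : (Lam G k).Finite := by
  have : Lam G k = Set.range (dec G k).μ := by
    ext μ
    exact mem_Lam_iff
  rw [this]
  exact Set.finite_range _

theorem finite_newNodes (G : Subgroup SU2) (k : ℕ) : (newNodes G k).Finite :=
  (finite_Lam G k).subset Set.sdiff_subset

/-- By semisimplicity and Schur's lemma an irreducible quotient is also a constituent. -/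
theorem mem_Lam_of_hom {k : ℕ} {ν : Node G} (f : (tensorRep G k).IntertwiningMap ν.ρ) {x : TP k}
    (hx : f x ≠ 0) : ν ∈ Lam G k := by
  by_contra hν
  apply hx
  rw [← dec_sum (G := G) x, map_sum]
  refine Finset.sum_eq_zero fun i _ => ?_
  by_contra hne
  exact hν (mem_Lam_iff.2 ⟨i, Node.eq_of_apply_ne_zero (f.comp ((dec G k).ι i)) hne⟩)

theorem mem_Lam_of_apply_ne_zero {k : ℕ} {ν : Node G} (f : ν.ρ.IntertwiningMap (tensorRep G k))
    {x : Fin ν.irrep.dim → ℂ} (hx : f x ≠ 0) : ν ∈ Lam G k :=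
  ⟨f, (hom_ne_zero_iff f).2 ⟨x, hx⟩⟩

theorem exists_retraction {k : ℕ} {ν : Node G} (h : ν ∈ Lam G k) :
    ∃ (f : ν.ρ.IntertwiningMap (tensorRep G k)) (g : (tensorRep G k).IntertwiningMap ν.ρ),
      ∀ x, g (f x) = x := by
  obtain ⟨i, rfl⟩ := mem_Lam_iff.1 h
  exact ⟨(dec G k).ι i, (dec G k).π i, (dec G k).π_ι_self i⟩

/-- By Schur's lemma the projection to a summand annihilates all isotypic components of other types.
So the intrinsic components can be read off from the chosen decomposition. -/
theorem mem_iSup_isotypic_iff {k : ℕ} (S : Set (Node G)) (x : TP k) :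
    x ∈ ⨆ μ ∈ S, isotypic G k μ ↔ ∀ i, (dec G k).μ i ∉ S → (dec G k).π i x = 0 := by
  constructor
  · intro hx i hi
    have hle : ⨆ μ ∈ S, isotypic G k μ ≤ LinearMap.ker ((dec G k).π i).toLinearMap := by
      refine iSup₂_le fun μ hμ => iSup_le fun f => ?_
      rintro _ ⟨y, rfl⟩
      have hne : μ ≠ (dec G k).μ i := fun h => hi (h ▸ hμ)
      have := Node.hom_eq_zero hne (((dec G k).π i).comp f)
      exact congrArg (fun f => f y) this
    exact hle hx
  · intro h
    rw [← dec_sum (G := G) x]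
    refine Submodule.sum_mem _ fun i _ => ?_
    by_cases hi : (dec G k).μ i ∈ S
    · refine Submodule.mem_iSup_of_mem _ (Submodule.mem_iSup_of_mem hi ?_)
      exact Submodule.mem_iSup_of_mem ((dec G k).ι i) ⟨_, rfl⟩
    · rw [h i hi, map_zero]
      exact zero_mem _

theorem μ_mem_old_iff {k : ℕ} (i : (dec G k).I) :
    (dec G k).μ i ∈ oldNodes G k ↔ (dec G k).μ i ∉ newNodes G k := by
  simp [newNodes, μ_mem_Lam i]

theorem mem_oldSpace_iff {k : ℕ} {x : TP k} :
    x ∈ oldSpace G k ↔ ∀ i, (dec G k).μ i ∈ newNodes G k → (dec G k).π i x = 0 := by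
  rw [oldSpace, mem_iSup_isotypic_iff]
  simp only [μ_mem_old_iff, not_not]

theorem mem_newSpace_iff {k : ℕ} {x : TP k} :
    x ∈ newSpace G k ↔ ∀ i, (dec G k).μ i ∉ newNodes G k → (dec G k).π i x = 0 := by
  rw [newSpace, mem_iSup_isotypic_iff]

theorem oldNodes_add_two (k : ℕ) : oldNodes G (k + 2) = Lam G k := by
  ext μ
  constructor
  · rintro ⟨j, hj, h⟩
    obtain rfl : j = k := by omega
    exact h
  · exact fun h => ⟨k, rfl, h⟩

theorem oldNodes_lt_two {k : ℕ} (hk : k < 2) : oldNodes G k = ∅ := by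
  ext μ
  simp only [Set.mem_empty_iff_false, iff_false]
  rintro ⟨j, hj, -⟩
  omega

theorem newSpace_lt_two {k : ℕ} (hk : k < 2) : newSpace G k = ⊤ := by
  refine eq_top_iff.2 fun x _ => mem_newSpace_iff.2 fun i hi => ?_
  exact absurd ⟨μ_mem_Lam i, by rw [oldNodes_lt_two hk]; exact Set.notMem_empty _⟩ hi

/-- The standard way to prove that a vector is old: exhibit an equivariant map from two degrees
lower that reaches it. -/
theorem hom_mem_oldSpace {k : ℕ} (φ : (tensorRep G k).IntertwiningMap (tensorRep G (k + 2)))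
    (x : TP k) : φ x ∈ oldSpace G (k + 2) := by
  refine mem_oldSpace_iff.2 fun i hi => ?_
  by_contra hne
  refine hi.2 ?_
  rw [oldNodes_add_two]
  exact mem_Lam_of_hom (((dec G (k + 2)).π i).comp φ) hne

/-- The dual of `hom_mem_oldSpace`. If a summand has an old type, composing its projection with an
embedding of this type into V^{⊗k} gives a map that detects it. -/
theorem mem_newSpace_iff_hom {k : ℕ} {x : TP (k + 2)} : x ∈ newSpace G (k + 2) ↔
    ∀ ψ : (tensorRep G (k + 2)).IntertwiningMap (tensorRep G k), ψ x = 0 := by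
  rw [mem_newSpace_iff]
  constructor
  · intro h ψ
    rw [← dec_sum (G := G) x, map_sum]
    refine Finset.sum_eq_zero fun i _ => ?_
    by_cases hi : (dec G (k + 2)).μ i ∈ newNodes G (k + 2)
    · by_contra hne
      refine hi.2 ?_
      rw [oldNodes_add_two]
      exact mem_Lam_of_apply_ne_zero (ψ.comp ((dec G (k + 2)).ι i)) hne
    · rw [h i hi, map_zero, map_zero]
  · intro h i hi
    rw [← μ_mem_old_iff, oldNodes_add_two] at hi
    obtain ⟨f, g, hgf⟩ := exists_retraction hi
    rw [← hgf ((dec G (k + 2)).π i x)]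
    have := h (f.comp ((dec G (k + 2)).π i))
    simp only [Representation.IntertwiningMap.comp_apply] at this
    rw [this, map_zero]

/-! ### The projections -/

/-- The projection onto a summand of the decomposition. -/
def proj (G : Subgroup SU2) (k : ℕ) (i : (dec G k).I) : Module.End ℂ (TP k) :=
  (((dec G k).ι i).comp ((dec G k).π i)).toLinearMap

theorem proj_apply {k : ℕ} (i : (dec G k).I) (x : TP k) :
    proj G k i x = (dec G k).ι i ((dec G k).π i x) := rfl

theorem proj_mem_Z {k : ℕ} (i : (dec G k).I) : proj G k i ∈ Z G k := hom_mem_Z _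

open Classical in
/-- The projection onto the new part. -/
def newProj (G : Subgroup SU2) (k : ℕ) : Module.End ℂ (TP k) :=
  ∑ i with (dec G k).μ i ∈ newNodes G k, proj G k i

open Classical in
theorem one_sub_newProj (G : Subgroup SU2) (k : ℕ) :
    1 - newProj G k = ∑ i with (dec G k).μ i ∉ newNodes G k, proj G k i := by
  have h : newProj G k + ∑ i with (dec G k).μ i ∉ newNodes G k, proj G k i = 1 := by
    rw [newProj, Finset.sum_filter_add_sum_filter_not]
    refine LinearMap.ext fun x => ?_
    rw [LinearMap.sum_apply]
    exact dec_sum x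
  rw [← h]
  exact add_sub_cancel_left _ _

theorem newProj_mem_Z {k : ℕ} : newProj G k ∈ Z G k :=
  sum_mem fun i _ => proj_mem_Z i

theorem π_newProj {k : ℕ} {i : (dec G k).I} (hi : (dec G k).μ i ∈ newNodes G k) (x : TP k) :
    (dec G k).π i (newProj G k x) = (dec G k).π i x := by
  classical
  rw [newProj, LinearMap.sum_apply, map_sum, Finset.sum_eq_single i]
  · exact (dec G k).π_ι_self i _
  · intro j _ hj
    exact (dec G k).π_ι_ne i j _ hj.symm
  · simp [hi]

theorem newProj_mem_newSpace {k : ℕ} (x : TP k) : newProj G k x ∈ newSpace G k := by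
  classical
  refine mem_newSpace_iff.2 fun i hi => ?_
  rw [newProj, LinearMap.sum_apply, map_sum]
  refine Finset.sum_eq_zero fun j hj => ?_
  refine (dec G k).π_ι_ne i j _ fun h => hi (h ▸ (Finset.mem_filter.1 hj).2)

theorem sub_newProj_mem_oldSpace {k : ℕ} (x : TP k) : x - newProj G k x ∈ oldSpace G k := by
  refine mem_oldSpace_iff.2 fun i hi => ?_
  rw [map_sub, π_newProj hi, sub_self]

theorem oldSpace_inf_newSpace {k : ℕ} {x : TP k} (h : x ∈ oldSpace G k) (h' : x ∈ newSpace G k) :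
    x = 0 := by
  by_contra hx
  obtain ⟨i, hi⟩ := exists_π_ne_zero (G := G) hx
  by_cases hn : (dec G k).μ i ∈ newNodes G k
  · exact hi (mem_oldSpace_iff.1 h i hn)
  · exact hi (mem_newSpace_iff.1 h' i hn)

theorem newProj_of_mem_newSpace {k : ℕ} {x : TP k} (h : x ∈ newSpace G k) : newProj G k x = x :=
  (sub_eq_zero.1 (oldSpace_inf_newSpace (G := G) (sub_newProj_mem_oldSpace x)
    (sub_mem h (newProj_mem_newSpace x)))).symm

theorem newProj_of_mem_oldSpace {k : ℕ} {x : TP k} (h : x ∈ oldSpace G k) : newProj G k x = 0 := by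
  have := sub_mem h (sub_newProj_mem_oldSpace (G := G) x)
  rw [sub_sub_cancel] at this
  exact oldSpace_inf_newSpace (G := G) this (newProj_mem_newSpace x)

theorem Z_mem_newSpace {k : ℕ} {a : Module.End ℂ (TP k)} (ha : a ∈ Z G k) {x : TP k}
    (hx : x ∈ newSpace G k) : a x ∈ newSpace G k := by
  refine mem_newSpace_iff.2 fun i hi => ?_
  rw [← dec_sum (G := G) x, map_sum, map_sum]
  refine Finset.sum_eq_zero fun j _ => ?_
  by_cases hj : (dec G k).μ j ∈ newNodes G k
  · by_contra hne
    refine hi ?_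
    rwa [← Node.eq_of_apply_ne_zero
      (((dec G k).π i).comp ((homOfMemZ ha).comp ((dec G k).ι j))) hne]
  · rw [mem_newSpace_iff.1 hx j hj]
    simp

theorem Z_mem_oldSpace {k : ℕ} {a : Module.End ℂ (TP k)} (ha : a ∈ Z G k) {x : TP k}
    (hx : x ∈ oldSpace G k) : a x ∈ oldSpace G k := by
  refine mem_oldSpace_iff.2 fun i hi => ?_
  rw [← dec_sum (G := G) x, map_sum, map_sum]
  refine Finset.sum_eq_zero fun j _ => ?_
  by_cases hj : (dec G k).μ j ∈ newNodes G k
  · rw [mem_oldSpace_iff.1 hx j hj]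
    simp
  · by_contra hne
    refine hj ?_
    rwa [Node.eq_of_apply_ne_zero
      (((dec G k).π i).comp ((homOfMemZ ha).comp ((dec G k).ι j))) hne]

theorem mul_newProj_mem_endNew {k : ℕ} {a : Module.End ℂ (TP k)} (ha : a ∈ Z G k) :
    a * newProj G k ∈ endNew G k := by
  refine ⟨mul_mem ha newProj_mem_Z, fun x hx => ?_, fun x => ?_⟩
  · rw [Module.End.mul_apply, newProj_of_mem_oldSpace hx, map_zero]
  · exact Z_mem_newSpace ha (newProj_mem_newSpace x)

theorem mul_newProj_of_mem_endNew {k : ℕ} {a : Module.End ℂ (TP k)} (ha : a ∈ endNew G k) :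
    a * newProj G k = a := by
  refine LinearMap.ext fun x => ?_
  have := ha.2.1 _ (sub_newProj_mem_oldSpace x)
  rw [map_sub, sub_eq_zero] at this
  exact this.symm

/-! ### The ideal generated by `e k` -/

/-- The antisymmetric vector in V ⊗ V is multiplied by det g = 1. -/
theorem cup_tensorRep {k : ℕ} (g : G) (x : TP k) :
    cup (tensorRep G k g x) = tensorRep G (k + 2) g (cup x) := by
  have h := ent_det g
  simp only [cup_apply, map_sub, tensorRep_cre, map_add, map_smul]
  linear_combination (norm := module) (-h) • (cre 1 (cre 0 (tensorRep G k g x)) -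
    cre 0 (cre 1 (tensorRep G k g x)))

theorem cap_tensorRep {k : ℕ} (g : G) (x : TP (k + 2)) :
    cap (tensorRep G (k + 2) g x) = tensorRep G k g (cap x) := by
  have h := ent_det g
  simp only [cap_apply, map_sub, ann_tensorRep, map_add, map_smul]
  linear_combination (norm := module) h • (tensorRep G k g (ann 0 (ann 1 x)) -
    tensorRep G k g (ann 1 (ann 0 x)))

/-- The map `cup` as an intertwining map. -/
def cupHom (G : Subgroup SU2) (k : ℕ) : (tensorRep G k).IntertwiningMap (tensorRep G (k + 2)) :=
  ⟨cup, fun g => LinearMap.ext fun x => cup_tensorRep g x⟩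

/-- The map `cap` as an intertwining map. -/
def capHom (G : Subgroup SU2) (k : ℕ) : (tensorRep G (k + 2)).IntertwiningMap (tensorRep G k) :=
  ⟨cap, fun g => LinearMap.ext fun x => cap_tensorRep g x⟩

/-- The map `f ⊗ 1` for an intertwining map `f`. -/
def tensorOne {j k : ℕ} (f : (tensorRep G j).IntertwiningMap (tensorRep G k)) :
    (tensorRep G (j + 1)).IntertwiningMap (tensorRep G (k + 1)) :=
  ⟨cre 0 ∘ₗ f.toLinearMap ∘ₗ ann 0 + cre 1 ∘ₗ f.toLinearMap ∘ₗ ann 1, fun g => by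
    refine LinearMap.ext fun x => ?_
    simp only [LinearMap.add_apply, LinearMap.comp_apply, ann_tensorRep, map_add, map_smul,
      tensorRep_cre, Representation.IntertwiningMap.toLinearMap_apply, hom_comm]
    module⟩

theorem tensorOne_apply {j k : ℕ} (f : (tensorRep G j).IntertwiningMap (tensorRep G k))
    (x : TP (j + 1)) : tensorOne f x = cre 0 (f (ann 0 x)) + cre 1 (f (ann 1 x)) := rfl

theorem tensorOne_cre {j k : ℕ} (f : (tensorRep G j).IntertwiningMap (tensorRep G k)) (i : Fin 2)
    (x : TP j) : tensorOne f (cre i x) = cre i (f x) := by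
  rw [tensorOne_apply]
  fin_cases i <;> simp

theorem embed_apply {k : ℕ} (a : Module.End ℂ (TP k)) (x : TP (k + 1)) :
    embed k a x = cre 0 (a (ann 0 x)) + cre 1 (a (ann 1 x)) := by
  rw [← cre_ann (embed k a x), ann_embed, ann_embed]

theorem embed_mem_Z {k : ℕ} {a : Module.End ℂ (TP k)} (ha : a ∈ Z G k) :
    embed k a ∈ Z G (k + 1) := by
  have : embed k a = (tensorOne (homOfMemZ ha)).toLinearMap :=
    LinearMap.ext fun x => embed_apply a x
  rw [this]
  exact hom_mem_Z _

theorem Zin_le (G : Subgroup SU2) (k : ℕ) : Zin G k ≤ Z G (k + 1) := by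
  rintro _ ⟨a, ha, rfl⟩
  exact embed_mem_Z ha

theorem e_mem_Z (G : Subgroup SU2) (k : ℕ) : e k ∈ Z G (k + 1) := by
  cases k with
  | zero => rw [e_zero]; exact zero_mem _
  | succ k =>
    rw [e_succ]
    exact hom_mem_Z ((cupHom G k).comp (capHom G k))

/-- Every map `φ : V^{⊗k} → V^{⊗(k+2)}` has the form `(a ⊗ 1) ∘ cup`. -/
theorem exists_bend {k : ℕ} (φ : (tensorRep G k).IntertwiningMap (tensorRep G (k + 2))) :
    ∃ a ∈ Z G (k + 1), ∀ x, embed (k + 1) a (cup x) = φ x := by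
  -- The last factor of the argument is paired, by the symplectic form, with the last factor of the
  -- output of φ. Equivariance is again det g = 1.
  refine ⟨ann 1 ∘ₗ φ.toLinearMap ∘ₗ ann 0 - ann 0 ∘ₗ φ.toLinearMap ∘ₗ ann 1,
    mem_Z_iff.2 fun g x => ?_, fun x => ?_⟩
  · have h := ent_det g
    simp only [LinearMap.sub_apply, LinearMap.comp_apply, ann_tensorRep, map_add, map_smul, map_sub,
      Representation.IntertwiningMap.toLinearMap_apply, hom_comm]
    linear_combination (norm := module) h • (tensorRep G (k + 1) g (ann 1 (φ (ann 0 x))) -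
      tensorRep G (k + 1) g (ann 0 (φ (ann 1 x))))
  · rw [cup_apply, map_sub, embed_cre, embed_cre]
    simp only [LinearMap.sub_apply, LinearMap.comp_apply, ann_cre_self, ann_zero_cre_one,
      ann_one_cre_zero, map_zero, sub_zero, zero_sub, map_neg, sub_neg_eq_add,
      Representation.IntertwiningMap.toLinearMap_apply]
    exact (add_comm _ _).trans (cre_ann _)

/-- Every map `ψ : V^{⊗(k+2)} → V^{⊗k}` has the form `cap ∘ (b ⊗ 1)`. -/
theorem exists_bend' {k : ℕ} (ψ : (tensorRep G (k + 2)).IntertwiningMap (tensorRep G k)) :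
    ∃ b ∈ Z G (k + 1), ∀ x, cap (embed (k + 1) b x) = ψ x := by
  -- One leg of the antisymmetric vector is fed into ψ as its last argument, and the other leg is
  -- appended to the result.
  refine ⟨cre 0 ∘ₗ ψ.toLinearMap ∘ₗ cre 1 - cre 1 ∘ₗ ψ.toLinearMap ∘ₗ cre 0,
    mem_Z_iff.2 fun g x => ?_, fun x => ?_⟩
  · have h := ent_det g
    have h0 := congrArg ψ (tensorRep_cre g 0 x)
    have h1 := congrArg ψ (tensorRep_cre g 1 x)
    simp only [hom_comm, map_add, map_smul] at h0 h1
    simp only [LinearMap.sub_apply, LinearMap.comp_apply, map_sub,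
      Representation.IntertwiningMap.toLinearMap_apply, tensorRep_cre, h0, h1, map_add, map_smul]
    linear_combination (norm := module) (-h) • (cre 0 (ψ (cre 1 (tensorRep G (k + 1) g x))) -
      cre 1 (ψ (cre 0 (tensorRep G (k + 1) g x))))
  · rw [cap_apply, ann_embed, ann_embed]
    simp only [LinearMap.sub_apply, LinearMap.comp_apply, map_sub, ann_cre_self, ann_zero_cre_one,
      ann_one_cre_zero, sub_zero, zero_sub, sub_neg_eq_add,
      Representation.IntertwiningMap.toLinearMap_apply]
    rw [add_comm, ← map_add, cre_ann]

end

/-! ### The splitting of Z_{k+1} and its generators -/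

section

variable {G : Subgroup SU2}

/-- Bending both maps gives (a ⊗ 1) ∘ `cup` ∘ `cap` ∘ (b ⊗ 1), and the two middle factors are `e (k
+ 1)`. -/
theorem comp_mem_ZeZ {k : ℕ} (φ : (tensorRep G k).IntertwiningMap (tensorRep G (k + 2)))
    (ψ : (tensorRep G (k + 2)).IntertwiningMap (tensorRep G k)) :
    (φ.comp ψ).toLinearMap ∈ ZeZ G (k + 1) := by
  obtain ⟨a, ha, haφ⟩ := exists_bend φ
  obtain ⟨b, hb, hbψ⟩ := exists_bend' ψ
  have : (φ.comp ψ).toLinearMap = embed (k + 1) a * e (k + 1) * embed (k + 1) b := by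
    refine LinearMap.ext fun x => ?_
    rw [e_succ]
    change φ (ψ x) = embed (k + 1) a (cup (cap (embed (k + 1) b x)))
    rw [haφ, hbψ]
  rw [this]
  exact Submodule.mul_mem_mul (Submodule.mul_mem_mul ⟨a, ha, rfl⟩
    (Submodule.mem_span_singleton_self _)) ⟨b, hb, rfl⟩

theorem ZeZ_induction {k : ℕ} {p : Module.End ℂ (TP (k + 1)) → Prop}
    (hadd : ∀ a b, p a → p b → p (a + b))
    (hmul : ∀ a ∈ Z G (k + 1), ∀ b ∈ Z G (k + 1), ∀ c : ℂ, p (a * c • e k * b))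
    {a : Module.End ℂ (TP (k + 1))} (ha : a ∈ ZeZ G k) : p a := by
  refine Submodule.mul_induction_on ha (fun m hm b hb => ?_) hadd
  refine Submodule.mul_induction_on (C := fun m => p (m * b)) hm (fun a ha n hn => ?_) ?_
  · obtain ⟨c, rfl⟩ := Submodule.mem_span_singleton.1 hn
    exact hmul a (Zin_le G k ha) b (Zin_le G k hb) c
  · intro x y hx hy
    rw [add_mul]
    exact hadd _ _ hx hy

theorem ZeZ_le_Z {k : ℕ} {a : Module.End ℂ (TP (k + 1))} (ha : a ∈ ZeZ G k) : a ∈ Z G (k + 1) :=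
  ZeZ_induction (p := fun a => a ∈ Z G (k + 1)) (fun _ _ => add_mem)
    (fun _ ha _ hb c => mul_mem (mul_mem ha (Subalgebra.smul_mem _ (e_mem_Z G k) c)) hb) ha

theorem e_apply_newSpace {k : ℕ} {x : TP (k + 1)} (hx : x ∈ newSpace G (k + 1)) : e k x = 0 := by
  cases k with
  | zero => rw [e_zero]; rfl
  | succ k =>
    rw [e_succ, LinearMap.comp_apply]
    have := mem_newSpace_iff_hom.1 hx (capHom G k)
    rw [show cap x = 0 from this, map_zero]

theorem e_mem_oldSpace {k : ℕ} (x : TP (k + 1)) : e k x ∈ oldSpace G (k + 1) := by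
  cases k with
  | zero => rw [e_zero]; exact zero_mem _
  | succ k =>
    rw [e_succ, LinearMap.comp_apply]
    exact hom_mem_oldSpace (cupHom G k) _

theorem ZeZ_apply_newSpace {k : ℕ} {a : Module.End ℂ (TP (k + 1))} (ha : a ∈ ZeZ G k)
    {x : TP (k + 1)} (hx : x ∈ newSpace G (k + 1)) : a x = 0 := by
  refine ZeZ_induction (G := G) (p := fun a => a x = 0) (fun _ _ ha hb => ?_)
    (fun a _ b hb c => ?_) ha
  · rw [LinearMap.add_apply, ha, hb, add_zero]
  · simp [Module.End.mul_apply, e_apply_newSpace (Z_mem_newSpace hb hx)]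

theorem ZeZ_mem_oldSpace {k : ℕ} {a : Module.End ℂ (TP (k + 1))} (ha : a ∈ ZeZ G k)
    (x : TP (k + 1)) : a x ∈ oldSpace G (k + 1) := by
  refine ZeZ_induction (G := G) (p := fun a => a x ∈ oldSpace G (k + 1)) (fun _ _ ha hb => ?_)
    (fun a ha b hb c => ?_) ha
  · exact add_mem ha hb
  · exact Z_mem_oldSpace ha (Submodule.smul_mem _ _ (e_mem_oldSpace _))

/-- An equivariant map that kills the new part is the sum of its restrictions to the old summands,
and each of these factors through the tensor power two degrees lower. -/
theorem mem_ZeZ_iff {k : ℕ} {a : Module.End ℂ (TP (k + 1))} :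
    a ∈ ZeZ G k ↔ a ∈ Z G (k + 1) ∧ ∀ x ∈ newSpace G (k + 1), a x = 0 := by
  classical
  refine ⟨fun h => ⟨ZeZ_le_Z h, fun x hx => ZeZ_apply_newSpace h hx⟩, fun ⟨ha, h⟩ => ?_⟩
  cases k with
  | zero =>
    -- In degree one everything is new, so vanishing on the new part means a = 0.
    have : a = 0 := LinearMap.ext fun x => h x (by
      rw [newSpace_lt_two (by norm_num)]; exact Submodule.mem_top)
    rw [this]
    exact zero_mem _
  | succ k =>
    have h1 : a = a * (1 - newProj G (k + 2)) := by
      refine LinearMap.ext fun x => ?_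
      rw [Module.End.mul_apply, LinearMap.sub_apply, map_sub, h _ (newProj_mem_newSpace x)]
      simp
    rw [h1, one_sub_newProj, Finset.mul_sum]
    refine Submodule.sum_mem _ fun i hi => ?_
    have hi' := (Finset.mem_filter.1 hi).2
    rw [← μ_mem_old_iff, oldNodes_add_two] at hi'
    obtain ⟨f, g, hgf⟩ := exists_retraction hi'
    have h2 : a * proj G (k + 2) i =
        ((((homOfMemZ ha).comp ((dec G (k + 2)).ι i)).comp g).comp
          (f.comp ((dec G (k + 2)).π i))).toLinearMap := by
      refine LinearMap.ext fun x => ?_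
      change a ((dec G (k + 2)).ι i ((dec G (k + 2)).π i x)) =
        a ((dec G (k + 2)).ι i (g (f ((dec G (k + 2)).π i x))))
      rw [hgf]
    rw [h2]
    exact comp_mem_ZeZ _ _

theorem mul_one_sub_newProj_mem_ZeZ {k : ℕ} {a : Module.End ℂ (TP (k + 1))}
    (ha : a ∈ Z G (k + 1)) : a * (1 - newProj G (k + 1)) ∈ ZeZ G k := by
  refine mem_ZeZ_iff.2 ⟨mul_mem ha (sub_mem (one_mem _) newProj_mem_Z), fun x hx => ?_⟩
  rw [Module.End.mul_apply, LinearMap.sub_apply, newProj_of_mem_newSpace hx]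
  simp

/-- Multiplication by `newProj` and by its complement splits every element. Nothing about G enters,
so only the second summand depends on the group. -/
theorem Z_eq_ZeZ_sup_endNew (G : Subgroup SU2) (k : ℕ) : Subalgebra.toSubmodule (Z G (k + 1)) =
    ZeZ G k ⊔ (endNew G (k + 1)).toSubmodule := by
  refine le_antisymm (fun a ha => ?_) (sup_le (fun a ha => ZeZ_le_Z ha) fun a ha => ha.1)
  have h : a = a * (1 - newProj G (k + 1)) + a * newProj G (k + 1) := by
    rw [mul_sub, mul_one, sub_add_cancel]
  rw [h]
  exact Submodule.add_mem_sup (mul_one_sub_newProj_mem_ZeZ ha) (mul_newProj_mem_endNew ha)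

theorem disjoint_ZeZ_endNew (G : Subgroup SU2) (k : ℕ) :
    Disjoint (ZeZ G k) (endNew G (k + 1)).toSubmodule := by
  refine Submodule.disjoint_def.2 fun a ha hb => LinearMap.ext fun x => ?_
  exact oldSpace_inf_newSpace (G := G) (ZeZ_mem_oldSpace ha x) (hb.2.2 x)

theorem ZeZ_mul_endNew {k : ℕ} {a b : Module.End ℂ (TP (k + 1))} (ha : a ∈ ZeZ G k)
    (hb : b ∈ endNew G (k + 1)) : a * b = 0 ∧ b * a = 0 :=
  ⟨LinearMap.ext fun x => ZeZ_apply_newSpace ha (hb.2.2 x),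
    LinearMap.ext fun x => hb.2.1 _ (ZeZ_mem_oldSpace ha x)⟩

/-! ### Multiplicity-free new parts -/

/-- The new part of `V^{⊗k}` is a sum of `c` pairwise non-isomorphic irreducible modules. -/
def MultFree (G : Subgroup SU2) (k c : ℕ) : Prop :=
  (∀ i j, (dec G k).μ i ∈ newNodes G k → (dec G k).μ i = (dec G k).μ j → i = j) ∧
    (newNodes G k).ncard = c

/-- The indices of the new summands. -/
abbrev NewIdx (G : Subgroup SU2) (k : ℕ) : Type := {i : (dec G k).I // (dec G k).μ i ∈ newNodes G k}

instance (k : ℕ) : Fintype (NewIdx G k) := Fintype.ofFinite _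

theorem MultFree.card {k c : ℕ} (h : MultFree G k c) : Nat.card (NewIdx G k) = c := by
  rw [← h.2, ← Nat.card_coe_set_eq]
  refine Nat.card_congr (Equiv.ofBijective (fun i => ⟨(dec G k).μ i.1, i.2⟩) ⟨?_, ?_⟩)
  · intro i j hij
    exact Subtype.ext (h.1 _ _ i.2 (Subtype.ext_iff.1 hij))
  · rintro ⟨μ, hμ⟩
    obtain ⟨i, rfl⟩ := mem_Lam_iff.1 hμ.1
    exact ⟨⟨i, hμ⟩, rfl⟩

theorem proj_mem_endNew {k : ℕ} (i : NewIdx G k) : proj G k i ∈ endNew G k := by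
  refine ⟨proj_mem_Z _, fun x hx => ?_, fun _ => ?_⟩
  · rw [proj_apply, mem_oldSpace_iff.1 hx i i.2, map_zero]
  · refine mem_newSpace_iff.2 fun j hj => ?_
    exact (dec G k).π_ι_ne j i _ fun h => hj (h ▸ i.2)

theorem proj_mul_self {k : ℕ} (i : (dec G k).I) : proj G k i * proj G k i = proj G k i :=
  LinearMap.ext fun _ => congrArg ((dec G k).ι i) ((dec G k).π_ι_self i _)

theorem proj_mul_ne {k : ℕ} {i j : (dec G k).I} (h : i ≠ j) : proj G k i * proj G k j = 0 := by
  refine LinearMap.ext fun x => ?_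
  rw [Module.End.mul_apply, proj_apply, proj_apply, (dec G k).π_ι_ne i j _ h, map_zero]
  rfl

theorem newProj_eq_sum {k : ℕ} : newProj G k = ∑ i : NewIdx G k, proj G k i := by
  classical
  rw [newProj]
  exact Finset.sum_subtype _ (fun i => by simp) _

theorem proj_ne_zero {k : ℕ} (i : (dec G k).I) : proj G k i ≠ 0 := by
  intro h
  obtain ⟨x, hx⟩ := ((dec G k).μ i).nontrivial
  apply hx
  have := LinearMap.congr_fun h ((dec G k).ι i x)
  rw [proj_apply, (dec G k).π_ι_self] at this
  rw [← (dec G k).π_ι_self i x, this]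
  exact map_zero _

/-- No other summand has the type of a new one, so by Schur's lemma an equivariant map sends a new
summand to itself by a scalar. -/
theorem MultFree.mul_proj {k c : ℕ} (h : MultFree G k c) {a : Module.End ℂ (TP k)} (ha : a ∈ Z G k)
    (i : NewIdx G k) : ∃ r : ℂ, a * proj G k i = r • proj G k i := by
  obtain ⟨r, hr⟩ := Node.hom_scalar
    (((dec G k).π i).comp ((homOfMemZ ha).comp ((dec G k).ι i)))
  refine ⟨r, LinearMap.ext fun x => ?_⟩
  rw [Module.End.mul_apply, ← dec_sum (G := G) (a (proj G k i x)), Finset.sum_eq_single i.1]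
  · have := hr ((dec G k).π i x)
    simp only [Representation.IntertwiningMap.comp_apply, homOfMemZ_apply] at this
    rw [proj_apply, this, map_smul]
    rfl
  · intro j _ hj
    by_contra hne
    refine hj (h.1 _ _ i.2 ?_).symm
    refine Node.eq_of_apply_ne_zero (((dec G k).π j).comp ((homOfMemZ ha).comp ((dec G k).ι i)))
      (x := (dec G k).π i x) fun h0 => hne ?_
    simp only [Representation.IntertwiningMap.comp_apply, homOfMemZ_apply] at h0
    rw [proj_apply, h0, map_zero]
  · simp

theorem MultFree.exists_coeff {k c : ℕ} (h : MultFree G k c) {a : Module.End ℂ (TP k)}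
    (ha : a ∈ Z G k) : ∃ r : NewIdx G k → ℂ,
      (∀ i : NewIdx G k, a * proj G k i = r i • proj G k i) ∧ a * newProj G k = ∑ i, r i • proj G k i := by
  choose r hr using fun i => h.mul_proj ha i
  refine ⟨r, hr, ?_⟩
  rw [newProj_eq_sum, Finset.mul_sum]
  exact Finset.sum_congr rfl fun i _ => hr i

theorem MultFree.endNew_eq_span {k c : ℕ} (h : MultFree G k c) : (endNew G k).toSubmodule =
    Submodule.span ℂ (Set.range fun i : NewIdx G k => proj G k i) := by
  refine le_antisymm (fun a ha => ?_) (Submodule.span_le.2 ?_)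
  · obtain ⟨r, -, hr⟩ := h.exists_coeff ha.1
    rw [mul_newProj_of_mem_endNew ha] at hr
    rw [hr]
    exact Submodule.sum_mem _ fun i _ => Submodule.smul_mem _ _ (Submodule.subset_span ⟨i, rfl⟩)
  · rintro _ ⟨i, rfl⟩
    exact proj_mem_endNew i

theorem linearIndependent_proj {k : ℕ} :
    LinearIndependent ℂ fun i : NewIdx G k => proj G k i := by
  rw [Fintype.linearIndependent_iff]
  intro g hg i
  have h := congrArg (fun a => a * proj G k i) hg
  simp only [Finset.sum_mul, smul_mul_assoc, zero_mul] at h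
  rw [Finset.sum_eq_single i] at h
  · rw [proj_mul_self] at h
    exact (smul_eq_zero.1 h).resolve_right (proj_ne_zero _)
  · intro j _ hj
    rw [proj_mul_ne fun h => hj (Subtype.ext h), smul_zero]
  · simp

theorem MultFree.finrank_endNew {k c : ℕ} (h : MultFree G k c) :
    Module.finrank ℂ (endNew G k) = c := by
  change Module.finrank ℂ (endNew G k).toSubmodule = c
  rw [h.endNew_eq_span, finrank_span_eq_card linearIndependent_proj, ← h.card,
    Nat.card_eq_fintype_card]

theorem MultFree.endNew_comm {k c : ℕ} (h : MultFree G k c) {a b : Module.End ℂ (TP k)}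
    (ha : a ∈ endNew G k) (hb : b ∈ endNew G k) : a * b = b * a := by
  obtain ⟨r, hr, har⟩ := h.exists_coeff ha.1
  obtain ⟨s, hs, hbs⟩ := h.exists_coeff hb.1
  rw [mul_newProj_of_mem_endNew ha] at har
  rw [mul_newProj_of_mem_endNew hb] at hbs
  have h1 : a * b = ∑ i, (s i * r i) • proj G k i := by
    rw [hbs, Finset.mul_sum]
    exact Finset.sum_congr rfl fun i _ => by rw [mul_smul_comm, hr, smul_smul]
  have h2 : b * a = ∑ i, (r i * s i) • proj G k i := by
    rw [har, Finset.mul_sum]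
    exact Finset.sum_congr rfl fun i _ => by rw [mul_smul_comm, hs, smul_smul]
  rw [h1, h2]
  exact Finset.sum_congr rfl fun i _ => by rw [mul_comm]

theorem MultFree.isProjOnto {k c : ℕ} (h : MultFree G k c) (i : NewIdx G k) :
    IsProjOnto G k ((dec G k).μ i) (proj G k i) := by
  refine ⟨proj_mul_self _, ⟨(dec G k).ι i, fun x y hxy => ?_, ?_⟩, ?_⟩
  · rw [← (dec G k).π_ι_self i x, hxy, (dec G k).π_ι_self]
  · refine le_antisymm ?_ ?_
    · rintro _ ⟨x, rfl⟩
      exact ⟨(dec G k).π i x, rfl⟩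
    · rintro _ ⟨x, rfl⟩
      exact ⟨(dec G k).ι i x, congrArg ((dec G k).ι i) ((dec G k).π_ι_self i x)⟩
  · ext x
    rw [mem_iSup_isotypic_iff, LinearMap.mem_ker, proj_apply]
    simp only [Set.mem_ofPred_eq, not_not]
    constructor
    · intro hx j hj
      obtain rfl := h.1 _ _ i.2 hj.symm
      rw [← (dec G k).π_ι_self i ((dec G k).π i x), hx, map_zero]
    · intro hx
      rw [hx i rfl, map_zero]

/-! ### Generation -/

section Generation

variable {k c : ℕ} {A : Subalgebra ℂ (Module.End ℂ (TP (k + 1)))}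

theorem ZeZ_le_subalgebra (h1 : Zin G k ≤ A) (h2 : e k ∈ A) :
    ZeZ G k ≤ Subalgebra.toSubmodule A := by
  rw [ZeZ]
  refine Submodule.mul_le.2 fun m hm b hb => A.mul_mem (?_ : m ∈ Subalgebra.toSubmodule A) (h1 hb)
  refine (Submodule.mul_le (P := Subalgebra.toSubmodule A)).2 (fun a ha n hn => ?_) hm
  obtain ⟨r, rfl⟩ := Submodule.mem_span_singleton.1 hn
  exact A.mul_mem (h1 ha) (A.smul_mem h2 r)

/-- The projection 1 - `newProj` onto the old part vanishes on the new part, so it already lies in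
the span of the products a e_k b. -/
theorem newProj_mem_subalgebra (h1 : Zin G k ≤ A) (h2 : e k ∈ A) : newProj G (k + 1) ∈ A := by
  have h := ZeZ_le_subalgebra h1 h2 (mul_one_sub_newProj_mem_ZeZ (G := G) (k := k) (one_mem _))
  rw [one_mul] at h
  have := A.sub_mem A.one_mem h
  rwa [sub_sub_cancel] at this

theorem MultFree.Z_eq (h : MultFree G (k + 1) c) (hA : A ≤ Z G (k + 1)) (h1 : Zin G k ≤ A)
    (h2 : e k ∈ A) (h3 : ∀ i : NewIdx G (k + 1), proj G (k + 1) i ∈ A) : Z G (k + 1) = A := by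
  refine le_antisymm (Subalgebra.toSubmodule.le_iff_le.1 ?_) hA
  rw [Z_eq_ZeZ_sup_endNew, h.endNew_eq_span]
  refine sup_le (ZeZ_le_subalgebra h1 h2) (Submodule.span_le.2 ?_)
  rintro _ ⟨i, rfl⟩
  exact h3 i

theorem MultFree.Z_eq_of_one (h : MultFree G (k + 1) 1) (hA : A ≤ Z G (k + 1)) (h1 : Zin G k ≤ A)
    (h2 : e k ∈ A) : Z G (k + 1) = A := by
  refine h.Z_eq hA h1 h2 fun i => ?_
  have hs : Subsingleton (NewIdx G (k + 1)) := (Nat.card_eq_one_iff_unique.1 h.card).1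
  have := newProj_mem_subalgebra h1 h2
  rwa [newProj_eq_sum, Fintype.sum_subsingleton _ i] at this

theorem MultFree.newProj_eq_of_two (h : MultFree G k 2) {i j : NewIdx G k} (hij : i ≠ j) :
    newProj G k = proj G k i + proj G k j := by
  classical
  have hu : (Finset.univ : Finset (NewIdx G k)) = {i, j} := by
    refine (Finset.eq_univ_of_card _ ?_).symm
    rw [Finset.card_pair hij, ← Nat.card_eq_fintype_card, h.card]
  rw [newProj_eq_sum, hu, Finset.sum_pair hij]

theorem MultFree.Z_eq_of_two (h : MultFree G (k + 1) 2) (hA : A ≤ Z G (k + 1)) (h1 : Zin G k ≤ A)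
    (h2 : e k ∈ A) {i : NewIdx G (k + 1)} (hi : proj G (k + 1) i ∈ A) : Z G (k + 1) = A := by
  refine h.Z_eq hA h1 h2 fun j => ?_
  by_cases hij : i = j
  · rwa [← hij]
  · have := A.sub_mem (newProj_mem_subalgebra h1 h2) hi
    rwa [h.newProj_eq_of_two hij, add_sub_cancel_left] at this

/-- If d acts on the two new summands by distinct scalars r and s, then (r - s)⁻¹ (d - s) `newProj`
is one of the two idempotents. -/
theorem MultFree.Z_eq_of_separating (h : MultFree G (k + 1) 2) (hA : A ≤ Z G (k + 1))
    (h1 : Zin G k ≤ A) (h2 : e k ∈ A) {d : Module.End ℂ (TP (k + 1))} (hd : d ∈ A)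
    (hd' : ∀ r : ℂ, d * newProj G (k + 1) ≠ r • newProj G (k + 1)) : Z G (k + 1) = A := by
  obtain ⟨i, j, hij⟩ : ∃ i j : NewIdx G (k + 1), i ≠ j := by
    have : Nontrivial (NewIdx G (k + 1)) := by
      rw [← Finite.one_lt_card_iff_nontrivial, h.card]
      norm_num
    exact exists_pair_ne _
  obtain ⟨r, hr, hdr⟩ := h.exists_coeff (hA hd)
  have hne : r i - r j ≠ 0 := by
    intro h0
    apply hd' (r i)
    rw [h.newProj_eq_of_two hij, mul_add, hr, hr, smul_add, sub_eq_zero.1 h0]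
  refine h.Z_eq_of_two hA h1 h2 (i := i) ?_
  have hn := newProj_mem_subalgebra h1 h2
  have := A.smul_mem (A.sub_mem (A.mul_mem hd hn) (A.smul_mem hn (r j))) (r i - r j)⁻¹
  convert this using 1
  rw [h.newProj_eq_of_two hij, mul_add, hr, hr, smul_add, add_sub_add_right_eq_sub]
  refine LinearMap.ext fun x => ?_
  simp only [LinearMap.smul_apply, LinearMap.sub_apply]
  rw [← sub_smul, smul_smul, inv_mul_cancel₀ hne, one_smul]

theorem MultFree.Z_eq_of_three (h : MultFree G (k + 1) 3) (hA : A ≤ Z G (k + 1))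
    (h1 : Zin G k ≤ A) (h2 : e k ∈ A) {i j : NewIdx G (k + 1)} (hij : i ≠ j)
    (hi : proj G (k + 1) i ∈ A) (hj : proj G (k + 1) j ∈ A) : Z G (k + 1) = A := by
  classical
  refine h.Z_eq hA h1 h2 fun l => ?_
  by_cases hil : i = l
  · rwa [← hil]
  by_cases hjl : j = l
  · rwa [← hjl]
  have hu : (Finset.univ : Finset (NewIdx G (k + 1))) = {i, j, l} := by
    refine (Finset.eq_univ_of_card _ ?_).symm
    rw [Finset.card_insert_of_notMem (by simp [hij, hil]), Finset.card_pair hjl,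
      ← Nat.card_eq_fintype_card, h.card]
  have := A.sub_mem (A.sub_mem (newProj_mem_subalgebra h1 h2) hi) hj
  rwa [newProj_eq_sum, hu, Finset.sum_insert (by simp [hij, hil]), Finset.sum_pair hjl,
    add_sub_cancel_left, add_sub_cancel_left] at this

end Generation

theorem adjoin_le_Z {k : ℕ} {S : Set (Module.End ℂ (TP (k + 1)))}
    (hS : ∀ a ∈ S, a ∈ Z G (k + 1)) :
    Algebra.adjoin ℂ ((Zin G k : Set (Module.End ℂ (TP (k + 1)))) ∪ S) ≤ Z G (k + 1) := by
  refine Algebra.adjoin_le ?_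
  rintro a (ha | ha)
  · exact Zin_le G k ha
  · exact hS a ha

theorem Zin_le_adjoin {k : ℕ} (S : Set (Module.End ℂ (TP (k + 1)))) :
    Zin G k ≤ Algebra.adjoin ℂ ((Zin G k : Set (Module.End ℂ (TP (k + 1)))) ∪ S) :=
  fun _ ha => Algebra.subset_adjoin (Or.inl ha)

theorem mem_adjoin_of_mem {k : ℕ} {S : Set (Module.End ℂ (TP (k + 1)))}
    {a : Module.End ℂ (TP (k + 1))} (ha : a ∈ S) :
    a ∈ Algebra.adjoin ℂ ((Zin G k : Set (Module.End ℂ (TP (k + 1)))) ∪ S) :=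
  Algebra.subset_adjoin (Or.inr ha)

theorem MultFree.Z_eq_adjoin_e {k : ℕ} (h : MultFree G (k + 1) 1) :
    Z G (k + 1) = Algebra.adjoin ℂ ((Zin G k : Set _) ∪ {e k}) :=
  h.Z_eq_of_one (adjoin_le_Z (by rintro _ rfl; exact e_mem_Z G k)) (Zin_le_adjoin _)
    (mem_adjoin_of_mem rfl)

theorem NewIdx.exists_of_mem {k : ℕ} {μ : Node G} (hμ : μ ∈ newNodes G k) :
    ∃ i : NewIdx G k, (dec G k).μ i = μ := by
  obtain ⟨i, rfl⟩ := mem_Lam_iff.1 hμ.1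
  exact ⟨⟨i, hμ⟩, rfl⟩

theorem MultFree.exists_proj_of_two {k : ℕ} (h : MultFree G (k + 1) 2) {μ : Node G}
    (hμ : μ ∈ newNodes G (k + 1)) : ∃ f, IsProjOnto G (k + 1) μ f ∧
      Z G (k + 1) = Algebra.adjoin ℂ ((Zin G k : Set _) ∪ {e k, f}) := by
  obtain ⟨i, rfl⟩ := NewIdx.exists_of_mem hμ
  refine ⟨proj G (k + 1) i, h.isProjOnto i, h.Z_eq_of_two (adjoin_le_Z ?_) (Zin_le_adjoin _)
    (mem_adjoin_of_mem (Or.inl rfl)) (i := i) (mem_adjoin_of_mem (Or.inr rfl))⟩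
  rintro _ (rfl | rfl)
  · exact e_mem_Z G k
  · exact proj_mem_Z _

theorem MultFree.exists_proj_of_three {k : ℕ} (h : MultFree G (k + 1) 3) {μ₁ μ₂ : Node G}
    (hμ₁ : μ₁ ∈ newNodes G (k + 1)) (hμ₂ : μ₂ ∈ newNodes G (k + 1)) (hne : μ₁ ≠ μ₂) :
    ∃ f₁ f₂, IsProjOnto G (k + 1) μ₁ f₁ ∧ IsProjOnto G (k + 1) μ₂ f₂ ∧
      Z G (k + 1) = Algebra.adjoin ℂ ((Zin G k : Set _) ∪ {e k, f₁, f₂}) := by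
  obtain ⟨i, rfl⟩ := NewIdx.exists_of_mem hμ₁
  obtain ⟨j, rfl⟩ := NewIdx.exists_of_mem hμ₂
  refine ⟨proj G (k + 1) i, proj G (k + 1) j, h.isProjOnto i, h.isProjOnto j,
    h.Z_eq_of_three (adjoin_le_Z ?_) (Zin_le_adjoin _) (mem_adjoin_of_mem (Or.inl rfl))
      (i := i) (j := j) (fun h => hne (by rw [h])) (mem_adjoin_of_mem (Or.inr (Or.inl rfl)))
      (mem_adjoin_of_mem (Or.inr (Or.inr rfl)))⟩
  rintro _ (rfl | rfl | rfl)
  · exact e_mem_Z G k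
  · exact proj_mem_Z _
  · exact proj_mem_Z _

/-! ### Vanishing of the new part -/

theorem newNodes_eq_empty_iff {k : ℕ} : newNodes G k = ∅ ↔ newProj G k = 0 := by
  constructor
  · intro h
    have : IsEmpty (NewIdx G k) := ⟨fun i => by simpa [h] using i.2⟩
    rw [newProj_eq_sum, Fintype.sum_empty]
  · intro h
    refine Set.eq_empty_of_forall_notMem fun μ hμ => ?_
    obtain ⟨i, rfl⟩ := NewIdx.exists_of_mem hμ
    obtain ⟨x, hx⟩ := ((dec G k).μ i).nontrivial
    apply hx
    rw [← (dec G k).π_ι_self i x, ← π_newProj i.2, h]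
    simp

theorem newNodes_eq_empty_of_oldSpace {k : ℕ} (h : oldSpace G k = ⊤) : newNodes G k = ∅ :=
  newNodes_eq_empty_iff.2 (LinearMap.ext fun x =>
    newProj_of_mem_oldSpace (by rw [h]; exact Submodule.mem_top))

theorem Z_eq_ZeZ_of_empty {k : ℕ} (h : newNodes G (k + 1) = ∅) :
    Subalgebra.toSubmodule (Z G (k + 1)) = ZeZ G k := by
  rw [newNodes_eq_empty_iff] at h
  refine le_antisymm (fun a ha => ?_) (fun a ha => ZeZ_le_Z ha)
  have := mul_one_sub_newProj_mem_ZeZ (G := G) ha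
  rwa [h, sub_zero, mul_one] at this

/-- If f is a G-map out of V^{⊗k}, then f ⊗ 1 is a G-map out of V^{⊗(k+1)}. So old vectors stay old
after a factor is appended. -/
theorem cre_mem_oldSpace {k : ℕ} {x : TP (k + 2)} (hx : x ∈ oldSpace G (k + 2)) (i : Fin 2) :
    cre i x ∈ oldSpace G (k + 3) := by
  rw [← dec_sum (G := G) x, map_sum]
  refine Submodule.sum_mem _ fun j _ => ?_
  by_cases hj : (dec G (k + 2)).μ j ∈ newNodes G (k + 2)
  · rw [mem_oldSpace_iff.1 hx j hj]
    simp
  · rw [← μ_mem_old_iff, oldNodes_add_two] at hj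
    obtain ⟨f, g, hgf⟩ := exists_retraction hj
    have h := tensorOne_cre (((dec G (k + 2)).ι j).comp g) i (f ((dec G (k + 2)).π j x))
    simp only [Representation.IntertwiningMap.comp_apply, hgf] at h
    rw [← h]
    exact hom_mem_oldSpace _ _

/-- Once everything is old it remains so. Hence (b) only has to be checked at k = diam(G). -/
theorem newNodes_succ_eq_empty {k : ℕ} (h : newNodes G (k + 2) = ∅) :
    newNodes G (k + 3) = ∅ := by
  refine newNodes_eq_empty_of_oldSpace (eq_top_iff.2 fun x _ => ?_)
  have hmem : ∀ y : TP (k + 2), y ∈ oldSpace G (k + 2) := fun y => by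
    have := sub_newProj_mem_oldSpace (G := G) y
    rwa [newNodes_eq_empty_iff.1 h, LinearMap.zero_apply, sub_zero] at this
  rw [← cre_ann x]
  exact add_mem (cre_mem_oldSpace (hmem _) 0) (cre_mem_oldSpace (hmem _) 1)

theorem newNodes_eq_empty_of_le {k l : ℕ} (h : newNodes G (k + 2) = ∅) (hkl : k ≤ l) :
    newNodes G (l + 2) = ∅ := by
  induction l, hkl using Nat.le_induction with
  | base => exact h
  | succ l _ ih => exact newNodes_succ_eq_empty ih

end

/-! ### Counting new summands by means of explicit vectors -/

section

variable {G : Subgroup SU2}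

/-! ### A criterion for multiplicity-freeness -/

theorem Node.mem_span_of_line {μ : Node G} {y : Fin μ.irrep.dim → ℂ} (hy : y ≠ 0)
    (h : ∀ g, μ.ρ g y ∈ Submodule.span ℂ {y}) (z : Fin μ.irrep.dim → ℂ) :
    z ∈ Submodule.span ℂ {y} := by
  let U : Subrepresentation μ.ρ := ⟨Submodule.span ℂ {y}, fun g v hv => by
    obtain ⟨r, rfl⟩ := Submodule.mem_span_singleton.1 hv
    rw [map_smul]
    exact Submodule.smul_mem _ _ (h g)⟩
  rcases (Node.isIrreducible μ).eq_bot_or_eq_top U with hU | hU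
  · have : y ∈ (⊥ : Subrepresentation μ.ρ) := by
      rw [← hU]
      exact Submodule.mem_span_singleton_self y
    exact absurd ((Submodule.mem_bot ℂ).1 this) hy
  · have : z ∈ (⊤ : Subrepresentation μ.ρ) := Submodule.mem_top (R := ℂ)
    rwa [← hU] at this

/-- `G` acts on the line spanned by `x`. -/
def IsStableLine (G : Subgroup SU2) {k : ℕ} (x : TP k) : Prop :=
  ∀ g, tensorRep G k g x ∈ Submodule.span ℂ {x}

theorem IsStableLine.hom {k : ℕ} {x : TP k} (hx : IsStableLine G x) {μ : Node G}
    (f : (tensorRep G k).IntertwiningMap μ.ρ) (g : G) : μ.ρ g (f x) ∈ Submodule.span ℂ {f x} := by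
  obtain ⟨r, hr⟩ := Submodule.mem_span_singleton.1 (hx g)
  rw [← hom_comm f, ← hr, map_smul]
  exact Submodule.smul_mem _ _ (Submodule.mem_span_singleton_self _)

theorem MultFree.of_card {k c : ℕ}
    (h : ∀ i j, (dec G k).μ i ∈ newNodes G k → (dec G k).μ i = (dec G k).μ j → i = j)
    (hc : Nat.card (NewIdx G k) = c) : MultFree G k c := by
  have h' : MultFree G k (newNodes G k).ncard := ⟨h, rfl⟩
  rw [h'.card] at hc
  exact hc ▸ h'

/-- A new vector that is an eigenvector of all of `Z G k` lies in a single summand, and its type has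
no second copy, since otherwise an endomorphism would move the vector. Two of the vectors cannot
share a summand: one of them spans a stable line, which would be the whole summand. By `hgen` the
vectors reach every new summand. Hence vectors and new summands correspond bijectively. -/
theorem MultFree.of_vectors {k c : ℕ} (x : Fin c → TP k) (hnew : ∀ a, x a ∈ newSpace G k)
    (hne : ∀ a, x a ≠ 0) (hmult : ∀ a, ∀ T ∈ Z G k, ∃ r : ℂ, T (x a) = r • x a)
    (hspan : ∀ a b, a ≠ b → x b ∉ Submodule.span ℂ {x a})
    (hline : ∀ a b, a ≠ b → IsStableLine G (x a) ∨ IsStableLine G (x b))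
    (hgen : ∀ (μ : Node G) (f : (tensorRep G k).IntertwiningMap μ.ρ),
      (∀ y ∈ oldSpace G k, f y = 0) → (∀ a, f (x a) = 0) → ∀ y, f y = 0) :
    MultFree G k c := by
  -- Here f is any map to the type of i, not only the projection. As ι ∘ f scales `x a` by a
  -- non-zero number, `x a` lies in the image of ι. The freedom in f is what excludes a second copy
  -- of the type.
  have hrange : ∀ (i : (dec G k).I) (f : (tensorRep G k).IntertwiningMap ((dec G k).μ i).ρ) a,
      f (x a) ≠ 0 → (dec G k).ι i ((dec G k).π i (x a)) = x a := by
    intro i f a hf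
    obtain ⟨r, hr⟩ := hmult a _ (hom_mem_Z (((dec G k).ι i).comp f))
    change (dec G k).ι i (f (x a)) = r • x a at hr
    have hr0 : r ≠ 0 := by
      rintro rfl
      rw [zero_smul] at hr
      apply hf
      rw [← (dec G k).π_ι_self i (f (x a)), hr, map_zero]
    have : x a = (dec G k).ι i (r⁻¹ • f (x a)) := by
      rw [map_smul, hr, smul_smul, inv_mul_cancel₀ hr0, one_smul]
    rw [this, (dec G k).π_ι_self]
  have hnot : ∀ (i : (dec G k).I) a b, a ≠ b → IsStableLine G (x a) →
      (dec G k).ι i ((dec G k).π i (x a)) = x a → (dec G k).ι i ((dec G k).π i (x b)) = x b →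
      False := by
    intro i a b hab hl ha hb
    have h0 : (dec G k).π i (x a) ≠ 0 := fun h => hne a (by rw [← ha, h, map_zero])
    obtain ⟨r, hr⟩ := Submodule.mem_span_singleton.1
      (Node.mem_span_of_line h0 (hl.hom _) ((dec G k).π i (x b)))
    apply hspan a b hab
    rw [← hb, ← hr, map_smul, ha]
    exact Submodule.smul_mem _ _ (Submodule.mem_span_singleton_self _)
  have hnot' : ∀ (i : (dec G k).I) a b, (dec G k).ι i ((dec G k).π i (x a)) = x a →
      (dec G k).ι i ((dec G k).π i (x b)) = x b → a = b := by
    intro i a b ha hb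
    by_contra hab
    rcases hline a b hab with h | h
    · exact hnot i a b hab h ha hb
    · exact hnot i b a (Ne.symm hab) h hb ha
  have hex : ∀ i : (dec G k).I, (dec G k).μ i ∈ newNodes G k → ∃ a, (dec G k).π i (x a) ≠ 0 := by
    intro i hi
    by_contra! h
    obtain ⟨y, hy⟩ := ((dec G k).μ i).nontrivial
    apply hy
    rw [← (dec G k).π_ι_self i y]
    exact hgen _ _ (fun z hz => mem_oldSpace_iff.1 hz i hi) h _
  have huniq : ∀ i j a, (dec G k).π i (x a) ≠ 0 → (dec G k).π j (x a) ≠ 0 → i = j := by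
    intro i j a hi hj
    by_contra hij
    apply hi
    rw [← hrange j _ a hj, (dec G k).π_ι_ne i j _ hij]
  have hex' : ∀ a, ∃ i : NewIdx G k, (dec G k).π i (x a) ≠ 0 := by
    intro a
    obtain ⟨i, hi⟩ := exists_π_ne_zero (G := G) (hne a)
    refine ⟨⟨i, ?_⟩, hi⟩
    by_contra h
    exact hi (mem_newSpace_iff.1 (hnew a) i h)
  choose s hs using hex'
  refine MultFree.of_card (fun i j hi hij => ?_) ?_
  · obtain ⟨a, ha⟩ := hex i hi
    obtain ⟨b, hb⟩ := hex j (hij ▸ hi)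
    have hf : ∃ f : (tensorRep G k).IntertwiningMap ((dec G k).μ i).ρ, f (x b) ≠ 0 := by
      rw [hij]
      exact ⟨_, hb⟩
    obtain ⟨f, hf⟩ := hf
    obtain rfl := hnot' i a b (hrange i _ a ha) (hrange i f b hf)
    exact huniq i j a ha hb
  · rw [← Nat.card_fin c]
    refine (Nat.card_congr (Equiv.ofBijective s ⟨fun a b hab => ?_, fun i => ?_⟩)).symm
    · exact hnot' (s a) a b (hrange _ _ a (hs a)) (hrange _ _ b (hab ▸ hs b))
    · obtain ⟨a, ha⟩ := hex i i.2
      exact ⟨a, Subtype.ext (huniq _ _ a (hs a) ha)⟩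

/-! ### The algebras `Z_0` and `Z_1` -/

instance nontrivial_tp (k : ℕ) : Nontrivial (TP k) :=
  ⟨⟨tensorBasis k fun _ => 0, 0, (tensorBasis k).ne_zero _⟩⟩

theorem Z_zero_eq_bot (G : Subgroup SU2) : Z G 0 = ⊥ := by
  have h1 : Module.finrank ℂ (TP 0) = 1 := by
    rw [Module.finrank_eq_card_basis (tensorBasis 0)]
    simp
  refine eq_bot_iff.2 fun a _ => ?_
  obtain ⟨r, hr⟩ := (LinearMap.existsUnique_eq_smul_id_of_finrank_eq_one h1 a).exists
  exact Algebra.mem_bot.2 ⟨r, by rw [hr]; rfl⟩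

/-- The case k = 0 of the generation statement: e_0 = 0 and Z_0 consists of scalars, so nothing but
scalars is generated. -/
theorem Z_one_eq_bot (h : MultFree G 1 1) :
    Z G 1 = ⊥ ∧ Nonempty (Z G 1 ≃ₐ[ℂ] Z G 0) := by
  have h1 : Z G 1 = ⊥ := by
    refine h.Z_eq_of_one (k := 0) bot_le ?_ (e_zero ▸ zero_mem _)
    rw [Zin, Z_zero_eq_bot, Algebra.map_bot]
  rw [h1, Z_zero_eq_bot]
  exact ⟨rfl, ⟨(Algebra.botEquiv ℂ _).trans (Algebra.botEquiv ℂ _).symm⟩⟩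

/-! ### Generators -/

theorem commutes_of_generators {S : Set SU2} (hG : G = Subgroup.closure S) {W U : Type*}
    [AddCommGroup W] [Module ℂ W] [AddCommGroup U] [Module ℂ U] {σ : Representation ℂ G W}
    {τ : Representation ℂ G U} (f : W →ₗ[ℂ] U)
    (h : ∀ x : G, (x : SU2) ∈ S → ∀ v, f (σ x v) = τ x (f v)) (g : G) (v : W) :
    f (σ g v) = τ g (f v) := by
  subst hG
  obtain ⟨g, hg⟩ := g
  induction hg using Subgroup.closure_induction generalizing v with
  | mem x hx => exact h ⟨x, _⟩ hx v
  | one =>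
    have : (⟨1, Subgroup.one_mem _⟩ : Subgroup.closure S) = 1 := rfl
    rw [this, map_one, map_one]
    rfl
  | mul x y hx hy ihx ihy =>
    have : (⟨x * y, Subgroup.mul_mem _ hx hy⟩ : Subgroup.closure S) = ⟨x, hx⟩ * ⟨y, hy⟩ := rfl
    rw [this, map_mul, map_mul, Module.End.mul_apply, Module.End.mul_apply, ihx, ihy]
  | inv x hx ihx =>
    have : (⟨x⁻¹, Subgroup.inv_mem _ hx⟩ : Subgroup.closure S) = ⟨x, hx⟩⁻¹ := rfl
    rw [this]
    have h1 := ihx (σ ⟨x, hx⟩⁻¹ v)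
    rw [← Module.End.mul_apply, ← map_mul, mul_inv_cancel, map_one, Module.End.one_apply] at h1
    rw [h1, ← Module.End.mul_apply (τ ⟨x, hx⟩⁻¹), ← map_mul, inv_mul_cancel, map_one,
      Module.End.one_apply]

end

/-! ### Weights of words, and the cyclic groups -/

section

variable {G : Subgroup SU2}

/-! ### Words and their weights -/

/-- The number of letters `v₁` in a word. -/
def ones {k : ℕ} (r : Fin k → Fin 2) : ℕ := ∑ i, (r i : ℕ)

theorem ones_snoc {k : ℕ} (r : Fin k → Fin 2) (i : Fin 2) :
    ones (Fin.snoc (α := fun _ => Fin 2) r i) = ones r + i := by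
  simp [ones, Fin.sum_univ_castSucc]

theorem ones_le {k : ℕ} (r : Fin k → Fin 2) : ones r ≤ k := by
  calc ones r ≤ ∑ _i : Fin k, 1 := Finset.sum_le_sum fun i _ => Nat.le_of_lt_succ (r i).2
    _ = k := by simp

theorem ones_const_zero (k : ℕ) : ones (fun _ : Fin k => 0) = 0 := by simp [ones]

theorem ones_const_one (k : ℕ) : ones (fun _ : Fin k => 1) = k := by simp [ones]

theorem eq_const_zero_of_ones {k : ℕ} {r : Fin k → Fin 2} (h : ones r = 0) : r = fun _ => 0 := by
  funext i
  exact Fin.ext (by simpa using (Finset.sum_eq_zero_iff.1 h) i (Finset.mem_univ i))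

theorem eq_const_one_of_ones {k : ℕ} {r : Fin k → Fin 2} (h : ones r = k) : r = fun _ => 1 := by
  have h1 : ∑ i, (r i : ℕ) = ∑ _i : Fin k, 1 := by simpa [ones] using h
  have h2 := (Finset.sum_eq_sum_iff_of_le fun i _ => Nat.le_of_lt_succ (r i).2).1 h1
  funext i
  exact Fin.ext (h2 i (Finset.mem_univ i))

theorem snoc_const {k : ℕ} (a : Fin 2) :
    Fin.snoc (α := fun _ => Fin 2) (fun _ : Fin k => a) a = fun _ => a := by
  funext i
  induction i using Fin.lastCases <;> simp

theorem cre_const {k : ℕ} (a : Fin 2) :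
    cre a (tensorBasis k fun _ => a) = tensorBasis (k + 1) fun _ => a := by
  rw [cre_tensorBasis, snoc_const]

theorem word_cases {k : ℕ} {r : Fin (k + 1) → Fin 2} {p : (Fin (k + 1) → Fin 2) → Prop}
    (h : ∀ s a, p (Fin.snoc (α := fun _ => Fin 2) s a)) : p r := by
  rw [← Fin.snoc_init_self r]
  exact h _ _

/-- If the words that end in two distinct letters are old, then so are all the words that are not
constant. -/
theorem tensorBasis_mem_oldSpace {m : ℕ}
    (base : ∀ r : Fin (m + 2) → Fin 2, (∀ a, r ≠ fun _ => a) → tensorBasis _ r ∈ oldSpace G (m + 2))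
    (step : ∀ k, m ≤ k → ∀ (s : Fin (k + 1) → Fin 2) (a b : Fin 2), a ≠ b →
      cre a (cre b (tensorBasis _ s)) ∈ oldSpace G (k + 3)) {k : ℕ} (hk : m ≤ k)
    (r : Fin (k + 2) → Fin 2) (hr : ∀ a, r ≠ fun _ => a) :
    tensorBasis _ r ∈ oldSpace G (k + 2) := by
  induction k, hk using Nat.le_induction with
  | base => exact base r hr
  | succ k hk ih =>
    revert hr
    refine word_cases (p := fun r => (∀ a, r ≠ fun _ => a) → tensorBasis _ r ∈ _) fun s a => ?_
    refine word_cases (r := s) (p := fun s => (∀ c, (Fin.snoc (α := fun _ => Fin 2) s a) ≠ fun _ => c) →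
      tensorBasis _ (Fin.snoc (α := fun _ => Fin 2) s a) ∈ _) fun s b hr => ?_
    by_cases hab : a = b
    · subst hab
      rw [← cre_tensorBasis]
      refine cre_mem_oldSpace (ih _ fun c hc => ?_) a
      have hac : a = c := by simpa using congrFun hc (Fin.last _)
      subst hac
      exact hr a (by rw [hc, snoc_const])
    · rw [← cre_tensorBasis, ← cre_tensorBasis]
      exact step k hk s a b hab

/-! ### The action of the diagonal element -/

theorem ent_gElt (ζ : Circle) : ent (gElt ζ) 0 0 = (ζ : ℂ)⁻¹ ∧ ent (gElt ζ) 0 1 = 0 ∧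
    ent (gElt ζ) 1 0 = 0 ∧ ent (gElt ζ) 1 1 = ζ := by
  simp [ent, gElt]

theorem ent_hElt : ent hElt 0 0 = 0 ∧ ent hElt 0 1 = Complex.I ∧
    ent hElt 1 0 = Complex.I ∧ ent hElt 1 1 = 0 := by
  simp [ent, hElt]

/-- The eigenvalue of the diagonal element `gElt ζ` on the word `r`. -/
def eig (ζ : Circle) {k : ℕ} (r : Fin k → Fin 2) : ℂ := (ζ : ℂ)⁻¹ ^ k * ((ζ : ℂ) ^ 2) ^ ones r

theorem eig_snoc (ζ : Circle) {k : ℕ} (r : Fin k → Fin 2) (i : Fin 2) :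
    eig ζ (Fin.snoc (α := fun _ => Fin 2) r i) = eig ζ r * ent (gElt ζ) i i := by
  have h : (ζ : ℂ) ≠ 0 := Circle.coe_ne_zero ζ
  obtain ⟨h1, -, -, h2⟩ := ent_gElt ζ
  fin_cases i
  · simp only [eig, ones_snoc, Fin.zero_eta, h1]
    simp [pow_succ]
    ring
  · simp only [eig, ones_snoc, Fin.mk_one, h2]
    simp only [Fin.val_one]
    linear_combination ((ζ : ℂ)⁻¹ ^ k * ((ζ : ℂ) ^ 2) ^ ones r * ζ) * inv_mul_cancel₀ h

theorem tensorRep_gElt {ζ : Circle} {g : G} (hg : (g : SU2) = gElt ζ) {k : ℕ}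
    (r : Fin k → Fin 2) : tensorRep G k g (tensorBasis k r) = eig ζ r • tensorBasis k r := by
  induction k with
  | zero => rw [tensorRep_zero]; simp [eig, ones]
  | succ k ih =>
    refine word_cases (p := fun r => tensorRep G (k + 1) g (tensorBasis _ r) =
      eig ζ r • tensorBasis _ r) fun s a => ?_
    obtain ⟨h1, h2, h3, h4⟩ := ent_gElt ζ
    rw [← cre_tensorBasis, tensorRep_cre, ih, eig_snoc, hg]
    fin_cases a <;> simp [h2, h3, smul_smul, mul_comm]

theorem coord_tensorRep_gElt {ζ : Circle} {g : G} (hg : (g : SU2) = gElt ζ) {k : ℕ}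
    (r : Fin k → Fin 2) (y : TP k) :
    (tensorBasis k).coord r (tensorRep G k g y) = eig ζ r * (tensorBasis k).coord r y := by
  have : (tensorBasis k).coord r ∘ₗ tensorRep G k g = eig ζ r • (tensorBasis k).coord r := by
    refine (tensorBasis k).ext fun s => ?_
    rw [LinearMap.comp_apply, tensorRep_gElt hg, LinearMap.smul_apply, map_smul]
    by_cases h : s = r
    · rw [h]
    · simp [h]
  exact LinearMap.congr_fun this y

theorem eig_eq_of_coord_ne_zero {ζ : Circle} {g : G} (hg : (g : SU2) = gElt ζ) {k : ℕ} {y : TP k}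
    {c : ℂ} (hy : tensorRep G k g y = c • y) {r : Fin k → Fin 2}
    (hr : (tensorBasis k).coord r y ≠ 0) : eig ζ r = c := by
  have h := coord_tensorRep_gElt hg r y
  rw [hy, map_smul, smul_eq_mul] at h
  exact (mul_right_cancel₀ hr h).symm

theorem eig_eq_iff {ζ : Circle} {k : ℕ} {r s : Fin k → Fin 2} :
    eig ζ r = eig ζ s ↔ ((ζ : ℂ) ^ 2) ^ ones r = ((ζ : ℂ) ^ 2) ^ ones s :=
  mul_right_inj' (pow_ne_zero _ (inv_ne_zero (Circle.coe_ne_zero ζ)))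

/-- Adding one letter of each kind does not change the eigenvalue, which accounts for the shift by
one in the exponent. -/
theorem eig_eq_iff_add_two {ζ : Circle} {k : ℕ} {r : Fin k → Fin 2} {s : Fin (k + 2) → Fin 2} :
    eig ζ r = eig ζ s ↔ ((ζ : ℂ) ^ 2) ^ (ones r + 1) = ((ζ : ℂ) ^ 2) ^ ones s := by
  have h : (ζ : ℂ) ≠ 0 := Circle.coe_ne_zero ζ
  have : eig ζ r = (ζ : ℂ)⁻¹ ^ (k + 2) * ((ζ : ℂ) ^ 2) ^ (ones r + 1) := by
    rw [eig]
    linear_combination (-(ζ : ℂ)⁻¹ ^ k * ((ζ : ℂ) ^ 2) ^ ones r * ((ζ : ℂ)⁻¹ * ζ + 1)) *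
      inv_mul_cancel₀ h
  rw [this, eig]
  exact mul_right_inj' (pow_ne_zero _ (inv_ne_zero h))

/-- The square of `ζ` has order greater than `m`. -/
def OrderGT (ζ : Circle) (m : ℕ) : Prop := ∀ d, 1 ≤ d → d ≤ m → ((ζ : ℂ) ^ 2) ^ d ≠ 1

theorem OrderGT.pow_inj {ζ : Circle} {m a b : ℕ} (h : OrderGT ζ m) (ha : a ≤ m) (hb : b ≤ m)
    (hab : ((ζ : ℂ) ^ 2) ^ a = ((ζ : ℂ) ^ 2) ^ b) : a = b := by
  have h0 : ∀ c : ℕ, ((ζ : ℂ) ^ 2) ^ c ≠ 0 := fun c =>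
    pow_ne_zero _ (pow_ne_zero _ (Circle.coe_ne_zero ζ))
  rcases lt_trichotomy a b with hlt | heq | hlt
  · exfalso
    refine h (b - a) (by omega) (by omega) (mul_left_cancel₀ (h0 a) ?_)
    rw [← pow_add, Nat.add_sub_cancel' hlt.le, mul_one, hab]
  · exact heq
  · exfalso
    refine h (a - b) (by omega) (by omega) (mul_left_cancel₀ (h0 b) ?_)
    rw [← pow_add, Nat.add_sub_cancel' hlt.le, mul_one, hab]

/-- A G-map to V^{⊗(k-1)} preserves the eigenvalue ζ^{±(k+1)} of g. This is not among the
eigenvalues ζ^{2j-(k-1)}, 0 ≤ j ≤ k - 1, unless (ζ²)^d = 1 for some d with 1 ≤ d ≤ k. -/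
theorem const_mem_newSpace {ζ : Circle} (hζ : gElt ζ ∈ G) {k : ℕ} (h : OrderGT ζ k) (a : Fin 2) :
    tensorBasis (k + 1) (fun _ => a) ∈ newSpace G (k + 1) := by
  cases k with
  | zero => rw [newSpace_lt_two (by norm_num)]; exact Submodule.mem_top
  | succ k =>
    refine mem_newSpace_iff_hom.2 fun ψ => ?_
    have h1 : tensorRep G k ⟨gElt ζ, hζ⟩ (ψ (tensorBasis (k + 2) fun _ => a)) =
        eig ζ (fun _ : Fin (k + 2) => a) • ψ (tensorBasis (k + 2) fun _ => a) := by
      rw [← hom_comm ψ, tensorRep_gElt rfl, map_smul]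
    refine (tensorBasis k).ext_elem fun r => ?_
    rw [map_zero, Finsupp.zero_apply]
    by_contra hne
    have h2 := eig_eq_iff_add_two.1 (eig_eq_of_coord_ne_zero rfl h1 hne)
    have h3 := ones_le r
    have h0 : (((ζ : ℂ) ^ 2) ^ (ones r + 1)) ≠ 0 :=
      pow_ne_zero _ (pow_ne_zero _ (Circle.coe_ne_zero ζ))
    fin_cases a
    · simp only [Fin.zero_eta, ones_const_zero, pow_zero] at h2
      exact h _ (by omega) (by omega) h2
    · simp only [Fin.mk_one, ones_const_one] at h2
      refine h (k + 1 - ones r) (by omega) (by omega) (mul_left_cancel₀ h0 ?_)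
      rw [← pow_add, mul_one, h2]
      congr 1
      omega

theorem Z_apply_coord_eq_zero {ζ : Circle} (hζ : gElt ζ ∈ G) {k : ℕ} (h : OrderGT ζ k)
    {T : Module.End ℂ (TP k)} (hT : T ∈ Z G k) {r s : Fin k → Fin 2} (hrs : ones r ≠ ones s) :
    (tensorBasis k).coord r (T (tensorBasis k s)) = 0 := by
  by_contra hne
  have h1 : tensorRep G k ⟨gElt ζ, hζ⟩ (T (tensorBasis k s)) = eig ζ s • T (tensorBasis k s) := by
    rw [← mem_Z_iff.1 hT, tensorRep_gElt rfl, map_smul]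
  exact hrs (h.pow_inj (ones_le r) (ones_le s) (eig_eq_iff.1 (eig_eq_of_coord_ne_zero rfl h1 hne)))

theorem ones_ne_ones_const {k : ℕ} {r : Fin k → Fin 2} {a : Fin 2} (h : r ≠ fun _ => a) :
    ones r ≠ ones fun _ : Fin k => a := by
  intro hr
  fin_cases a
  · exact h (eq_const_zero_of_ones (hr.trans (ones_const_zero k)))
  · exact h (eq_const_one_of_ones (hr.trans (ones_const_one k)))

/-- Words with different numbers of letters v₁ have different eigenvalues under g, so the eigenvalue
of a constant word is simple. -/
theorem Z_apply_const {ζ : Circle} (hζ : gElt ζ ∈ G) {k : ℕ} (h : OrderGT ζ k)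
    {T : Module.End ℂ (TP k)} (hT : T ∈ Z G k) (a : Fin 2) :
    ∃ c : ℂ, T (tensorBasis k fun _ => a) = c • tensorBasis k fun _ => a := by
  refine ⟨(tensorBasis k).coord (fun _ => a) (T (tensorBasis k fun _ => a)),
    (tensorBasis k).ext_elem fun r => ?_⟩
  by_cases hr : r = fun _ => a
  · subst hr; simp
  · have := Z_apply_coord_eq_zero hζ h hT (ones_ne_ones_const hr)
    rw [Module.Basis.coord_apply] at this
    rw [this, map_smul, Finsupp.smul_apply, Module.Basis.repr_self, Finsupp.single_eq_of_ne hr,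
      smul_zero]

theorem tensorBasis_notMem_span {k : ℕ} {r s : Fin k → Fin 2} (h : r ≠ s) :
    tensorBasis k s ∉ Submodule.span ℂ {tensorBasis k r} := by
  intro hs
  obtain ⟨c, hc⟩ := Submodule.mem_span_singleton.1 hs
  have := congrArg ((tensorBasis k).coord s) hc
  simp [h] at this

theorem const_ne_const {k : ℕ} {a b : Fin 2} (h : a ≠ b) :
    (fun _ : Fin (k + 1) => a) ≠ fun _ => b := fun hab => h (congrFun hab 0)

theorem isStableLine_of_generators {S : Set SU2} (hG : G = Subgroup.closure S) {k : ℕ} {x : TP k}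
    (h : ∀ g : G, (g : SU2) ∈ S → tensorRep G k g x ∈ Submodule.span ℂ {x}) :
    IsStableLine G x := by
  subst hG
  rintro ⟨g, hg⟩
  induction hg using Subgroup.closure_induction with
  | mem g hg => exact h ⟨g, _⟩ hg
  | one =>
    have : (⟨1, Subgroup.one_mem _⟩ : Subgroup.closure S) = 1 := rfl
    rw [this, map_one]
    exact Submodule.mem_span_singleton_self x
  | mul g g' hg hg' ih ih' =>
    have : (⟨g * g', Subgroup.mul_mem _ hg hg'⟩ : Subgroup.closure S) = ⟨g, hg⟩ * ⟨g', hg'⟩ := rfl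
    rw [this, map_mul, Module.End.mul_apply]
    obtain ⟨c, hc⟩ := Submodule.mem_span_singleton.1 ih'
    rw [← hc, map_smul]
    exact Submodule.smul_mem _ _ ih
  | inv g hg ih =>
    have : (⟨g⁻¹, Subgroup.inv_mem _ hg⟩ : Subgroup.closure S) = ⟨g, hg⟩⁻¹ := rfl
    rw [this]
    obtain ⟨c, hc⟩ := Submodule.mem_span_singleton.1 ih
    have h1 : c • tensorRep _ k ⟨g, hg⟩⁻¹ x = x := by
      rw [← map_smul, hc, tensorRep_mul_apply, inv_mul_cancel, map_one, Module.End.one_apply]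
    by_cases hc0 : c = 0
    · rw [hc0, zero_smul] at h1
      rw [← h1, map_zero]
      exact zero_mem _
    · refine Submodule.mem_span_singleton.2 ⟨c⁻¹, ?_⟩
      conv_lhs => rw [← h1]
      rw [smul_smul, inv_mul_cancel₀ hc0, one_smul]

theorem hom_eq_zero_of_words {k : ℕ} {μ : Node G} {f : (tensorRep G k).IntertwiningMap μ.ρ}
    (h : ∀ r, f (tensorBasis k r) = 0) (y : TP k) : f y = 0 := by
  have : f.toLinearMap = 0 := (tensorBasis k).ext h
  exact LinearMap.congr_fun this y

/-! ### The cyclic groups -/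

theorem zpowers_eq_closure (ζ : Circle) :
    Subgroup.zpowers (gElt ζ) = Subgroup.closure {gElt ζ} := Subgroup.zpowers_eq_closure _

/-- A rank-one map between words of equal eigenvalue commutes with the only generator. It serves
both for matrix units and for maps between different degrees. -/
theorem coord_smul_comm {ζ : Circle} (hG : G = Subgroup.closure {gElt ζ}) {k l : ℕ}
    {r : Fin k → Fin 2} {s : Fin l → Fin 2} (h : eig ζ r = eig ζ s) (g : G) (y : TP k) :
    (tensorBasis k).coord r (tensorRep G k g y) • tensorBasis l s =
      tensorRep G l g ((tensorBasis k).coord r y • tensorBasis l s) := by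
  refine commutes_of_generators hG (σ := tensorRep G k) (τ := tensorRep G l)
    (((tensorBasis k).coord r).smulRight (tensorBasis l s)) (fun g hg v => ?_) g y
  rw [LinearMap.smulRight_apply, LinearMap.smulRight_apply, coord_tensorRep_gElt hg, map_smul,
    tensorRep_gElt hg, smul_smul, h, mul_comm]

/-- Two distinct letters contribute ζ⁻¹ζ = 1 to the eigenvalue, so appending them is equivariant. -/
theorem cre_cre_mem_oldSpace_of_cyclic {ζ : Circle} (hG : G = Subgroup.closure {gElt ζ}) {k : ℕ}
    {a b : Fin 2} (hab : a ≠ b) (x : TP k) : cre a (cre b x) ∈ oldSpace G (k + 2) := by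
  refine hom_mem_oldSpace ⟨cre a ∘ₗ cre b, fun g => LinearMap.ext fun v => ?_⟩ x
  refine commutes_of_generators hG (σ := tensorRep G k) (τ := tensorRep G (k + 2))
    (cre a ∘ₗ cre b) (fun g hg v => ?_) g v
  obtain ⟨h1, h2, h3, h4⟩ := ent_gElt ζ
  have h0 : (ζ : ℂ) ≠ 0 := Circle.coe_ne_zero ζ
  rw [LinearMap.comp_apply, LinearMap.comp_apply, tensorRep_cre, tensorRep_cre, hg]
  fin_cases a <;> fin_cases b
  · exact absurd rfl hab
  · simp [h1, h2, h3, h4, smul_smul, h0]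
  · simp [h1, h2, h3, h4, smul_smul, h0]
  · exact absurd rfl hab

theorem nonconst_mem_oldSpace_of_cyclic {ζ : Circle} (hG : G = Subgroup.closure {gElt ζ}) {k : ℕ}
    (r : Fin (k + 1) → Fin 2) (hr : ∀ a, r ≠ fun _ => a) :
    tensorBasis _ r ∈ oldSpace G (k + 1) := by
  cases k with
  | zero => exact absurd (funext fun i => by rw [Fin.fin_one_eq_zero i]) (hr (r 0))
  | succ k =>
    refine tensorBasis_mem_oldSpace (m := 0) (fun r hr => ?_)
      (fun k _ s a b hab => cre_cre_mem_oldSpace_of_cyclic hG hab _) (Nat.zero_le k) r hr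
    revert hr
    refine word_cases (p := fun r => (∀ a, r ≠ fun _ => a) → tensorBasis _ r ∈ _) fun s a => ?_
    refine word_cases (r := s) (p := fun s => (∀ c, (Fin.snoc (α := fun _ => Fin 2) s a) ≠ fun _ => c) →
      tensorBasis _ (Fin.snoc (α := fun _ => Fin 2) s a) ∈ _) fun s b hr => ?_
    by_cases hab : a = b
    · subst hab
      refine absurd ?_ (hr a)
      rw [Subsingleton.elim s fun _ => a, snoc_const, snoc_const]
    · rw [← cre_tensorBasis, ← cre_tensorBasis]
      exact cre_cre_mem_oldSpace_of_cyclic hG hab _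

theorem gElt_mem_closure {ζ : Circle} {S : Set SU2} (hG : G = Subgroup.closure S) (h : gElt ζ ∈ S) :
    gElt ζ ∈ G := hG ▸ Subgroup.subset_closure h

theorem multFree_of_cyclic {ζ : Circle} (hG : G = Subgroup.closure {gElt ζ}) {k : ℕ}
    (h : OrderGT ζ (k + 1)) : MultFree G (k + 1) 2 := by
  have hζ := gElt_mem_closure hG rfl
  refine MultFree.of_vectors (fun a => tensorBasis (k + 1) fun _ => a)
    (const_mem_newSpace hζ fun d h1 h2 => h d h1 (by omega)) (fun a => (tensorBasis _).ne_zero _)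
    (fun a T hT => Z_apply_const hζ h hT a)
    (fun a b hab => tensorBasis_notMem_span (const_ne_const hab))
    (fun a b _ => Or.inl (isStableLine_of_generators hG fun g hg => ?_)) fun μ f h1 h2 => ?_
  · rw [tensorRep_gElt hg]
    exact Submodule.smul_mem _ _ (Submodule.mem_span_singleton_self _)
  · refine hom_eq_zero_of_words fun r => ?_
    by_cases hr : ∃ a, r = fun _ => a
    · obtain ⟨a, rfl⟩ := hr
      exact h2 a
    · push Not at hr
      exact h1 _ (nonconst_mem_oldSpace_of_cyclic hG r hr)

theorem matrixUnit_apply {k : ℕ} (r s : Fin k → Fin 2) (x : TP k) :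
    matrixUnit r s x = (tensorBasis k).coord s x • tensorBasis k r := by
  have : matrixUnit r s = ((tensorBasis k).coord s).smulRight (tensorBasis k r) := by
    refine (tensorBasis k).ext fun t => ?_
    rw [matrixUnit, Matrix.toLin_self, LinearMap.smulRight_apply]
    rw [Finset.sum_eq_single r]
    · by_cases h : t = s
      · simp [h]
      · simp [Ne.symm h]
    · intro b _ hb
      simp [hb.symm]
    · simp
  rw [this, LinearMap.smulRight_apply]

theorem matrixUnit_mem_Z {ζ : Circle} (hG : G = Subgroup.closure {gElt ζ}) {k : ℕ}
    {r s : Fin k → Fin 2} (h : eig ζ s = eig ζ r) : matrixUnit r s ∈ Z G k := by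
  refine mem_Z_iff.2 fun g x => ?_
  rw [matrixUnit_apply, matrixUnit_apply]
  exact coord_smul_comm hG h g x

/-- The new part is spanned by the two constant words. The matrix unit at the word v₁…v₁ of one
degree lower, tensored with 1, fixes one of them and kills the other. -/
theorem Z_eq_adjoin_e_of_cyclic {ζ : Circle} (hG : G = Subgroup.closure {gElt ζ}) {k : ℕ}
    (h : OrderGT ζ (k + 2)) :
    Z G (k + 2) = Algebra.adjoin ℂ ((Zin G (k + 1) : Set _) ∪ {e (k + 1)}) := by
  have hζ := gElt_mem_closure hG rfl
  refine (multFree_of_cyclic hG h).Z_eq_of_separating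
    (adjoin_le_Z (by rintro _ rfl; exact e_mem_Z G _)) (Zin_le_adjoin _) (mem_adjoin_of_mem rfl)
    (d := embed (k + 1) (matrixUnit (fun _ => 1) (fun _ => 1)))
    (Zin_le_adjoin _ ⟨_, matrixUnit_mem_Z hG rfl, rfl⟩) fun r hr => ?_
  have hnew := const_mem_newSpace hζ (k := k + 1) fun d h1 h2 => h d h1 (by omega)
  have h1 := LinearMap.congr_fun hr (tensorBasis _ fun _ => 0)
  have h2 := LinearMap.congr_fun hr (tensorBasis _ fun _ => 1)
  rw [Module.End.mul_apply, LinearMap.smul_apply, newProj_of_mem_newSpace (hnew _), ← cre_const,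
    embed_cre, matrixUnit_apply] at h1 h2
  have h3 : (fun _ : Fin (k + 1) => (0 : Fin 2)) ≠ fun _ => 1 := const_ne_const (by decide)
  simp only [Module.Basis.coord_apply, Module.Basis.repr_self, Finsupp.single_eq_same,
    Finsupp.single_eq_of_ne h3.symm, zero_smul, one_smul, map_zero] at h1 h2
  rw [cre_const] at h1 h2
  rcases smul_eq_zero.1 h1.symm with h4 | h4
  · rw [h4, zero_smul] at h2
    exact (tensorBasis _).ne_zero _ h2
  · exact (tensorBasis _).ne_zero _ h4

/-- Under the hypothesis a constant word has the eigenvalue of the opposite constant word two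
degrees lower, so the constant words become old too. -/
theorem newNodes_eq_empty_of_cyclic {ζ : Circle} (hG : G = Subgroup.closure {gElt ζ}) {k : ℕ}
    (h : ((ζ : ℂ) ^ 2) ^ (k + 1) = 1) : newNodes G (k + 2) = ∅ := by
  refine newNodes_eq_empty_of_oldSpace (Submodule.eq_top_iff_forall_basis_mem (tensorBasis _) |>.2 fun r => ?_)
  by_cases hr : ∃ a, r = fun _ => a
  · obtain ⟨a, rfl⟩ := hr
    obtain ⟨s, hs⟩ : ∃ s : Fin k → Fin 2, eig ζ s = eig ζ fun _ : Fin (k + 2) => a := by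
      simp only [eig_eq_iff_add_two]
      fin_cases a
      · exact ⟨fun _ => 1, by simp [ones_const_one, ones_const_zero, h]⟩
      · exact ⟨fun _ => 0, by
          simp only [ones_const_zero, Fin.mk_one, ones_const_one]
          rw [pow_succ _ (k + 1), h, zero_add, pow_one, one_mul]⟩
    have := hom_mem_oldSpace (G := G) ⟨((tensorBasis k).coord s).smulRight (tensorBasis (k + 2) fun _ => a),
      fun g => LinearMap.ext fun y => coord_smul_comm hG hs g y⟩ (tensorBasis k s)
    simpa using this
  · push Not at hr
    exact nonconst_mem_oldSpace_of_cyclic hG r hr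

/-- In degree ñ both constant words are still new but have the same eigenvalue. The new part is one
line with multiplicity two, and its endomorphisms form the full algebra spanned by the four matrix
units. -/
theorem Z_eq_adjoin_matrixUnit_of_cyclic {ζ : Circle} (hG : G = Subgroup.closure {gElt ζ}) {k : ℕ}
    (h : OrderGT ζ k) (h' : ((ζ : ℂ) ^ 2) ^ (k + 1) = 1) :
    Z G (k + 1) = Algebra.adjoin ℂ ((Zin G k : Set _) ∪ {e k} ∪
      {E | ∃ p ∈ ({fun _ => 0, fun _ => 1} : Set (Fin (k + 1) → Fin 2)),
        ∃ q ∈ ({fun _ => 0, fun _ => 1} : Set (Fin (k + 1) → Fin 2)), E = matrixUnit p q}) := by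
  have hζ := gElt_mem_closure hG rfl
  have heig : ∀ a b : Fin 2, eig ζ (fun _ : Fin (k + 1) => a) = eig ζ fun _ : Fin (k + 1) => b := by
    have : ∀ a : Fin 2, ((ζ : ℂ) ^ 2) ^ ones (fun _ : Fin (k + 1) => a) = 1 := by
      intro a
      fin_cases a
      · simp [ones_const_zero]
      · simp [ones_const_one, h']
    intro a b
    rw [eig_eq_iff, this, this]
  rw [Set.union_assoc]
  set S := ({e k} ∪ {E | ∃ p ∈ ({fun _ => 0, fun _ => 1} : Set (Fin (k + 1) → Fin 2)),
        ∃ q ∈ ({fun _ => 0, fun _ => 1} : Set (Fin (k + 1) → Fin 2)), E = matrixUnit p q}) with hS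
  have hunit : ∀ a b : Fin 2, matrixUnit (fun _ => a) (fun _ => b) ∈
      Algebra.adjoin ℂ ((Zin G k : Set (Module.End ℂ (TP (k + 1)))) ∪ S) := fun a b => by
    refine mem_adjoin_of_mem (Or.inr ⟨_, ?_, _, ?_, rfl⟩)
    · fin_cases a <;> simp
    · fin_cases b <;> simp
  refine le_antisymm (Subalgebra.toSubmodule.le_iff_le.1 ?_) (adjoin_le_Z ?_)
  · rw [Z_eq_ZeZ_sup_endNew]
    refine sup_le (ZeZ_le_subalgebra (Zin_le_adjoin _) (mem_adjoin_of_mem (Or.inl rfl))) fun a ha => ?_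
    have hnew := const_mem_newSpace hζ h
    -- The difference of the two sides is new, and it is also a combination of non-constant words,
    -- hence old.
    have hspan : ∀ y ∈ newSpace G (k + 1),
        y = ∑ b : Fin 2, (tensorBasis _).coord (fun _ => b) y • tensorBasis _ fun _ => b := by
      intro y hy
      rw [← sub_eq_zero]
      refine oldSpace_inf_newSpace (G := G) ?_
        (sub_mem hy (Submodule.sum_mem _ fun b _ => Submodule.smul_mem _ _ (hnew b)))
      set w := y - ∑ b : Fin 2, (tensorBasis _).coord (fun _ => b) y • tensorBasis _ fun _ => b with hw
      rw [← (tensorBasis _).sum_repr w]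
      refine Submodule.sum_mem _ fun r _ => ?_
      by_cases hr : ∃ a, r = fun _ => a
      · obtain ⟨a, rfl⟩ := hr
        have h3 : (fun _ : Fin (k + 1) => (0 : Fin 2)) ≠ fun _ => 1 := const_ne_const (by decide)
        have : (tensorBasis _).repr w (fun _ => a) = 0 := by
          rw [hw]
          fin_cases a <;> simp [Fin.sum_univ_two, h3, h3.symm]
        rw [this, zero_smul]
        exact zero_mem _
      · push Not at hr
        exact Submodule.smul_mem _ _ (nonconst_mem_oldSpace_of_cyclic hG r hr)
    have : a = ∑ b : Fin 2, ∑ c : Fin 2, (tensorBasis _).coord (fun _ => b)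
        (a (tensorBasis _ fun _ => c)) • matrixUnit (fun _ => b) (fun _ => c) := by
      refine (tensorBasis _).ext fun r => ?_
      simp only [LinearMap.sum_apply, LinearMap.smul_apply, matrixUnit_apply]
      by_cases hr : ∃ a, r = fun _ => a
      · obtain ⟨c, rfl⟩ := hr
        rw [hspan _ (ha.2.2 (tensorBasis _ fun _ => c))]
        have h3 : (fun _ : Fin (k + 1) => (0 : Fin 2)) ≠ fun _ => 1 := const_ne_const (by decide)
        fin_cases c <;> simp [Fin.sum_univ_two, h3, h3.symm]
      · push Not at hr
        rw [ha.2.1 _ (nonconst_mem_oldSpace_of_cyclic hG r hr)]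
        simp [hr]
    rw [this]
    exact Submodule.sum_mem _ fun b _ => Submodule.sum_mem _ fun c _ =>
      Submodule.smul_mem _ _ (hunit b c)
  · rintro _ (rfl | ⟨p, hp, q, hq, rfl⟩)
    · exact e_mem_Z G k
    · rcases hp with rfl | rfl <;> rcases hq with rfl | rfl <;>
        exact matrixUnit_mem_Z hG (heig _ _)

end

section

variable {G : Subgroup SU2}

/-! ### The binary dihedral groups -/

/-- The word with the two letters interchanged. -/
def flip {k : ℕ} (r : Fin k → Fin 2) : Fin k → Fin 2 := fun i => 1 - r i

theorem flip_snoc {k : ℕ} (r : Fin k → Fin 2) (i : Fin 2) :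
    flip (Fin.snoc (α := fun _ => Fin 2) r i) = Fin.snoc (α := fun _ => Fin 2) (flip r) (1 - i) := by
  funext j
  induction j using Fin.lastCases <;> simp [flip]

theorem flip_flip {k : ℕ} (r : Fin k → Fin 2) : flip (flip r) = r := by
  funext i
  simp [flip]

theorem flip_ne {k : ℕ} (r : Fin (k + 1) → Fin 2) : flip r ≠ r := by
  intro h
  have : ∀ j : Fin 2, 1 - j ≠ j := by decide
  exact this _ (congrFun h 0)

theorem flip_const_one (k : ℕ) : flip (fun _ : Fin k => (1 : Fin 2)) = fun _ => 0 := by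
  funext i
  simp [flip]

theorem tensorRep_hElt_cre {g : G} (hg : (g : SU2) = hElt) {k : ℕ} (j : Fin 2) (x : TP k) :
    tensorRep G (k + 1) g (cre j x) = Complex.I • cre (1 - j) (tensorRep G k g x) := by
  obtain ⟨h1, h2, h3, h4⟩ := ent_hElt
  rw [tensorRep_cre, hg]
  fin_cases j <;> simp [h1, h2, h3, h4]

theorem tensorRep_gElt_cre {ζ : Circle} {g : G} (hg : (g : SU2) = gElt ζ) {k : ℕ} (j : Fin 2)
    (x : TP k) : tensorRep G (k + 1) g (cre j x) = ent (gElt ζ) j j • cre j (tensorRep G k g x) := by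
  obtain ⟨h1, h2, h3, h4⟩ := ent_gElt ζ
  rw [tensorRep_cre, hg]
  fin_cases j <;> simp [h2, h3]

theorem tensorRep_hElt {g : G} (hg : (g : SU2) = hElt) {k : ℕ} (r : Fin k → Fin 2) :
    tensorRep G k g (tensorBasis k r) = Complex.I ^ k • tensorBasis k (flip r) := by
  induction k with
  | zero => rw [tensorRep_zero, Subsingleton.elim (flip r) r]; simp
  | succ k ih =>
    refine word_cases (p := fun r => tensorRep G (k + 1) g (tensorBasis _ r) =
      Complex.I ^ (k + 1) • tensorBasis _ (flip r)) fun s a => ?_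
    rw [← cre_tensorBasis, tensorRep_hElt_cre hg, ih, map_smul, cre_tensorBasis, flip_snoc, smul_smul,
      pow_succ']

theorem coord_tensorRep_hElt {g : G} (hg : (g : SU2) = hElt) {k : ℕ} (r : Fin k → Fin 2)
    (y : TP k) : (tensorBasis k).coord r (tensorRep G k g y) =
      Complex.I ^ k * (tensorBasis k).coord (flip r) y := by
  have : (tensorBasis k).coord r ∘ₗ tensorRep G k g =
      Complex.I ^ k • (tensorBasis k).coord (flip r) := by
    refine (tensorBasis k).ext fun s => ?_
    rw [LinearMap.comp_apply, tensorRep_hElt hg, LinearMap.smul_apply, map_smul]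
    by_cases h : s = flip r
    · rw [h, flip_flip]; simp
    · have h' : flip s ≠ r := fun h' => h (by rw [← h', flip_flip])
      simp [h, h']
  exact LinearMap.congr_fun this y

/-- The two signs. -/
def sgn (a : Fin 2) : ℂ := if a = 0 then 1 else -1

theorem sgn_zero : sgn 0 = 1 := rfl

theorem sgn_one : sgn 1 = -1 := rfl

theorem fin_two_cases (j : Fin 2) : j = 0 ∨ j = 1 := by
  revert j
  decide

theorem sgn_mul_self (a : Fin 2) : sgn a * sgn a = 1 := by
  obtain rfl | rfl := fin_two_cases a <;> simp [sgn_zero, sgn_one]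

theorem sgn_ne {a b : Fin 2} (h : a ≠ b) : sgn a ≠ sgn b := by
  obtain rfl | rfl := fin_two_cases a <;> obtain rfl | rfl := fin_two_cases b <;>
    first | exact absurd rfl h | (rw [sgn_zero, sgn_one]; norm_num)

/-- The map `x ⊗ v_j ↦ ± x ⊗ v_j`, with the sign depending on `j`. -/
def sgnLast {k : ℕ} : TP (k + 1) →ₗ[ℂ] TP (k + 1) := cre 0 ∘ₗ ann 0 - cre 1 ∘ₗ ann 1

theorem sgnLast_cre {k : ℕ} (j : Fin 2) (x : TP k) : sgnLast (cre j x) = sgn j • cre j x := by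
  rw [sgnLast, LinearMap.sub_apply, LinearMap.comp_apply, LinearMap.comp_apply]
  obtain rfl | rfl := fin_two_cases j
  · rw [ann_cre_self, ann_one_cre_zero, map_zero, sub_zero, sgn_zero, one_smul]
  · rw [ann_cre_self, ann_zero_cre_one, map_zero, zero_sub, sgn_one, neg_one_smul]

theorem sgnLast_tensorRep_gElt {ζ : Circle} {g : G} (hg : (g : SU2) = gElt ζ) {k : ℕ}
    (x : TP (k + 1)) : sgnLast (tensorRep G (k + 1) g x) = tensorRep G (k + 1) g (sgnLast x) := by
  have : sgnLast ∘ₗ tensorRep G (k + 1) g = tensorRep G (k + 1) g ∘ₗ sgnLast := by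
    refine tp_hom_ext fun j y => ?_
    rw [LinearMap.comp_apply, LinearMap.comp_apply, sgnLast_cre, tensorRep_gElt_cre hg, map_smul,
      map_smul, tensorRep_gElt_cre hg, sgnLast_cre, smul_comm]
  exact LinearMap.congr_fun this x

theorem sgnLast_tensorRep_hElt {g : G} (hg : (g : SU2) = hElt) {k : ℕ} (x : TP (k + 1)) :
    sgnLast (tensorRep G (k + 1) g x) = -tensorRep G (k + 1) g (sgnLast x) := by
  have : sgnLast ∘ₗ tensorRep G (k + 1) g = -(tensorRep G (k + 1) g ∘ₗ sgnLast) := by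
    refine tp_hom_ext fun j y => ?_
    rw [LinearMap.neg_apply, LinearMap.comp_apply, LinearMap.comp_apply, sgnLast_cre,
      tensorRep_hElt_cre hg, map_smul, map_smul, tensorRep_hElt_cre hg, sgnLast_cre, smul_comm,
      ← neg_smul]
    congr 1
    obtain rfl | rfl := fin_two_cases j
    · rw [sub_zero, sgn_zero, sgn_one]
    · rw [sub_self, sgn_zero, sgn_one, neg_neg]
  exact LinearMap.congr_fun this x

/-- The map `x ↦ x ⊗ (v₋₁ ⊗ v₁ + v₁ ⊗ v₋₁)`. -/
def symTwo {k : ℕ} : TP k →ₗ[ℂ] TP (k + 2) := cre 1 ∘ₗ cre 0 + cre 0 ∘ₗ cre 1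

theorem symTwo_apply {k : ℕ} (x : TP k) : symTwo x = cre 1 (cre 0 x) + cre 0 (cre 1 x) := rfl

theorem symTwo_tensorRep_gElt {ζ : Circle} {g : G} (hg : (g : SU2) = gElt ζ) {k : ℕ} (x : TP k) :
    symTwo (tensorRep G k g x) = tensorRep G (k + 2) g (symTwo x) := by
  obtain ⟨h1, h2, h3, h4⟩ := ent_gElt ζ
  have h0 : (ζ : ℂ) ≠ 0 := Circle.coe_ne_zero ζ
  rw [symTwo_apply, symTwo_apply, map_add, tensorRep_gElt_cre hg, tensorRep_gElt_cre hg,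
    tensorRep_gElt_cre hg, tensorRep_gElt_cre hg, map_smul, map_smul, smul_smul, smul_smul, h1, h4,
    mul_inv_cancel₀ h0, inv_mul_cancel₀ h0, one_smul, one_smul]

/-- The symmetric vector is fixed by g and multiplied by i² = -1 by h. The sign cancels against the
one in `sgnLast_tensorRep_hElt`, so the composite `symCup` is equivariant. -/
theorem symTwo_tensorRep_hElt {g : G} (hg : (g : SU2) = hElt) {k : ℕ} (x : TP k) :
    symTwo (tensorRep G k g x) = -tensorRep G (k + 2) g (symTwo x) := by
  rw [symTwo_apply, symTwo_apply, map_add, tensorRep_hElt_cre hg, tensorRep_hElt_cre hg,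
    tensorRep_hElt_cre hg, tensorRep_hElt_cre hg, map_smul, map_smul, smul_smul, smul_smul,
    Complex.I_mul_I, sub_self, sub_zero, neg_one_smul, neg_one_smul, neg_add, neg_neg, neg_neg]
  exact add_comm _ _

theorem dihedral_generators {ζ : Circle} {p : G → Prop}
    (h1 : ∀ g : G, (g : SU2) = gElt ζ → p g) (h2 : ∀ g : G, (g : SU2) = hElt → p g) :
    ∀ g : G, (g : SU2) ∈ ({gElt ζ, hElt} : Set SU2) → p g := by
  rintro g (hg | hg)
  · exact h1 g hg
  · exact h2 g hg

/-- The map `x ⊗ v_j ↦ ± x ⊗ v_j ⊗ (v₋₁ ⊗ v₁ + v₁ ⊗ v₋₁)` as an intertwining map. -/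
def symCup {ζ : Circle} (hG : G = Subgroup.closure {gElt ζ, hElt}) (k : ℕ) :
    (tensorRep G (k + 1)).IntertwiningMap (tensorRep G (k + 3)) :=
  ⟨symTwo ∘ₗ sgnLast, fun g => LinearMap.ext fun x =>
    commutes_of_generators hG (σ := tensorRep G (k + 1)) (τ := tensorRep G (k + 3))
      (symTwo ∘ₗ sgnLast) (dihedral_generators
        (fun g hg x => by
          rw [LinearMap.comp_apply, LinearMap.comp_apply, sgnLast_tensorRep_gElt hg,
            symTwo_tensorRep_gElt hg])
        fun g hg x => by
          rw [LinearMap.comp_apply, LinearMap.comp_apply, sgnLast_tensorRep_hElt hg, map_neg,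
            symTwo_tensorRep_hElt hg, neg_neg]) g x⟩

theorem symCup_cre {ζ : Circle} (hG : G = Subgroup.closure {gElt ζ, hElt}) {k : ℕ} (j : Fin 2)
    (x : TP k) : symCup hG k (cre j x) = sgn j • symTwo (cre j x) := by
  rw [← map_smul, ← sgnLast_cre]
  rfl

/-- Half the sum and half the difference of the antisymmetric and the symmetric vector are the two
mixed pairs. A preceding factor is needed to carry the sign of `sgnLast`, so the statement begins in
degree three. -/
theorem cre_cre_mem_oldSpace_of_dihedral {ζ : Circle} (hG : G = Subgroup.closure {gElt ζ, hElt})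
    {k : ℕ} {a b : Fin 2} (hab : a ≠ b) (x : TP (k + 1)) :
    cre a (cre b x) ∈ oldSpace G (k + 3) := by
  have key : ∀ (j : Fin 2) (y : TP k), cre a (cre b (cre j y)) ∈ oldSpace G (k + 3) := by
    intro j y
    have h1 : cup (cre j y) ∈ oldSpace G (k + 3) := hom_mem_oldSpace (cupHom G (k + 1)) (cre j y)
    have h2 : symTwo (cre j y) ∈ oldSpace G (k + 3) := by
      have := Submodule.smul_mem _ (sgn j) (hom_mem_oldSpace (symCup hG k) (cre j y))
      rwa [symCup_cre, smul_smul, sgn_mul_self, one_smul] at this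
    rw [symTwo_apply] at h2
    rw [cup_apply] at h1
    have h3 := Submodule.smul_mem _ (1 / 2 : ℂ) (add_mem h1 h2)
    have h4 := Submodule.smul_mem _ (1 / 2 : ℂ) (sub_mem h2 h1)
    have h5 : ∀ u w : TP (k + 3), (1 / 2 : ℂ) • (u - w + (u + w)) = u := fun u w => by module
    have h6 : ∀ u w : TP (k + 3), (1 / 2 : ℂ) • (u + w - (u - w)) = w := fun u w => by module
    rw [h5] at h3
    rw [h6] at h4
    obtain rfl | rfl := fin_two_cases a <;> obtain rfl | rfl := fin_two_cases b
    · exact absurd rfl hab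
    · exact h4
    · exact h3
    · exact absurd rfl hab
  rw [← cre_ann x, map_add, map_add]
  exact add_mem (key _ _) (key _ _)

theorem nonconst_mem_oldSpace_of_dihedral {ζ : Circle}
    (hG : G = Subgroup.closure {gElt ζ, hElt}) {k : ℕ} (r : Fin (k + 3) → Fin 2)
    (hr : ∀ a, r ≠ fun _ => a) : tensorBasis _ r ∈ oldSpace G (k + 3) := by
  refine tensorBasis_mem_oldSpace (m := 1) (fun r hr => ?_)
    (fun k _ s a b hab => cre_cre_mem_oldSpace_of_dihedral hG hab _) (Nat.le_add_left 1 k) r hr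
  revert hr
  refine word_cases (p := fun r => (∀ a, r ≠ fun _ => a) → tensorBasis _ r ∈ _) fun s a => ?_
  refine word_cases (r := s) (p := fun s => (∀ c, (Fin.snoc (α := fun _ => Fin 2) s a) ≠ fun _ => c) →
    tensorBasis _ (Fin.snoc (α := fun _ => Fin 2) s a) ∈ _) fun s b => ?_
  refine word_cases (r := s) (p := fun s => (∀ c, (Fin.snoc (α := fun _ => Fin 2)
    (Fin.snoc (α := fun _ => Fin 2) s b) a) ≠ fun _ => c) → tensorBasis _
      (Fin.snoc (α := fun _ => Fin 2) (Fin.snoc (α := fun _ => Fin 2) s b) a) ∈ _) fun s c hr => ?_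
  rw [← cre_tensorBasis, ← cre_tensorBasis]
  by_cases hab : a = b
  · subst hab
    by_cases hac : a = c
    · subst hac
      refine absurd ?_ (hr a)
      rw [Subsingleton.elim s fun _ => a, snoc_const, snoc_const, snoc_const]
    -- The word is c a a with c ≠ a. Exchanging its first two letters changes it by an old vector
    -- coming from `cup`, and a c a ends in distinct letters.
    · have h1 := cre_cre_mem_oldSpace_of_dihedral hG hac (cre a (tensorBasis 0 s))
      have h2 : cre a (cup (tensorBasis 0 s)) ∈ oldSpace G 3 :=
        cre_mem_oldSpace (hom_mem_oldSpace (cupHom G 0) (tensorBasis 0 s)) a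
      rw [cup_apply, map_sub] at h2
      rw [← cre_tensorBasis]
      obtain rfl | rfl := fin_two_cases a <;> obtain rfl | rfl := fin_two_cases c
      · exact absurd rfl hac
      · have := sub_mem h1 h2
        rwa [sub_sub_cancel] at this
      · have := add_mem h2 h1
        rwa [sub_add_cancel] at this
      · exact absurd rfl hac
  · exact cre_cre_mem_oldSpace_of_dihedral hG hab _

theorem nonconst_mem_oldSpace_one {r : Fin 1 → Fin 2} (hr : ∀ a, r ≠ fun _ => a) :
    tensorBasis _ r ∈ oldSpace G 1 :=
  absurd (funext fun i => by rw [Fin.fin_one_eq_zero i]) (hr (r 0))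

theorem hElt_mem {ζ : Circle} (hG : G = Subgroup.closure {gElt ζ, hElt}) : hElt ∈ G :=
  hG ▸ Subgroup.subset_closure (Or.inr rfl)

theorem gElt_mem {ζ : Circle} (hG : G = Subgroup.closure {gElt ζ, hElt}) : gElt ζ ∈ G :=
  hG ▸ Subgroup.subset_closure (Or.inl rfl)

theorem const_zero_eq (hh : hElt ∈ G) (k : ℕ) : tensorBasis k (fun _ => 0) =
    (Complex.I ^ k)⁻¹ • tensorRep G k ⟨hElt, hh⟩ (tensorBasis k fun _ => 1) := by
  rw [tensorRep_hElt rfl, flip_const_one, smul_smul,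
    inv_mul_cancel₀ (pow_ne_zero _ Complex.I_ne_zero), one_smul]

/-- The element h exchanges the two constant words up to a scalar, so either of them generates the
new part. The assumption `hold` is vacuous in degree one and satisfied from degree three on, but it
fails in degree two. -/
theorem multFree_one_of_dihedral {ζ : Circle} (hG : G = Subgroup.closure {gElt ζ, hElt}) {k : ℕ}
    (h : OrderGT ζ (k + 1)) (hold : ∀ r : Fin (k + 1) → Fin 2, (∀ a, r ≠ fun _ => a) →
      tensorBasis _ r ∈ oldSpace G (k + 1)) : MultFree G (k + 1) 1 := by
  have hζ := gElt_mem hG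
  refine MultFree.of_vectors (fun _ => tensorBasis (k + 1) fun _ => 1)
    (fun _ => const_mem_newSpace hζ (fun d h1 h2 => h d h1 (by omega)) 1)
    (fun _ => (tensorBasis _).ne_zero _) (fun _ T hT => Z_apply_const hζ h hT 1)
    (fun a b hab => absurd (Subsingleton.elim a b) hab)
    (fun a b hab => absurd (Subsingleton.elim a b) hab) fun μ f h1 h2 => ?_
  have h3 : f (tensorBasis (k + 1) fun _ => 1) = 0 := h2 0
  refine hom_eq_zero_of_words fun r => ?_
  by_cases hr : ∃ a, r = fun _ => a
  · obtain ⟨a, rfl⟩ := hr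
    fin_cases a
    · simp only [Fin.zero_eta]
      rw [const_zero_eq (hElt_mem hG), map_smul, hom_comm f, h3, map_zero, smul_zero]
    · exact h3
  · push Not at hr
    exact h1 _ (hold r hr)

/-- The combination of a word and its flip. -/
def pairVec (ε : ℂ) {k : ℕ} (r : Fin k → Fin 2) : TP k :=
  tensorBasis k r + ε • tensorBasis k (flip r)

theorem coord_pairVec (ε : ℂ) {k : ℕ} (r : Fin (k + 1) → Fin 2) :
    (tensorBasis _).coord r (pairVec ε r) = 1 ∧ (tensorBasis _).coord (flip r) (pairVec ε r) = ε := by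
  simp [pairVec, flip_ne, (flip_ne r).symm]

theorem pairVec_ne_zero (ε : ℂ) {k : ℕ} (r : Fin (k + 1) → Fin 2) : pairVec ε r ≠ 0 := by
  intro h
  have := (coord_pairVec ε r).1
  rw [h, map_zero] at this
  exact zero_ne_one this

theorem tensorRep_hElt_pairVec {g : G} (hg : (g : SU2) = hElt) {ε : ℂ} (hε : ε * ε = 1) {k : ℕ}
    (r : Fin k → Fin 2) : tensorRep G k g (pairVec ε r) = (Complex.I ^ k * ε) • pairVec ε r := by
  rw [pairVec, map_add, map_smul, tensorRep_hElt hg, tensorRep_hElt hg, flip_flip, smul_add,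
    smul_smul, smul_smul, mul_assoc, hε]
  rw [mul_one, add_comm, mul_comm ε]

theorem tensorRep_gElt_pairVec {ζ : Circle} {g : G} (hg : (g : SU2) = gElt ζ) {ε : ℂ} {k : ℕ}
    {r : Fin k → Fin 2} (hr : eig ζ (flip r) = eig ζ r) :
    tensorRep G k g (pairVec ε r) = eig ζ r • pairVec ε r := by
  rw [pairVec, map_add, map_smul, tensorRep_gElt hg, tensorRep_gElt hg, hr]
  module

theorem isStableLine_pairVec {ζ : Circle} (hG : G = Subgroup.closure {gElt ζ, hElt}) {ε : ℂ}
    (hε : ε * ε = 1) {k : ℕ} {r : Fin k → Fin 2} (hr : eig ζ (flip r) = eig ζ r) :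
    IsStableLine G (pairVec ε r) := by
  refine isStableLine_of_generators hG (dihedral_generators (fun g hg => ?_) fun g hg => ?_)
  · rw [tensorRep_gElt_pairVec hg hr]
    exact Submodule.smul_mem _ _ (Submodule.mem_span_singleton_self _)
  · rw [tensorRep_hElt_pairVec hg hε]
    exact Submodule.smul_mem _ _ (Submodule.mem_span_singleton_self _)

/-- Commutation with h determines T on the flipped word. On the span of the two words T is then α +
β · flip, and `pairVec` is an eigenvector of the flip. -/
theorem Z_apply_pairVec (hh : hElt ∈ G) {ε : ℂ} (hε : ε * ε = 1) {k : ℕ} {r : Fin (k + 1) → Fin 2}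
    {T : Module.End ℂ (TP (k + 1))} (hT : T ∈ Z G (k + 1))
    (h : ∀ s, s ≠ r → s ≠ flip r → (tensorBasis _).coord s (T (tensorBasis _ r)) = 0) :
    ∃ c : ℂ, T (pairVec ε r) = c • pairVec ε r := by
  set α := (tensorBasis _).coord r (T (tensorBasis _ r)) with hα
  set β := (tensorBasis _).coord (flip r) (T (tensorBasis _ r)) with hβ
  have h1 : T (tensorBasis _ r) = α • tensorBasis _ r + β • tensorBasis _ (flip r) := by
    refine (tensorBasis _).ext_elem fun s => ?_
    by_cases hs : s = r
    · subst hs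
      simp [hα, flip_ne]
    · by_cases hs' : s = flip r
      · subst hs'
        simp [hβ, (flip_ne r).symm]
      · have := h s hs hs'
        rw [Module.Basis.coord_apply] at this
        rw [this]
        simp [Ne.symm hs, Ne.symm hs']
  have h2 : T (tensorBasis _ (flip r)) = α • tensorBasis _ (flip r) + β • tensorBasis _ r := by
    have h3 := mem_Z_iff.1 hT ⟨hElt, hh⟩ (tensorBasis _ r)
    rw [tensorRep_hElt rfl, map_smul, h1, map_add, map_smul, map_smul, tensorRep_hElt rfl,
      tensorRep_hElt rfl, flip_flip, smul_comm α, smul_comm β, ← smul_add] at h3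
    exact smul_right_injective _ (pow_ne_zero _ Complex.I_ne_zero) h3
  refine ⟨α + β * ε, ?_⟩
  rw [pairVec, map_add, map_smul, h1, h2]
  linear_combination (norm := module) (-β * hε) • tensorBasis (k + 1) (flip r)

theorem pairVec_const {ε : ℂ} (k : ℕ) : pairVec ε (fun _ : Fin k => 1) =
    (tensorBasis k fun _ => 1) + ε • tensorBasis k fun _ => 0 := by
  rw [pairVec, flip_const_one]

theorem Z_apply_pairVec_const {ζ : Circle} (hG : G = Subgroup.closure {gElt ζ, hElt}) {ε : ℂ}
    (hε : ε * ε = 1) {k : ℕ} (h : OrderGT ζ k) (h' : ((ζ : ℂ) ^ 2) ^ (k + 1) = 1)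
    {T : Module.End ℂ (TP (k + 1))} (hT : T ∈ Z G (k + 1)) :
    ∃ c : ℂ, T (pairVec ε fun _ => 1) = c • pairVec ε fun _ => 1 := by
  refine Z_apply_pairVec (hElt_mem hG) hε hT fun s hs hs' => ?_
  by_contra hne
  have h1 : tensorRep G (k + 1) ⟨gElt ζ, gElt_mem hG⟩ (T (tensorBasis _ fun _ => 1)) =
      eig ζ (fun _ : Fin (k + 1) => 1) • T (tensorBasis _ fun _ => 1) := by
    rw [← mem_Z_iff.1 hT, tensorRep_gElt rfl, map_smul]
  have h2 := eig_eq_iff.1 (eig_eq_of_coord_ne_zero rfl h1 hne)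
  rw [ones_const_one, h'] at h2
  have h3 := ones_le s
  have h4 : ones s ≠ 0 := fun h4 => hs' (by rw [flip_const_one, eq_const_zero_of_ones h4])
  have h5 : ones s ≠ k + 1 := fun h5 => hs (eq_const_one_of_ones h5)
  exact h (ones s) (by omega) (by omega) h2

theorem eig_flip_const {ζ : Circle} {k : ℕ} (h' : ((ζ : ℂ) ^ 2) ^ k = 1) :
    eig ζ (flip fun _ : Fin k => 1) = eig ζ fun _ : Fin k => 1 := by
  rw [eig_eq_iff, flip_const_one, ones_const_one, ones_const_zero, h', pow_zero]

theorem pairVec_const_mem_newSpace {ζ : Circle} (hG : G = Subgroup.closure {gElt ζ, hElt}) (ε : ℂ)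
    {k : ℕ} (h : OrderGT ζ k) : pairVec ε (fun _ => 1) ∈ newSpace G (k + 1) := by
  rw [pairVec_const]
  exact add_mem (const_mem_newSpace (gElt_mem hG) h 1)
    (Submodule.smul_mem _ _ (const_mem_newSpace (gElt_mem hG) h 0))

theorem pairVec_notMem_span {ε δ : ℂ} (h : ε ≠ δ) {k : ℕ} (r : Fin (k + 1) → Fin 2) :
    pairVec δ r ∉ Submodule.span ℂ {pairVec ε r} := by
  intro hs
  obtain ⟨c, hc⟩ := Submodule.mem_span_singleton.1 hs
  have h1 := congrArg ((tensorBasis _).coord r) hc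
  have h2 := congrArg ((tensorBasis _).coord (flip r)) hc
  rw [map_smul, (coord_pairVec _ r).1, (coord_pairVec _ r).1, smul_eq_mul, mul_one] at h1
  rw [map_smul, (coord_pairVec _ r).2, (coord_pairVec _ r).2, h1, smul_eq_mul, one_mul] at h2
  exact h h2

theorem hom_const_eq_zero_of_pairVec {k : ℕ} {μ : Node G}
    {f : (tensorRep G k).IntertwiningMap μ.ρ} {r : Fin k → Fin 2}
    (h1 : f (pairVec 1 r) = 0) (h2 : f (pairVec (-1) r) = 0) :
    f (tensorBasis k r) = 0 ∧ f (tensorBasis k (flip r)) = 0 := by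
  have h3 : tensorBasis k r = (1 / 2 : ℂ) • (pairVec 1 r + pairVec (-1) r) := by
    rw [pairVec, pairVec]; module
  have h4 : tensorBasis k (flip r) = (1 / 2 : ℂ) • (pairVec 1 r - pairVec (-1) r) := by
    rw [pairVec, pairVec]; module
  constructor
  · rw [h3, map_smul, map_add, h1, h2, add_zero, smul_zero]
  · rw [h4, map_smul, map_sub, h1, h2, sub_zero, smul_zero]

/-- In degree n the constant words have equal eigenvalues under g. Their span breaks up into the
lines of the sum and the difference, on which h acts by opposite scalars. -/
theorem multFree_two_of_dihedral {ζ : Circle} (hG : G = Subgroup.closure {gElt ζ, hElt}) {k : ℕ}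
    (h : OrderGT ζ (k + 2)) (h' : ((ζ : ℂ) ^ 2) ^ (k + 3) = 1) : MultFree G (k + 3) 2 := by
  refine MultFree.of_vectors (fun a => pairVec (sgn a) fun _ => 1)
    (fun a => pairVec_const_mem_newSpace hG _ h) (fun a => pairVec_ne_zero _ _)
    (fun a T hT => Z_apply_pairVec_const hG (sgn_mul_self a) h h' hT)
    (fun a b hab => pairVec_notMem_span (sgn_ne hab) _)
    (fun a b _ => Or.inl (isStableLine_pairVec hG (sgn_mul_self a) (eig_flip_const h')))
    fun μ f h1 h2 => ?_
  obtain ⟨h3, h4⟩ := hom_const_eq_zero_of_pairVec (h2 0) (h2 1)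
  refine hom_eq_zero_of_words fun r => ?_
  by_cases hr : ∃ a, r = fun _ => a
  · obtain ⟨a, rfl⟩ := hr
    fin_cases a
    · rwa [flip_const_one] at h4
    · exact h3
  · push Not at hr
    exact h1 _ (nonconst_mem_oldSpace_of_dihedral hG r hr)

/-- One degree beyond n, each constant word has the eigenvalue under g of the opposite constant word
two degrees lower, and both are reached by one equivariant map. -/
theorem newNodes_eq_empty_of_dihedral {ζ : Circle} (hG : G = Subgroup.closure {gElt ζ, hElt})
    {k : ℕ} (h : ((ζ : ℂ) ^ 2) ^ (k + 2) = 1) : newNodes G (k + 3) = ∅ := by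
  refine newNodes_eq_empty_of_oldSpace
    (Submodule.eq_top_iff_forall_basis_mem (tensorBasis _) |>.2 fun r => ?_)
  by_cases hr : ∃ a, r = fun _ => a
  · obtain ⟨a, rfl⟩ := hr
    have e1 : eig ζ (fun _ : Fin (k + 1) => 0) = eig ζ fun _ : Fin (k + 3) => 1 := by
      rw [eig_eq_iff_add_two, ones_const_zero, ones_const_one, pow_succ _ (k + 2), h]
      simp
    have e2 : eig ζ (fun _ : Fin (k + 1) => 1) = eig ζ fun _ : Fin (k + 3) => 0 := by
      rw [eig_eq_iff_add_two, ones_const_zero, ones_const_one, h, pow_zero]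
    -- The minus sign makes up for `I ^ (k + 3) = -I ^ (k + 1)` in the action of h.
    let f : TP (k + 1) →ₗ[ℂ] TP (k + 3) :=
      ((tensorBasis (k + 1)).coord fun _ => 0).smulRight (tensorBasis (k + 3) fun _ => 1) -
        ((tensorBasis (k + 1)).coord fun _ => 1).smulRight (tensorBasis (k + 3) fun _ => 0)
    have hf : ∀ y, f y = (tensorBasis (k + 1)).coord (fun _ => 0) y • (tensorBasis (k + 3) fun _ => 1) -
        (tensorBasis (k + 1)).coord (fun _ => 1) y • (tensorBasis (k + 3) fun _ => 0) := fun y => rfl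
    have hcomm : ∀ g y, f (tensorRep G (k + 1) g y) = tensorRep G (k + 3) g (f y) := by
      refine fun g y => commutes_of_generators hG f
        (dihedral_generators (fun g hg y => ?_) fun g hg y => ?_) g y
      · rw [hf, hf, coord_tensorRep_gElt hg, coord_tensorRep_gElt hg, map_sub, map_smul, map_smul,
          tensorRep_gElt hg, tensorRep_gElt hg, e1, e2]
        module
      · have h0 : flip (fun _ : Fin (k + 3) => (0 : Fin 2)) = fun _ => 1 := by
          rw [← flip_const_one, flip_flip]
        have h0' : flip (fun _ : Fin (k + 1) => (0 : Fin 2)) = fun _ => 1 := by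
          rw [← flip_const_one, flip_flip]
        rw [hf, hf, coord_tensorRep_hElt hg, coord_tensorRep_hElt hg, map_sub, map_smul, map_smul,
          tensorRep_hElt hg, tensorRep_hElt hg, flip_const_one, flip_const_one, h0, h0',
          pow_succ _ (k + 2), pow_succ _ (k + 1), mul_assoc, Complex.I_mul_I]
        module
    have h3 : (fun _ : Fin (k + 1) => (0 : Fin 2)) ≠ fun _ => 1 := const_ne_const (by decide)
    have hmem := hom_mem_oldSpace (G := G) ⟨f, fun g => LinearMap.ext fun y => hcomm g y⟩
    fin_cases a
    · have := hmem (tensorBasis _ fun _ => 1)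
      change f _ ∈ _ at this
      rw [hf] at this
      simpa [h3.symm] using this
    · have := hmem (tensorBasis _ fun _ => 0)
      change f _ ∈ _ at this
      rw [hf] at this
      simpa [h3] using this
  · push Not at hr
    exact nonconst_mem_oldSpace_of_dihedral hG r hr

/-! ### The second tensor power for the binary dihedral groups -/

/-- The word `v₋₁ v₁`. -/
def w01 : Fin 2 → Fin 2 := ![0, 1]

theorem tensorBasis_w01 : tensorBasis 2 w01 = cre 1 (cre 0 (tensorBasis 0 ![])) := by
  rw [cre_tensorBasis, cre_tensorBasis]
  congr 1
  decide

theorem tensorBasis_flip_w01 : tensorBasis 2 (flip w01) = cre 0 (cre 1 (tensorBasis 0 ![])) := by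
  rw [cre_tensorBasis, cre_tensorBasis]
  congr 1
  decide

theorem word_two_cases (r : Fin 2 → Fin 2) :
    r = w01 ∨ r = flip w01 ∨ r = (fun _ => 1) ∨ r = fun _ => 0 := by
  revert r
  decide

theorem eig_flip_w01 (ζ : Circle) : eig ζ (flip w01) = eig ζ w01 := by
  rw [eig_eq_iff]
  rfl

/-- The element h acts on this vector by i² = -1 and trivially on V^{⊗0}, so every map between the
two vanishes on it. -/
theorem pairVec_w01_mem_newSpace (hh : hElt ∈ G) : pairVec 1 w01 ∈ newSpace G 2 := by
  refine mem_newSpace_iff_hom.2 fun ψ => ?_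
  have h1 := hom_comm ψ ⟨hElt, hh⟩ (pairVec 1 w01)
  rw [tensorRep_zero, tensorRep_hElt_pairVec rfl (by norm_num), map_smul] at h1
  rw [Complex.I_sq] at h1
  have h2 : (2 : ℂ) • ψ (pairVec 1 w01) = 0 := by
    linear_combination (norm := module) -h1
  exact (smul_eq_zero.1 h2).resolve_left two_ne_zero

theorem Z_apply_pairVec_w01 {ζ : Circle} (hG : G = Subgroup.closure {gElt ζ, hElt})
    (h : OrderGT ζ 1) {T : Module.End ℂ (TP 2)} (hT : T ∈ Z G 2) :
    ∃ c : ℂ, T (pairVec 1 w01) = c • pairVec 1 w01 := by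
  refine Z_apply_pairVec (hElt_mem hG) (by norm_num) hT fun s hs hs' => ?_
  by_contra hne
  have h1 : tensorRep G 2 ⟨gElt ζ, gElt_mem hG⟩ (T (tensorBasis 2 w01)) =
      eig ζ w01 • T (tensorBasis 2 w01) := by
    rw [← mem_Z_iff.1 hT, tensorRep_gElt rfl, map_smul]
  have h2 := eig_eq_iff.1 (eig_eq_of_coord_ne_zero rfl h1 hne)
  have h3 := h 1 le_rfl le_rfl
  have h0 : ((ζ : ℂ) ^ 2) ≠ 0 := pow_ne_zero _ (Circle.coe_ne_zero ζ)
  rw [show ones w01 = 1 from rfl] at h2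
  rcases word_two_cases s with rfl | rfl | rfl | rfl
  · exact hs rfl
  · exact hs' rfl
  · rw [ones_const_one] at h2
    exact h3 (mul_left_cancel₀ h0 (by rw [pow_one, mul_one, ← sq, h2, pow_one]))
  · rw [ones_const_zero, pow_zero] at h2
    exact h3 h2.symm

theorem hom_w01_eq_zero {μ : Node G} {f : (tensorRep G 2).IntertwiningMap μ.ρ}
    (h1 : ∀ y ∈ oldSpace G 2, f y = 0) (h2 : f (pairVec 1 w01) = 0) :
    f (tensorBasis 2 w01) = 0 ∧ f (tensorBasis 2 (flip w01)) = 0 := by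
  refine hom_const_eq_zero_of_pairVec h2 ?_
  have := h1 _ (hom_mem_oldSpace (cupHom G 0) (tensorBasis 0 ![]))
  rw [show cupHom G 0 (tensorBasis 0 ![]) = cup (tensorBasis 0 ![]) from rfl, cup_apply,
    ← tensorBasis_w01, ← tensorBasis_flip_w01] at this
  rwa [pairVec, neg_one_smul, ← sub_eq_add_neg]

theorem pairVec_w01_coord (ε : ℂ) (a : Fin 2) :
    (tensorBasis 2).coord (fun _ => a) (pairVec ε w01) = 0 := by
  have h1 : w01 ≠ fun _ => a := by fin_cases a <;> decide
  have h2 : flip w01 ≠ fun _ => a := by fin_cases a <;> decide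
  simp [pairVec, h1, h2]

theorem notMem_span_of_coord {k : ℕ} {x y : TP k} (r : Fin k → Fin 2)
    (hx : (tensorBasis k).coord r x = 0) (hy : (tensorBasis k).coord r y ≠ 0) :
    y ∉ Submodule.span ℂ {x} := by
  intro h
  obtain ⟨c, rfl⟩ := Submodule.mem_span_singleton.1 h
  rw [map_smul, hx, smul_zero] at hy
  exact hy rfl

theorem multFree_two_two_of_dihedral {ζ : Circle} (hG : G = Subgroup.closure {gElt ζ, hElt})
    (h : OrderGT ζ 2) : MultFree G 2 2 := by
  have hζ := gElt_mem hG
  have h' : OrderGT ζ 1 := fun d h1 h2 => h d h1 (by omega)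
  have hst : IsStableLine G (pairVec 1 w01) :=
    isStableLine_pairVec hG (by norm_num) (eig_flip_w01 ζ)
  refine MultFree.of_vectors (k := 2) ![pairVec 1 w01, tensorBasis 2 fun _ => 1] ?_ ?_ ?_ ?_ ?_ ?_
  · rw [Fin.forall_fin_two]
    exact ⟨pairVec_w01_mem_newSpace (hElt_mem hG), const_mem_newSpace hζ h' 1⟩
  · rw [Fin.forall_fin_two]
    exact ⟨pairVec_ne_zero _ _, (tensorBasis 2).ne_zero _⟩
  · rw [Fin.forall_fin_two]
    exact ⟨fun T hT => Z_apply_pairVec_w01 hG h' hT, fun T hT => Z_apply_const hζ h hT 1⟩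
  · simp only [Fin.forall_fin_two]
    have h3 : (fun _ : Fin 2 => (1 : Fin 2)) ≠ w01 := by decide
    refine ⟨⟨fun h => absurd rfl h, fun _ => ?_⟩, fun _ => ?_, fun h => absurd rfl h⟩
    · exact notMem_span_of_coord (fun _ => 1) (pairVec_w01_coord 1 1) (by simp)
    · exact notMem_span_of_coord w01 (by simp [h3]) (by simp [(coord_pairVec 1 w01).1])
  · simp only [Fin.forall_fin_two]
    exact ⟨⟨fun h => absurd rfl h, fun _ => Or.inl hst⟩, fun _ => Or.inr hst, fun h => absurd rfl h⟩
  · intro μ f h1 h2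
    obtain ⟨h3, h4⟩ := hom_w01_eq_zero h1 (h2 0)
    have h5 : f (tensorBasis 2 fun _ => 1) = 0 := h2 1
    refine hom_eq_zero_of_words fun r => ?_
    rcases word_two_cases r with rfl | rfl | rfl | rfl
    · exact h3
    · exact h4
    · exact h5
    · rw [const_zero_eq (hElt_mem hG), map_smul, hom_comm f, h5, map_zero, smul_zero]

/-- If ζ² has order two, the span of the constant words also splits, and with the symmetric vector
there are three lines. -/
theorem multFree_two_three_of_dihedral {ζ : Circle} (hG : G = Subgroup.closure {gElt ζ, hElt})
    (h : OrderGT ζ 1) (h' : ((ζ : ℂ) ^ 2) ^ 2 = 1) : MultFree G 2 3 := by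
  have hst0 : IsStableLine G (pairVec 1 w01) :=
    isStableLine_pairVec hG (by norm_num) (eig_flip_w01 ζ)
  have hst : ∀ a, IsStableLine G (pairVec (sgn a) fun _ : Fin 2 => 1) := fun a =>
    isStableLine_pairVec hG (sgn_mul_self a) (eig_flip_const h')
  have hcoord : ∀ ε : ℂ, (tensorBasis 2).coord w01 (pairVec ε fun _ => 1) = 0 := fun ε => by
    have h1 : (fun _ : Fin 2 => (1 : Fin 2)) ≠ w01 := by decide
    have h2 : (fun _ : Fin 2 => (0 : Fin 2)) ≠ w01 := by decide
    rw [pairVec_const]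
    simp [h1, h2]
  refine MultFree.of_vectors (k := 2) (Fin.cons (pairVec 1 w01) fun a => pairVec (sgn a) fun _ => 1)
    ?_ ?_ ?_ ?_ ?_ ?_
  · rw [Fin.forall_fin_succ]
    exact ⟨pairVec_w01_mem_newSpace (hElt_mem hG), fun a => pairVec_const_mem_newSpace hG _ h⟩
  · rw [Fin.forall_fin_succ]
    exact ⟨pairVec_ne_zero _ _, fun a => pairVec_ne_zero _ _⟩
  · rw [Fin.forall_fin_succ]
    exact ⟨fun T hT => Z_apply_pairVec_w01 hG h hT,
      fun a T hT => Z_apply_pairVec_const hG (sgn_mul_self a) h h' hT⟩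
  · intro a b hab
    cases a using Fin.cases with
    | zero => cases b using Fin.cases with
      | zero => exact absurd rfl hab
      | succ b =>
        exact notMem_span_of_coord (fun _ => 1) (pairVec_w01_coord 1 1)
          (by simp [-Module.Basis.coord_apply, (coord_pairVec _ (fun _ : Fin 2 => (1 : Fin 2))).1])
    | succ a => cases b using Fin.cases with
      | zero =>
        exact notMem_span_of_coord w01 (hcoord _)
          (by simp [-Module.Basis.coord_apply, (coord_pairVec 1 w01).1])
      | succ b => exact pairVec_notMem_span (sgn_ne fun h => hab (congrArg Fin.succ h)) _
  · intro a b _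
    cases a using Fin.cases with
    | zero => exact Or.inl hst0
    | succ a => exact Or.inl (hst a)
  · intro μ f h1 h2
    obtain ⟨h3, h4⟩ := hom_w01_eq_zero h1 (h2 0)
    obtain ⟨h5, h6⟩ := hom_const_eq_zero_of_pairVec (h2 1) (h2 2)
    refine hom_eq_zero_of_words fun r => ?_
    rcases word_two_cases r with rfl | rfl | rfl | rfl
    · exact h3
    · exact h4
    · exact h5
    · rwa [flip_const_one] at h6

/-! ### One-dimensional modules of the binary dihedral groups -/

theorem IsLine.eq {ζ : Circle} (hG : G = Subgroup.closure {gElt ζ, hElt}) {c d c' d' : ℂ}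
    {μ : Node G} (h : IsLine ζ c d μ) (h' : IsLine ζ c' d' μ) : c = c' ∧ d = d' := by
  obtain ⟨v, hv⟩ := μ.nontrivial
  constructor
  · exact smul_left_injective ℂ hv
      ((h.2.1 ⟨_, gElt_mem hG⟩ rfl v).symm.trans (h'.2.1 ⟨_, gElt_mem hG⟩ rfl v))
  · exact smul_left_injective ℂ hv
      ((h.2.2 ⟨_, hElt_mem hG⟩ rfl v).symm.trans (h'.2.2 ⟨_, hElt_mem hG⟩ rfl v))

theorem IsLine.mem_newNodes {ζ : Circle} (hG : G = Subgroup.closure {gElt ζ, hElt}) {k : ℕ}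
    {x : TP k} (hx : x ∈ newSpace G k) (hx0 : x ≠ 0) {c d : ℂ}
    (hc : ∀ g : G, (g : SU2) = gElt ζ → tensorRep G k g x = c • x)
    (hd : ∀ g : G, (g : SU2) = hElt → tensorRep G k g x = d • x) {μ : Node G}
    (h : IsLine ζ c d μ) : μ ∈ newNodes G k := by
  let f₀ : (Fin μ.irrep.dim → ℂ) →ₗ[ℂ] TP k :=
    (LinearMap.proj (⟨0, by rw [h.1]; exact one_pos⟩ : Fin μ.irrep.dim)).smulRight x
  have hf₀ : ∀ v, f₀ v = v ⟨0, by rw [h.1]; exact one_pos⟩ • x := fun v => rfl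
  have hcomm : ∀ g v, f₀ (μ.ρ g v) = tensorRep G k g (f₀ v) := by
    refine fun g v => commutes_of_generators hG f₀
      (dihedral_generators (fun g hg v => ?_) fun g hg v => ?_) g v
    · rw [h.2.1 g hg, map_smul, hf₀, map_smul, hc g hg, smul_comm]
    · rw [h.2.2 g hg, map_smul, hf₀, map_smul, hd g hg, smul_comm]
  let f : μ.ρ.IntertwiningMap (tensorRep G k) := ⟨f₀, fun g => LinearMap.ext fun v => hcomm g v⟩
  have hfx : f (fun _ => 1) = x := by
    change f₀ _ = x
    rw [hf₀, one_smul]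
  refine ⟨mem_Lam_of_apply_ne_zero f (x := fun _ => 1) (by rwa [hfx]), fun hold => hx0 ?_⟩
  refine oldSpace_inf_newSpace (G := G) ?_ hx
  rw [oldSpace]
  refine Submodule.mem_iSup_of_mem μ (Submodule.mem_iSup_of_mem hold ?_)
  exact Submodule.mem_iSup_of_mem f ⟨_, hfx⟩

theorem exists_isLine {ζ : Circle} (hG : G = Subgroup.closure {gElt ζ, hElt}) {k : ℕ} {x : TP k}
    (hx0 : x ≠ 0) {c d : ℂ} (hc : ∀ g : G, (g : SU2) = gElt ζ → tensorRep G k g x = c • x)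
    (hd : ∀ g : G, (g : SU2) = hElt → tensorRep G k g x = d • x) : ∃ μ : Node G, IsLine ζ c d μ := by
  obtain ⟨i, hi⟩ := exists_π_ne_zero (G := G) hx0
  have hst : IsStableLine G x := isStableLine_of_generators hG
    (dihedral_generators (fun g hg => by
      rw [hc g hg]; exact Submodule.smul_mem _ _ (Submodule.mem_span_singleton_self _))
      fun g hg => by
        rw [hd g hg]; exact Submodule.smul_mem _ _ (Submodule.mem_span_singleton_self _))
  have hspan := fun z => Submodule.mem_span_singleton.1
    (Node.mem_span_of_line hi (hst.hom ((dec G k).π i)) z)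
  refine ⟨(dec G k).μ i, ?_, fun g hg v => ?_, fun g hg v => ?_⟩
  · have := finrank_eq_one _ hi hspan
    simpa using this
  · obtain ⟨r, rfl⟩ := hspan v
    rw [map_smul, ← hom_comm, hc g hg, map_smul, smul_comm]
  · obtain ⟨r, rfl⟩ := hspan v
    rw [map_smul, ← hom_comm, hd g hg, map_smul, smul_comm]

/-- A counting argument: the listed lines are new, the vectors realise n pairwise different ones,
and there are only n new nodes. -/
theorem newNodes_eq_lines {ζ : Circle} (hG : G = Subgroup.closure {gElt ζ, hElt}) {k n : ℕ}
    (hn : (newNodes G k).ncard = n) (x : Fin n → TP k) (hx : ∀ a, x a ∈ newSpace G k)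
    (hx0 : ∀ a, x a ≠ 0) (c d : Fin n → ℂ) (hcd : ∀ a b, c a = c b → d a = d b → a = b)
    (hc : ∀ a, ∀ g : G, (g : SU2) = gElt ζ → tensorRep G k g (x a) = c a • x a)
    (hd : ∀ a, ∀ g : G, (g : SU2) = hElt → tensorRep G k g (x a) = d a • x a) :
    newNodes G k = {μ | ∃ a, IsLine ζ (c a) (d a) μ} := by
  have hsub : {μ | ∃ a, IsLine ζ (c a) (d a) μ} ⊆ newNodes G k := fun μ ⟨a, ha⟩ =>
    ha.mem_newNodes hG (hx a) (hx0 a) (hc a) (hd a)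
  refine (Set.eq_of_subset_of_ncard_le hsub ?_ (finite_newNodes G k)).symm
  choose μ hμ using fun a => exists_isLine hG (hx0 a) (hc a) (hd a)
  have hinj : Function.Injective μ := fun a b hab => by
    obtain ⟨h1, h2⟩ := (hμ a).eq hG (hab ▸ hμ b)
    exact hcd a b h1 h2
  have h1 : (Set.range μ).ncard = n := by
    rw [← Set.image_univ, Set.ncard_image_of_injective _ hinj, Set.ncard_univ, Nat.card_fin]
  refine (hn.trans h1.symm).le.trans (Set.ncard_le_ncard ?_ ?_)
  swap
  · exact (finite_newNodes G k).subset hsub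
  rintro _ ⟨a, rfl⟩
  exact ⟨a, hμ a⟩

end

section

variable {G : Subgroup SU2}

/-! ### The group `SU₂` -/

theorem exists_word {k j : ℕ} (h : j ≤ k) : ∃ t : Fin k → Fin 2, ones t = j := by
  induction k generalizing j with
  | zero => exact ⟨fun _ => 0, by rw [ones_const_zero]; omega⟩
  | succ k ih =>
    rcases Nat.eq_zero_or_pos j with rfl | hj
    · exact ⟨fun _ => 0, ones_const_zero _⟩
    · obtain ⟨t, ht⟩ := ih (j := j - 1) (by omega)
      refine ⟨Fin.snoc (α := fun _ => Fin 2) t 1, ?_⟩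
      rw [ones_snoc, ht, Fin.val_one]
      omega

theorem eq_of_ones_eq {r s : Fin 1 → Fin 2} (h : ones r = ones s) : r = s := by
  revert r s
  decide

/-- Modulo old vectors adjacent letters commute, because their commutator is in the image of `cup`.
The class of a word depends only on its number of letters v₁. -/
theorem sub_mem_oldSpace_of_ones_eq {k : ℕ} {r s : Fin k → Fin 2} (h : ones r = ones s) :
    tensorBasis k r - tensorBasis k s ∈ oldSpace G k := by
  have hcre : ∀ k, (∀ {r s : Fin k → Fin 2}, ones r = ones s →
      tensorBasis k r - tensorBasis k s ∈ oldSpace G k) → ∀ {r s : Fin k → Fin 2},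
      ones r = ones s → ∀ a, cre a (tensorBasis k r) - cre a (tensorBasis k s) ∈
        oldSpace G (k + 1) := by
    rintro (_ | _ | k) ih r s hrs a
    · rw [Subsingleton.elim r s, sub_self]
      exact zero_mem _
    · rw [eq_of_ones_eq hrs, sub_self]
      exact zero_mem _
    · rw [← map_sub]
      exact cre_mem_oldSpace (ih hrs) a
  -- For distinct last letters, both prefixes are replaced by a common word t followed by the
  -- opposite letter, and one `cup` exchanges the last two letters.
  have hswap : ∀ k, (∀ {r s : Fin k → Fin 2}, ones r = ones s →
      tensorBasis k r - tensorBasis k s ∈ oldSpace G k) → ∀ {r s : Fin k → Fin 2},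
      ones r = ones s + 1 → cre 0 (tensorBasis k r) - cre 1 (tensorBasis k s) ∈
        oldSpace G (k + 1) := by
    rintro (_ | k) ih r s hrs
    · have := ones_le r
      omega
    · have h1 := ones_le r
      obtain ⟨t, ht⟩ := exists_word (show ones s ≤ k by omega)
      have h2 := hcre _ ih (r := r) (s := Fin.snoc (α := fun _ => Fin 2) t 1)
        (by rw [ones_snoc, ht, hrs, Fin.val_one]) 0
      have h3 := hcre _ ih (r := s) (s := Fin.snoc (α := fun _ => Fin 2) t 0)
        (by rw [ones_snoc, ht, Fin.val_zero, add_zero]) 1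
      have h4 : cup (tensorBasis k t) ∈ oldSpace G (k + 2) := hom_mem_oldSpace (cupHom G k) _
      rw [cup_apply] at h4
      rw [← cre_tensorBasis] at h2 h3
      have := sub_mem (sub_mem h2 h3) h4
      convert this using 1
      abel
  induction k with
  | zero =>
    rw [Subsingleton.elim r s, sub_self]
    exact zero_mem _
  | succ k ih =>
    revert h
    refine word_cases (p := fun r => ones r = ones s → tensorBasis _ r - _ ∈ _) fun r a => ?_
    refine word_cases (p := fun s => ones _ = ones s → _ - tensorBasis _ s ∈ _) fun s b => ?_
    rw [ones_snoc, ones_snoc, ← cre_tensorBasis, ← cre_tensorBasis]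
    intro h
    obtain rfl | rfl := fin_two_cases a <;> obtain rfl | rfl := fin_two_cases b
    · exact hcre k ih (by simpa using h) 0
    · exact hswap k ih (by simpa using h)
    · rw [← neg_mem_iff, neg_sub]
      exact hswap k ih (by simpa using h.symm)
    · exact hcre k ih (by simpa using h) 1

/-- A rotation with rational entries. -/
def rot : SU2 :=
  ⟨!![3 / 5, 4 / 5; -4 / 5, 3 / 5], by
    rw [Matrix.mem_specialUnitaryGroup_iff, Matrix.mem_unitaryGroup_iff]
    constructor
    · ext i j
      fin_cases i <;> fin_cases j <;>
        simp [Matrix.mul_apply, Fin.sum_univ_two, Matrix.star_apply, map_ofNat] <;> norm_num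
    · simp [Matrix.det_fin_two]; norm_num⟩

/-- Each letter v₋₁ contributes 4/5 and each letter v₁ contributes 3/5. What matters is that no
coordinate vanishes and that the coordinate depends only on the weight. -/
theorem coord_rot {g : G} (hg : (g : SU2) = rot) {k : ℕ} (r : Fin k → Fin 2) :
    (tensorBasis k).coord r (tensorRep G k g (tensorBasis k fun _ => 1)) =
      (4 / 5) ^ k * (3 / 4) ^ ones r := by
  induction k with
  | zero =>
    rw [tensorRep_zero, Subsingleton.elim r fun _ => 1]
    simp [ones]
  | succ k ih =>
    refine word_cases (p := fun r => (tensorBasis (k + 1)).coord r _ = _ * _ ^ ones r) fun s a => ?_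
    rw [Module.Basis.coord_apply, tensorBasis_repr_snoc, ← cre_const, tensorRep_cre, hg]
    have h := ih s
    rw [Module.Basis.coord_apply] at h
    have h0 : ent rot 0 1 = 4 / 5 := by simp [ent, rot]
    have h1 : ent rot 1 1 = 3 / 5 := by simp [ent, rot]
    obtain rfl | rfl := fin_two_cases a
    · simp only [map_add, map_smul, ann_cre_self, ann_zero_cre_one, smul_zero, add_zero,
        Finsupp.smul_apply, h, h0, ones_snoc, Fin.val_zero, smul_eq_mul]
      ring
    · simp only [map_add, map_smul, ann_cre_self, ann_one_cre_zero, smul_zero, zero_add,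
        Finsupp.smul_apply, h, h1, ones_snoc, Fin.val_one, smul_eq_mul]
      ring

/-- The number exp(i) is not a root of unity, because π is irrational. -/
theorem exists_orderGT : ∃ ζ : Circle, ∀ m, OrderGT ζ m := by
  refine ⟨Circle.exp 1, fun m d hd _ h => ?_⟩
  rw [← pow_mul, Circle.coe_exp, ← Complex.exp_nat_mul, Complex.exp_eq_one_iff] at h
  obtain ⟨n, hn⟩ := h
  have h1 : ((2 * d : ℕ) : ℂ) = n * (2 * Real.pi) := by
    have := Complex.I_ne_zero
    apply mul_right_cancel₀ this
    rw [mul_assoc, ← hn]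
    push_cast
    ring
  have h2 : ((2 * d : ℕ) : ℝ) = n * (2 * Real.pi) := by exact_mod_cast h1
  have hn0 : (n : ℝ) ≠ 0 := by
    intro h0
    rw [h0, zero_mul] at h2
    have : (2 * d : ℕ) = 0 := by exact_mod_cast h2
    omega
  refine irrational_pi ⟨(d : ℚ) / n, ?_⟩
  push_cast at h2 ⊢
  field_simp
  linarith

theorem eq_zero_of_sum_eigenvectors {M : Type*} [AddCommGroup M] [Module ℂ M]
    (T : Module.End ℂ M) {n : ℕ} {c : Fin n → ℂ} (hc : Function.Injective c) {v : Fin n → M}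
    (hv : ∀ j, T (v j) = c j • v j) {N : Fin n → ℂ} (hN : ∀ j, N j ≠ 0)
    (h : ∑ j, N j • v j = 0) (j : Fin n) : v j = 0 := by
  classical
  by_contra hj
  have hli : LinearIndependent ℂ fun i : {i // v i ≠ 0} => v i :=
    Module.End.eigenvectors_linearIndependent' T (fun i : {i // v i ≠ 0} => c i)
      (hc.comp Subtype.val_injective) _ fun i => ⟨Module.End.mem_eigenspace_iff.2 (hv i), i.2⟩
  refine hN j (Fintype.linearIndependent_iff.1 hli (fun i => N i) ?_ ⟨j, hj⟩)
  refine Eq.trans ?_ h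
  rw [← Finset.sum_filter_of_ne (s := Finset.univ) (p := fun i => v i ≠ 0)]
  · exact (Finset.sum_subtype _ (fun i => by simp) fun i => N i • v i).symm
  · intro i _ hi hvi
    rw [hvi, smul_zero] at hi
    exact hi rfl

/-- The map f kills the rotated vector v₁^{⊗m}, which involves every weight. Modulo old vectors its
weight components are non-zero multiples of single words, whose images are eigenvectors of a
diagonal element for distinct eigenvalues. So each image vanishes. -/
theorem hom_eq_zero_of_top {ζ : Circle} {m : ℕ} (hζ : OrderGT ζ m) {μ : Node (⊤ : Subgroup SU2)}
    {f : (tensorRep ⊤ m).IntertwiningMap μ.ρ} (h1 : ∀ y ∈ oldSpace ⊤ m, f y = 0)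
    (h2 : f (tensorBasis m fun _ => 1) = 0) (r : Fin m → Fin 2) : f (tensorBasis m r) = 0 := by
  choose t ht using fun j : Fin (m + 1) => exists_word (Nat.le_of_lt_succ j.2)
  let o : (Fin m → Fin 2) → Fin (m + 1) := fun r => ⟨ones r, Nat.lt_succ_of_le (ones_le r)⟩
  have hf : ∀ r, f (tensorBasis m r) = f (tensorBasis m (t (o r))) := by
    intro r
    rw [← sub_eq_zero, ← map_sub]
    exact h1 _ (sub_mem_oldSpace_of_ones_eq (ht (o r)).symm)
  -- The sum of the coordinates of the rotated vector over all words with j letters v₁.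
  let N : Fin (m + 1) → ℂ := fun j =>
    (Finset.univ.filter fun r => o r = j).card * ((4 / 5) ^ m * (3 / 4) ^ (j : ℕ))
  have hN : ∀ j, N j ≠ 0 := by
    intro j
    refine mul_ne_zero ?_ (mul_ne_zero (pow_ne_zero _ (by norm_num)) (pow_ne_zero _ (by norm_num)))
    rw [Nat.cast_ne_zero, Finset.card_ne_zero]
    exact ⟨t j, Finset.mem_filter.2 ⟨Finset.mem_univ _, Fin.ext (ht j)⟩⟩
  have hzero : ∑ j, N j • f (tensorBasis m (t j)) = 0 := by
    have h3 : f (tensorRep _ m ⟨rot, Subgroup.mem_top _⟩ (tensorBasis m fun _ => 1)) = 0 := by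
      rw [hom_comm f, h2, map_zero]
    rw [← (tensorBasis m).sum_repr (tensorRep _ m ⟨rot, Subgroup.mem_top _⟩ _), map_sum] at h3
    rw [← h3, ← Finset.sum_fiberwise_of_maps_to (t := Finset.univ) (g := o)
      (fun _ _ => Finset.mem_univ _)]
    refine Finset.sum_congr rfl fun j _ => ?_
    have h4 : ∀ r ∈ Finset.univ.filter (fun r => o r = j),
        f ((tensorBasis m).repr (tensorRep _ m ⟨rot, Subgroup.mem_top _⟩
          (tensorBasis m fun _ => 1)) r • tensorBasis m r) =
        ((4 / 5 : ℂ) ^ m * (3 / 4) ^ (j : ℕ)) • f (tensorBasis m (t j)) := by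
      intro r hr
      have hr' := (Finset.mem_filter.1 hr).2
      have h5 := coord_rot (g := (⟨rot, Subgroup.mem_top _⟩ : (⊤ : Subgroup SU2))) rfl r
      rw [Module.Basis.coord_apply] at h5
      rw [map_smul, h5, hf r, ← hr']
    rw [Finset.sum_congr rfl h4, Finset.sum_const, ← Nat.cast_smul_eq_nsmul ℂ, smul_smul]
  rw [hf r]
  refine eq_zero_of_sum_eigenvectors (μ.ρ ⟨gElt ζ, Subgroup.mem_top _⟩)
    (c := fun j => eig ζ (t j)) (fun i j hij => ?_) (fun j => ?_) hN hzero (o r)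
  · have := hζ.pow_inj (ones_le _) (ones_le _) (eig_eq_iff.1 hij)
    rw [ht, ht] at this
    exact Fin.ext this
  · rw [← hom_comm f, tensorRep_gElt rfl, map_smul]

theorem multFree_of_top {k : ℕ} : MultFree (⊤ : Subgroup SU2) (k + 1) 1 := by
  obtain ⟨ζ, hζ'⟩ := exists_orderGT
  have hζ : gElt ζ ∈ (⊤ : Subgroup SU2) := Subgroup.mem_top _
  exact MultFree.of_vectors (fun _ => tensorBasis (k + 1) fun _ => 1)
    (fun _ => const_mem_newSpace hζ (hζ' _) 1)
    (fun _ => (tensorBasis _).ne_zero _) (fun _ T hT => Z_apply_const hζ (hζ' _) hT 1)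
    (fun a b hab => absurd (Subsingleton.elim a b) hab)
    (fun a b hab => absurd (Subsingleton.elim a b) hab)
    fun μ f h1 h2 => hom_eq_zero_of_words (hom_eq_zero_of_top (hζ' _) h1 (h2 0))

end

/-! ### Edges and distances in the representation graph -/

section

variable {G : Subgroup SU2}

/-! ### Edges of the representation graph -/

/-- The coordinate map `x ⊗ v ↦ v_i x`. -/
def tcoord {W : Type*} [AddCommGroup W] [Module ℂ W] (i : Fin 2) : W ⊗[ℂ] V →ₗ[ℂ] W :=
  (TensorProduct.rid ℂ W).toLinearMap ∘ₗ LinearMap.lTensor W (LinearMap.proj i : V →ₗ[ℂ] ℂ)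

theorem tcoord_tmul {W : Type*} [AddCommGroup W] [Module ℂ W] (i : Fin 2) (x : W) (v : V) :
    tcoord i (x ⊗ₜ[ℂ] v) = v i • x := by
  simp [tcoord]

theorem sum_tcoord {W : Type*} [AddCommGroup W] [Module ℂ W] (w : W ⊗[ℂ] V) :
    tcoord 0 w ⊗ₜ[ℂ] (Pi.single 0 1 : V) + tcoord 1 w ⊗ₜ[ℂ] (Pi.single 1 1 : V) = w := by
  induction w with
  | zero => simp
  | tmul x v =>
    have : v = v 0 • Pi.single 0 1 + v 1 • Pi.single 1 1 := by
      ext i; fin_cases i <;> simp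
    conv_rhs => rw [this]
    rw [tcoord_tmul, tcoord_tmul, TensorProduct.tmul_add, TensorProduct.tmul_smul,
      TensorProduct.tmul_smul, TensorProduct.smul_tmul', TensorProduct.smul_tmul']
  | add x y hx hy =>
    rw [map_add, map_add, TensorProduct.add_tmul, TensorProduct.add_tmul, add_add_add_comm, hx, hy]

theorem tcoord_tprod {W : Type*} [AddCommGroup W] [Module ℂ W] (σ : Representation ℂ G W) (g : G)
    (i : Fin 2) (w : W ⊗[ℂ] V) : tcoord i (σ.tprod (natRep G) g w) =
      ent g i 0 • σ g (tcoord 0 w) + ent g i 1 • σ g (tcoord 1 w) := by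
  induction w with
  | zero => simp
  | tmul x v =>
    rw [Representation.tprod_apply, TensorProduct.map_tmul, tcoord_tmul, tcoord_tmul, tcoord_tmul,
      map_smul, map_smul, smul_smul, smul_smul, ← add_smul]
    congr 1
    simp [natRep, Matrix.mulVec, dotProduct, Fin.sum_univ_two]
  | add x y hx hy =>
    simp only [map_add, hx, hy]
    module

theorem edgeMult_ne_zero_iff {μ ν : Node G} : edgeMult μ ν ≠ 0 ↔
    ∃ θ : ν.ρ.IntertwiningMap (μ.ρ.tprod (natRep G)), ∃ x, θ x ≠ 0 := by
  rw [edgeMult, ← Nat.pos_iff_ne_zero]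
  refine (Module.finrank_pos_iff_exists_ne_zero (R := ℂ)
    (M := ν.ρ.IntertwiningMap (μ.ρ.tprod (natRep G)))).trans ?_
  simp only [hom_ne_zero_iff]

theorem mem_Lam_succ_of_edge {m : ℕ} {μ ν : Node G} (hμ : μ ∈ Lam G m) (h : edgeMult μ ν ≠ 0) :
    ν ∈ Lam G (m + 1) := by
  obtain ⟨θ, x, hx⟩ := edgeMult_ne_zero_iff.1 h
  obtain ⟨f, p, hpf⟩ := exists_retraction hμ
  let F₀ : (Fin ν.irrep.dim → ℂ) →ₗ[ℂ] TP (m + 1) :=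
    (cre 0 ∘ₗ f.toLinearMap ∘ₗ tcoord 0 + cre 1 ∘ₗ f.toLinearMap ∘ₗ tcoord 1) ∘ₗ θ.toLinearMap
  have hF₀ : ∀ y, F₀ y = cre 0 (f (tcoord 0 (θ y))) + cre 1 (f (tcoord 1 (θ y))) := fun _ => rfl
  let F : ν.ρ.IntertwiningMap (tensorRep G (m + 1)) := ⟨F₀, fun g => LinearMap.ext fun y => by
    change F₀ (ν.ρ g y) = tensorRep G (m + 1) g (F₀ y)
    rw [hF₀, hF₀, hom_comm θ, tcoord_tprod, tcoord_tprod]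
    simp only [map_add, map_smul, hom_comm f, tensorRep_cre]
    module⟩
  refine mem_Lam_of_apply_ne_zero F (x := x) fun h0 => hx ?_
  change F₀ x = 0 at h0
  rw [hF₀] at h0
  have h1 := congrArg (fun y => p (ann 0 y)) h0
  have h2 := congrArg (fun y => p (ann 1 y)) h0
  simp only [map_add, ann_cre_self, ann_zero_cre_one, ann_one_cre_zero, add_zero, zero_add, hpf,
    map_zero] at h1 h2
  rw [← sum_tcoord (θ x), h1, h2, TensorProduct.zero_tmul, TensorProduct.zero_tmul, add_zero]

/-- Self-duality of V allows an edge to be traversed backwards. This is needed because `repGraph`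
symmetrises the relation. -/
theorem mem_Lam_succ_of_edge' {m : ℕ} {μ ν : Node G} (hμ : μ ∈ Lam G m) (h : edgeMult ν μ ≠ 0) :
    ν ∈ Lam G (m + 1) := by
  obtain ⟨θ, x, hx⟩ := edgeMult_ne_zero_iff.1 h
  obtain ⟨f, p, hpf⟩ := exists_retraction hμ
  let F₀ : TP (m + 1) →ₗ[ℂ] (Fin ν.irrep.dim → ℂ) :=
    tcoord 1 ∘ₗ θ.toLinearMap ∘ₗ p.toLinearMap ∘ₗ ann 0 -
      tcoord 0 ∘ₗ θ.toLinearMap ∘ₗ p.toLinearMap ∘ₗ ann 1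
  have hF₀ : ∀ y, F₀ y = tcoord 1 (θ (p (ann 0 y))) - tcoord 0 (θ (p (ann 1 y))) := fun _ => rfl
  let F : (tensorRep G (m + 1)).IntertwiningMap ν.ρ := ⟨F₀, fun g => LinearMap.ext fun y => by
    have hd := ent_det g
    rw [LinearMap.comp_apply, LinearMap.comp_apply, hF₀, hF₀, ann_tensorRep, ann_tensorRep]
    simp only [map_add, map_sub, map_smul, hom_comm p, hom_comm θ, tcoord_tprod]
    linear_combination (norm := module) hd • (ν.ρ g (tcoord 1 (θ (p (ann 0 y)))) -
      ν.ρ g (tcoord 0 (θ (p (ann 1 y)))))⟩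
  by_contra hν
  have h0 : ∀ y, F₀ y = 0 := fun y => by
    by_contra hy
    exact hν (mem_Lam_of_hom F hy)
  have h1 := h0 (cre 0 (f x))
  have h2 := h0 (cre 1 (f x))
  rw [hF₀] at h1 h2
  simp only [ann_cre_self, ann_zero_cre_one, ann_one_cre_zero, hpf, map_zero, sub_zero, zero_sub,
    neg_eq_zero] at h1 h2
  apply hx
  rw [← sum_tcoord (θ x), h1, h2, TensorProduct.zero_tmul, TensorProduct.zero_tmul, add_zero]

theorem exists_edge_of_mem_Lam_succ {m : ℕ} {μ : Node G} (hμ : μ ∈ Lam G (m + 1)) :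
    ∃ ν ∈ Lam G m, edgeMult ν μ ≠ 0 := by
  obtain ⟨f, hf⟩ := hμ
  obtain ⟨x, hx⟩ := (hom_ne_zero_iff f).1 hf
  obtain ⟨i, hi⟩ : ∃ i, ann i (f x) ≠ 0 := by
    by_contra! h
    exact hx (tp_ext fun i => by rw [h i, map_zero])
  obtain ⟨j, hj⟩ := exists_π_ne_zero (G := G) hi
  refine ⟨(dec G m).μ j, μ_mem_Lam j, edgeMult_ne_zero_iff.2 ?_⟩
  let F₀ : (Fin μ.irrep.dim → ℂ) →ₗ[ℂ] (Fin ((dec G m).μ j).irrep.dim → ℂ) ⊗[ℂ] V :=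
    ((TensorProduct.mk ℂ _ V).flip (Pi.single 0 1) ∘ₗ ((dec G m).π j).toLinearMap ∘ₗ ann 0 +
      (TensorProduct.mk ℂ _ V).flip (Pi.single 1 1) ∘ₗ ((dec G m).π j).toLinearMap ∘ₗ ann 1) ∘ₗ
        f.toLinearMap
  have hF₀ : ∀ y, F₀ y = ((dec G m).π j (ann 0 (f y))) ⊗ₜ[ℂ] (Pi.single 0 1 : V) +
    ((dec G m).π j (ann 1 (f y))) ⊗ₜ[ℂ] (Pi.single 1 1 : V) := fun _ => rfl
  have hc : ∀ i y, tcoord i (F₀ y) = (dec G m).π j (ann i (f y)) := by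
    intro i y
    rw [hF₀, map_add, tcoord_tmul, tcoord_tmul]
    obtain rfl | rfl := fin_two_cases i <;> simp
  refine ⟨⟨F₀, fun g => LinearMap.ext fun y => ?_⟩, x, fun h0 => hj ?_⟩
  · have h1 : ∀ w w' : (Fin ((dec G m).μ j).irrep.dim → ℂ) ⊗[ℂ] V,
        (∀ i, tcoord i w = tcoord i w') → w = w' := fun w w' h => by
      rw [← sum_tcoord w, ← sum_tcoord w', h, h]
    refine h1 _ _ fun i => ?_
    change tcoord i (F₀ (μ.ρ g y)) = tcoord i (((dec G m).μ j).ρ.tprod (natRep G) g (F₀ y))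
    rw [tcoord_tprod, hc, hc, hc, hom_comm f, ann_tensorRep, map_add, map_smul, map_smul, hom_comm, hom_comm]
  · rw [← hc]
    rw [show F₀ x = 0 from h0, map_zero]

theorem Lam_le_add_two {m : ℕ} {μ : Node G} (hμ : μ ∈ Lam G m) : μ ∈ Lam G (m + 2) := by
  obtain ⟨f, hf⟩ := hμ
  obtain ⟨x, hx⟩ := (hom_ne_zero_iff f).1 hf
  refine mem_Lam_of_apply_ne_zero ((cupHom G m).comp f) (x := x) fun h => hx ?_
  have : cup (f x) = 0 := h
  rw [cup_apply] at this
  have h1 := congrArg (fun y => ann 0 (ann 1 y)) this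
  simpa using h1

theorem Lam_mono {m : ℕ} {μ : Node G} (hμ : μ ∈ Lam G m) (j : ℕ) : μ ∈ Lam G (m + 2 * j) := by
  induction j with
  | zero => exact hμ
  | succ j ih => exact Lam_le_add_two ih

theorem zero_mem_Lam (G : Subgroup SU2) : Node.zero G ∈ Lam G 0 := by
  obtain ⟨φ⟩ : Nonempty ((Node.zero G).irrep.ρ.Equiv (Representation.trivial ℂ G (Fin 1 → ℂ))) :=
    Quotient.mk_out (s := IrrepIn.setoid G)
      (⟨1, Representation.trivial ℂ G (Fin 1 → ℂ), trivial_irreducible G, trivial_occurs G⟩ :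
        IrrepIn G)
  let t : (Representation.trivial ℂ G (Fin 1 → ℂ)).IntertwiningMap (tensorRep G 0) :=
    ⟨(LinearMap.proj 0).smulRight (tensorBasis 0 ![]), fun g => LinearMap.ext fun y => by
      rw [LinearMap.comp_apply, LinearMap.comp_apply, tensorRep_zero]
      rfl⟩
  refine mem_Lam_of_apply_ne_zero (t.comp φ.toIntertwiningMap) (x := φ.symm fun _ => 1) ?_
  rw [Representation.IntertwiningMap.comp_apply]
  have : φ.toIntertwiningMap (φ.symm fun _ => 1) = fun _ => 1 :=
    φ.toLinearEquiv.apply_symm_apply _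
  rw [this]
  change (1 : ℂ) • tensorBasis 0 ![] ≠ 0
  rw [one_smul]
  exact (tensorBasis 0).ne_zero _

theorem eq_zero_of_mem_Lam_zero {μ : Node G} (hμ : μ ∈ Lam G 0) : μ = Node.zero G := by
  obtain ⟨f, hf⟩ := hμ
  obtain ⟨x, hx⟩ := (hom_ne_zero_iff f).1 hf
  obtain ⟨h, p, hp⟩ := exists_retraction (zero_mem_Lam G)
  refine Node.eq_of_apply_ne_zero (p.comp f) (x := x) fun h0 => ?_
  rw [Representation.IntertwiningMap.comp_apply] at h0
  obtain ⟨y, hy⟩ := (Node.zero G).nontrivial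
  have h1 : Module.finrank ℂ (TP 0) = 1 := by
    rw [Module.finrank_eq_card_basis (tensorBasis 0)]
    simp
  obtain ⟨c, hc⟩ := (finrank_eq_one_iff_of_nonzero' _ hx).1 h1 (h y)
  apply hy
  rw [← hp y, ← hc, map_smul, h0, smul_zero]

/-! ### Distances in the representation graph -/

theorem mem_Lam_of_walk {m : ℕ} {μ ν : Node G} (w : (repGraph G).Walk μ ν) (hμ : μ ∈ Lam G m) :
    ν ∈ Lam G (m + w.length) := by
  induction w generalizing m with
  | nil => exact hμ
  | cons h w ih =>
    rw [SimpleGraph.Walk.length_cons, add_comm w.length, ← add_assoc]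
    refine ih ?_
    rcases ((SimpleGraph.fromRel_adj _ _ _).1 h).2 with h | h
    · exact mem_Lam_succ_of_edge hμ h
    · exact mem_Lam_succ_of_edge' hμ h

theorem exists_walk_of_mem_Lam {m : ℕ} {μ : Node G} (hμ : μ ∈ Lam G m) :
    ∃ w : (repGraph G).Walk (Node.zero G) μ, w.length ≤ m := by
  induction m generalizing μ with
  | zero =>
    obtain rfl := eq_zero_of_mem_Lam_zero hμ
    exact ⟨.nil, le_rfl⟩
  | succ m ih =>
    obtain ⟨ν, hν, h⟩ := exists_edge_of_mem_Lam_succ hμ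
    obtain ⟨w, hw⟩ := ih hν
    by_cases hne : ν = μ
    · subst hne
      exact ⟨w, by omega⟩
    · have hadj : (repGraph G).Adj ν μ := (SimpleGraph.fromRel_adj _ _ _).2 ⟨hne, Or.inl h⟩
      exact ⟨w.concat hadj, by rw [SimpleGraph.Walk.length_concat]; omega⟩

/-- A node at distance d occurs in all degrees d, d + 2, d + 4, …. If a new node of degree k + 2
were nearer, then according to the parity of d it would occur in degree k, against newness, or in
degree k + 1, against `h`. -/
theorem setOf_dist_eq {k : ℕ} (h : ∀ μ ∈ newNodes G (k + 2), μ ∉ Lam G (k + 1)) :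
    {μ : Node G | (repGraph G).dist (Node.zero G) μ = k + 2} = newNodes G (k + 2) := by
  have hdist : ∀ {m : ℕ} {μ : Node G}, μ ∈ Lam G m → (repGraph G).dist (Node.zero G) μ ≤ m :=
    fun hμ => by
      obtain ⟨w, hw⟩ := exists_walk_of_mem_Lam hμ
      exact (SimpleGraph.dist_le w).trans hw
  have hLam : ∀ {m : ℕ} {μ : Node G}, μ ∈ Lam G m →
      μ ∈ Lam G ((repGraph G).dist (Node.zero G) μ) := fun hμ => by
    obtain ⟨w, -⟩ := exists_walk_of_mem_Lam hμ
    obtain ⟨w', hw'⟩ := w.reachable.exists_walk_length_eq_dist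
    have := mem_Lam_of_walk w' (zero_mem_Lam G)
    rwa [zero_add, hw'] at this
  ext μ
  rw [Set.mem_ofPred_eq, newNodes, oldNodes_add_two]
  constructor
  · intro hμ
    have hr : (repGraph G).Reachable (Node.zero G) μ := by
      -- For unreachable nodes `dist` takes the value `0`, which is not k + 2.
      by_contra hr
      rw [SimpleGraph.dist_eq_zero_of_not_reachable hr] at hμ
      omega
    obtain ⟨w', hw'⟩ := hr.exists_walk_length_eq_dist
    have h1 := mem_Lam_of_walk w' (zero_mem_Lam G)
    rw [zero_add, hw', hμ] at h1
    exact ⟨h1, fun h2 => by have := hdist h2; omega⟩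
  · intro hμ
    have h1 := hdist hμ.1
    have h2 := hLam hμ.1
    set d := (repGraph G).dist (Node.zero G) μ
    by_contra hne
    rcases Nat.even_or_odd' (k + 1 - d) with ⟨j, hj | hj⟩
    · refine h μ (by rwa [newNodes, oldNodes_add_two]) ?_
      have := Lam_mono h2 j
      rwa [← hj, Nat.add_sub_cancel' (by omega)] at this
    · refine hμ.2 ?_
      have := Lam_mono h2 j
      rwa [show d + 2 * j = k by omega] at this

theorem tensorRep_neg_one {g : G} (hg : ((g : SU2) : Matrix (Fin 2) (Fin 2) ℂ) = -1) {k : ℕ}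
    (x : TP k) : tensorRep G k g x = (-1 : ℂ) ^ k • x := by
  induction k with
  | zero => rw [tensorRep_zero, pow_zero, one_smul]
  | succ k ih =>
    have h : ∀ i j, ent g i j = if i = j then -1 else 0 := fun i j => by
      rw [ent, hg, Matrix.neg_apply, Matrix.one_apply]
      split_ifs <;> simp
    refine tp_ext fun i => ?_
    rw [ann_tensorRep, ih, ih, h, h, map_smul, pow_succ']
    obtain rfl | rfl := fin_two_cases i <;> simp

theorem notMem_Lam_of_neg_one {g : G} (hg : ((g : SU2) : Matrix (Fin 2) (Fin 2) ℂ) = -1) {k : ℕ}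
    {μ : Node G} (hμ : μ ∈ Lam G (k + 1)) : μ ∉ Lam G k := by
  intro hμ'
  have key : ∀ {m : ℕ}, μ ∈ Lam G m → ∀ x, μ.ρ g x = (-1 : ℂ) ^ m • x := by
    intro m hm x
    obtain ⟨f, p, hp⟩ := exists_retraction hm
    rw [← hp (μ.ρ g x), hom_comm f, tensorRep_neg_one hg, map_smul, hp]
  obtain ⟨x, hx⟩ := μ.nontrivial
  have h := (key hμ x).symm.trans (key hμ' x)
  have h2 : (2 * (-1 : ℂ) ^ k) • x = 0 := by
    linear_combination (norm := module) -h
  refine (smul_eq_zero.1 h2).elim (fun h => ?_) hx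
  exact mul_ne_zero two_ne_zero (pow_ne_zero _ (by norm_num)) h

/-- A new node carries the eigenvalue ζ^{±(k+1)} of g. If it also occurred among the eigenvalues on
V^{⊗k}, an odd power ζ^{2d+1} with d ≤ k would be 1. -/
theorem notMem_Lam_of_cyclic {ζ : Circle} (hG : G = Subgroup.closure {gElt ζ}) {k : ℕ}
    (h : ∀ d, d ≤ k → (ζ : ℂ) ^ (2 * d + 1) ≠ 1) {μ : Node G} (hμ : μ ∈ newNodes G (k + 1)) :
    μ ∉ Lam G k := by
  intro hμ'
  have hζ := gElt_mem_closure hG rfl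
  have h0 : (ζ : ℂ) ≠ 0 := Circle.coe_ne_zero ζ
  obtain ⟨i, rfl⟩ := NewIdx.exists_of_mem hμ
  obtain ⟨f, p, hp⟩ := exists_retraction hμ'
  obtain ⟨a, ha⟩ : ∃ a, (dec G (k + 1)).π i (tensorBasis _ fun _ => a) ≠ 0 := by
    by_contra! hc
    obtain ⟨x, hx⟩ := ((dec G (k + 1)).μ i).nontrivial
    apply hx
    rw [← (dec G (k + 1)).π_ι_self i x]
    refine hom_eq_zero_of_words (fun r => ?_) _
    by_cases hr : ∃ a, r = fun _ => a
    · obtain ⟨a, rfl⟩ := hr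
      exact hc a
    · push Not at hr
      exact mem_oldSpace_iff.1 (nonconst_mem_oldSpace_of_cyclic hG r hr) i i.2
  set y := (dec G (k + 1)).π i (tensorBasis _ fun _ => a)
  have hy : tensorRep G k ⟨gElt ζ, hζ⟩ (f y) = eig ζ (fun _ : Fin (k + 1) => a) • f y := by
    rw [← hom_comm f, ← hom_comm, tensorRep_gElt rfl, map_smul, map_smul]
  obtain ⟨r, hr⟩ : ∃ r, (tensorBasis k).coord r (f y) ≠ 0 := by
    by_contra! hc
    apply ha
    rw [← hp y, (tensorBasis k).ext_elem (x := f y) (y := 0) fun r => by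
      rw [map_zero]; exact hc r, map_zero]
  have h1 := eig_eq_of_coord_ne_zero rfl hy hr
  have h2 := ones_le r
  have h3 : (ζ : ℂ) ^ (2 * ones r + 1) = ((ζ : ℂ) ^ 2) ^ ones (fun _ : Fin (k + 1) => a) := by
    have h4 : eig ζ r = (ζ : ℂ)⁻¹ ^ (k + 1) * (ζ : ℂ) ^ (2 * ones r + 1) := by
      rw [eig, pow_succ ((ζ : ℂ)⁻¹), pow_succ _ (2 * ones r), pow_mul]
      linear_combination (-(ζ : ℂ)⁻¹ ^ k * ((ζ : ℂ) ^ 2) ^ ones r) * inv_mul_cancel₀ h0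
    rw [h4, eig] at h1
    exact mul_left_cancel₀ (pow_ne_zero _ (inv_ne_zero h0)) h1
  obtain rfl | rfl := fin_two_cases a
  · rw [ones_const_zero, pow_zero] at h3
    exact h _ h2 h3
  · rw [ones_const_one, ← pow_mul] at h3
    refine h (k - ones r) (by omega)
      (mul_left_cancel₀ (pow_ne_zero (2 * ones r + 1) h0) ?_)
    rw [← pow_add, mul_one, h3]
    congr 1
    omega

theorem neg_one_mem_dihedral {ζ : Circle} (hG : G = Subgroup.closure {gElt ζ, hElt}) :
    ∃ g : G, ((g : SU2) : Matrix (Fin 2) (Fin 2) ℂ) = -1 := by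
  refine ⟨⟨hElt, hElt_mem hG⟩ * ⟨hElt, hElt_mem hG⟩, ?_⟩
  ext i j
  fin_cases i <;> fin_cases j <;> simp [hElt]

theorem neg_one_mem_top :
    ∃ g : (⊤ : Subgroup SU2), ((g : SU2) : Matrix (Fin 2) (Fin 2) ℂ) = -1 :=
  ⟨⟨hElt, Subgroup.mem_top _⟩ * ⟨hElt, Subgroup.mem_top _⟩, by
    ext i j
    fin_cases i <;> fin_cases j <;> simp [hElt]⟩

end

/-! ### Multiplicities and dimensions from traces -/

section

variable {G : Subgroup SU2}

/-! ### Multiplicities and dimensions of spaces of intertwining maps -/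

instance (k : ℕ) : Fintype (dec G k).I := (dec G k).fintype

theorem Node.finrank_hom_self (μ : Node G) : Module.finrank ℂ (μ.ρ.IntertwiningMap μ.ρ) = 1 := by
  refine finrank_eq_one (Representation.IntertwiningMap.id μ.ρ) ?_ fun f => ?_
  · obtain ⟨x, hx⟩ := μ.nontrivial
    intro h
    exact hx (congrArg (fun f : μ.ρ.IntertwiningMap μ.ρ => f x) h)
  · obtain ⟨c, hc⟩ := Node.hom_scalar f
    exact ⟨c, Representation.IntertwiningMap.ext (LinearMap.ext fun x => (hc x).symm)⟩

open Classical in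
theorem Node.finrank_hom (μ ν : Node G) :
    Module.finrank ℂ (μ.ρ.IntertwiningMap ν.ρ) = if μ = ν then 1 else 0 := by
  split_ifs with h
  · subst h
    exact Node.finrank_hom_self μ
  · have : Subsingleton (μ.ρ.IntertwiningMap ν.ρ) :=
      ⟨fun f g => (Node.hom_eq_zero h f).trans (Node.hom_eq_zero h g).symm⟩
    exact Module.finrank_zero_of_subsingleton

/-- The dimension of `Hom_G(V^{⊗a}, V^{⊗b})`. -/
def homDim (G : Subgroup SU2) (a b : ℕ) : ℕ :=
  Module.finrank ℂ ((tensorRep G a).IntertwiningMap (tensorRep G b))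

/-- The matrix of an intertwining map with respect to the decompositions into irreducibles. -/
def blocks (G : Subgroup SU2) (a b : ℕ) : (tensorRep G a).IntertwiningMap (tensorRep G b) ≃ₗ[ℂ]
    ((p : (dec G a).I × (dec G b).I) →
      ((dec G a).μ p.1).ρ.IntertwiningMap ((dec G b).μ p.2).ρ) where
  toFun f p := ((dec G b).π p.2).comp (f.comp ((dec G a).ι p.1))
  map_add' f g := by
    funext p
    refine Representation.IntertwiningMap.ext (LinearMap.ext fun x => ?_)
    exact map_add ((dec G b).π p.2) _ _
  map_smul' c f := by
    funext p
    refine Representation.IntertwiningMap.ext (LinearMap.ext fun x => ?_)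
    exact map_smul ((dec G b).π p.2) _ _
  invFun F := ∑ p, ((dec G b).ι p.2).comp ((F p).comp ((dec G a).π p.1))
  left_inv f := by
    refine Representation.IntertwiningMap.ext (LinearMap.ext fun x => ?_)
    change (∑ p : (dec G a).I × (dec G b).I, ((dec G b).ι p.2).comp
      ((((dec G b).π p.2).comp (f.comp ((dec G a).ι p.1))).comp ((dec G a).π p.1))) x = f x
    rw [Representation.IntertwiningMap.sum_apply, Fintype.sum_prod_type]
    conv_rhs => rw [← dec_sum (G := G) x, map_sum]
    exact Finset.sum_congr rfl fun i _ => dec_sum (f ((dec G a).ι i ((dec G a).π i x)))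
  right_inv F := by
    funext ⟨i, j⟩
    refine Representation.IntertwiningMap.ext (LinearMap.ext fun x => ?_)
    change (dec G b).π j ((∑ p : (dec G a).I × (dec G b).I, ((dec G b).ι p.2).comp
      ((F p).comp ((dec G a).π p.1))) ((dec G a).ι i x)) = F (i, j) x
    rw [Representation.IntertwiningMap.sum_apply, map_sum, Finset.sum_eq_single (i, j)]
    · change (dec G b).π j ((dec G b).ι j (F (i, j) ((dec G a).π i ((dec G a).ι i x)))) = _
      rw [(dec G b).π_ι_self, (dec G a).π_ι_self]
    · rintro ⟨i', j'⟩ _ hne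
      change (dec G b).π j ((dec G b).ι j' (F (i', j') ((dec G a).π i' ((dec G a).ι i x)))) = 0
      by_cases hj : j = j'
      · have hi : i' ≠ i := fun hi => hne (by rw [hi, hj])
        rw [(dec G a).π_ι_ne i' i x hi, map_zero, map_zero, map_zero]
      · exact (dec G b).π_ι_ne j j' _ hj
    · exact fun h => absurd (Finset.mem_univ _) h

open Classical in
/-- The multiplicity of `G^μ` in `V^{⊗k}`. -/
def mult (G : Subgroup SU2) (k : ℕ) (μ : Node G) : ℕ :=
  (Finset.univ.filter fun i : (dec G k).I => (dec G k).μ i = μ).card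

/-- The part of the scalar product of the multiplicity vectors of `V^{⊗a}` and `V^{⊗b}` that comes
from the nodes in `Λ_c \ Λ_{c-2}`. -/
def newGram (G : Subgroup SU2) (a b c : ℕ) : ℕ :=
  ∑ μ ∈ (finite_newNodes G c).toFinset, mult G a μ * mult G b μ

/-- The part of the scalar product of the multiplicity vectors of `V^{⊗a}` and `V^{⊗b}` that comes
from the nodes in `Λ_c`. -/
def gram (G : Subgroup SU2) (a b c : ℕ) : ℕ :=
  ∑ μ ∈ (finite_Lam G c).toFinset, mult G a μ * mult G b μ

theorem homDim_eq_gram (a b : ℕ) : homDim G a b = gram G a b a := by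
  classical
  rw [homDim, (blocks G a b).finrank_eq, Module.finrank_pi_fintype, Fintype.sum_prod_type, gram]
  have h : ∀ i, ∑ j, Module.finrank ℂ (((dec G a).μ i).ρ.IntertwiningMap ((dec G b).μ j).ρ) =
      mult G b ((dec G a).μ i) := fun i => by
    simp only [Node.finrank_hom, mult, Finset.sum_boole, Nat.cast_id]
    congr 1
    ext j
    simp [eq_comm]
  rw [Finset.sum_congr rfl fun i _ => h i, ← Finset.sum_fiberwise_of_maps_to
    (t := (finite_Lam G a).toFinset) (g := (dec G a).μ) fun i _ => by simpa using μ_mem_Lam i]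
  refine Finset.sum_congr rfl fun μ _ => ?_
  rw [Finset.sum_congr rfl fun i hi => by rw [(Finset.mem_filter.1 hi).2], Finset.sum_const,
    smul_eq_mul, mult]
  congr

theorem newNodes_lt_two {c : ℕ} (hc : c < 2) : newNodes G c = Lam G c := by
  rw [newNodes, oldNodes_lt_two hc, Set.sdiff_empty]

theorem gram_lt_two (a b : ℕ) {c : ℕ} (hc : c < 2) : gram G a b c = newGram G a b c := by
  rw [gram, newGram]
  congr 2
  exact (newNodes_lt_two hc).symm

theorem gram_add_two (a b c : ℕ) : gram G a b (c + 2) = gram G a b c + newGram G a b (c + 2) := by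
  classical
  rw [gram, gram, newGram, ← Finset.sum_union]
  · refine Finset.sum_congr ?_ fun _ _ => rfl
    ext μ
    simp only [Finset.mem_union, Set.Finite.mem_toFinset, newNodes, oldNodes_add_two,
      Set.mem_sdiff]
    have := Lam_le_add_two (G := G) (m := c) (μ := μ)
    tauto
  · rw [Finset.disjoint_left]
    intro μ h1 h2
    simp only [Set.Finite.mem_toFinset, newNodes, oldNodes_add_two, Set.mem_sdiff] at h1 h2
    exact h2.2 h1

theorem mult_pos {k : ℕ} {μ : Node G} (h : μ ∈ Lam G k) : 1 ≤ mult G k μ := by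
  obtain ⟨i, hi⟩ := mem_Lam_iff.1 h
  exact Finset.card_pos.2 ⟨i, by simpa using hi⟩

/-- A sum of squares of positive integers that is at most 3 has all its terms equal to 1, so this
one number determines the new part. -/
theorem mult_eq_one_of_newGram {c n : ℕ} (h : newGram G c c c = n) (hn : n ≤ 3) {μ : Node G}
    (hμ : μ ∈ newNodes G c) : mult G c μ = 1 := by
  have h1 := mult_pos hμ.1
  have h2 : mult G c μ * mult G c μ ≤ newGram G c c c :=
    Finset.single_le_sum (f := fun μ => mult G c μ * mult G c μ) (fun _ _ => Nat.zero_le _)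
      ((finite_newNodes G c).mem_toFinset.2 hμ)
  by_contra hne
  have : 2 ≤ mult G c μ := by omega
  nlinarith

theorem MultFree.of_newGram {c n : ℕ} (h : newGram G c c c = n) (hn : n ≤ 3) : MultFree G c n := by
  refine ⟨fun i j hi hij => ?_, ?_⟩
  · have := mult_eq_one_of_newGram h hn hi
    rw [mult] at this
    exact Finset.card_le_one.1 this.le i (by simp) j (by simp [hij])
  · rw [← h, newGram, Set.ncard_eq_toFinset_card _ (finite_newNodes G c), Finset.card_eq_sum_ones]
    refine Finset.sum_congr rfl fun μ hμ => ?_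
    rw [mult_eq_one_of_newGram h hn ((finite_newNodes G c).mem_toFinset.1 hμ)]

theorem exists_vector_of_newGram {c : ℕ} (h : newGram G c c c = 1) :
    ∃ u : ℕ → ℕ, u c = 1 ∧ ∀ a b, newGram G a b c = u a * u b := by
  have h1 := (MultFree.of_newGram h (by norm_num)).2
  obtain ⟨p, hp⟩ := Set.ncard_eq_one.1 h1
  have hp' : (finite_newNodes G c).toFinset = {p} := by
    ext μ
    simp [hp]
  refine ⟨fun a => mult G a p, mult_eq_one_of_newGram h (by norm_num) (by rw [hp]; rfl),
    fun a b => ?_⟩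
  rw [newGram, hp', Finset.sum_singleton]

theorem exists_vectors_of_newGram {c : ℕ} (h : newGram G c c c = 2) :
    ∃ u v : ℕ → ℕ, u c = 1 ∧ v c = 1 ∧ ∀ a b, newGram G a b c = u a * u b + v a * v b := by
  classical
  have h1 := (MultFree.of_newGram h (by norm_num)).2
  obtain ⟨p, q, hpq, hp⟩ := Set.ncard_eq_two.1 h1
  have hp' : (finite_newNodes G c).toFinset = {p, q} := by
    ext μ
    simp [hp]
  refine ⟨fun a => mult G a p, fun a => mult G a q,
    mult_eq_one_of_newGram h (by norm_num) (by rw [hp]; exact Or.inl rfl),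
    mult_eq_one_of_newGram h (by norm_num) (by rw [hp]; exact Or.inr rfl), fun a b => ?_⟩
  rw [newGram, hp', Finset.sum_pair hpq]

theorem newNodes_eq_empty_of_newGram {c : ℕ} (h : newGram G c c c = 0) : newNodes G c = ∅ := by
  have := (MultFree.of_newGram h (by norm_num)).2
  rwa [Set.ncard_eq_zero (finite_newNodes G c)] at this

/-! ### Traces -/

theorem trace_eq_sum {k : ℕ} (T : Module.End ℂ (TP k)) :
    LinearMap.trace ℂ (TP k) T = ∑ r, (tensorBasis k).repr (T (tensorBasis k r)) r := by
  rw [LinearMap.trace_eq_matrix_trace ℂ (tensorBasis k), Matrix.trace]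
  simp [LinearMap.toMatrix_apply]

theorem trace_succ {k : ℕ} (T : Module.End ℂ (TP (k + 1))) :
    LinearMap.trace ℂ (TP (k + 1)) T = ∑ i, LinearMap.trace ℂ (TP k) (ann i ∘ₗ T ∘ₗ cre i) := by
  rw [trace_eq_sum, sum_words_succ]
  refine Finset.sum_congr rfl fun i _ => ?_
  rw [trace_eq_sum]
  refine Finset.sum_congr rfl fun r _ => ?_
  rw [tensorBasis_repr_snoc, ← cre_tensorBasis]
  rfl

theorem trace_embed {k : ℕ} (a : Module.End ℂ (TP k)) :
    LinearMap.trace ℂ (TP (k + 1)) (embed k a) = 2 * LinearMap.trace ℂ (TP k) a := by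
  rw [trace_succ, Fin.sum_univ_two, two_mul]
  congr 2 <;>
  · refine LinearMap.ext fun x => ?_
    rw [LinearMap.comp_apply, LinearMap.comp_apply, embed_cre, ann_cre_self]

/-- The trace of an element of `SU₂`. -/
def tr (g : SU2) : ℂ := ent g 0 0 + ent g 1 1

theorem character_tensorRep (k : ℕ) (g : G) : (tensorRep G k).character g = tr g ^ k := by
  induction k with
  | zero =>
    rw [Representation.character, trace_eq_sum]
    simp [tensorRep_zero]
  | succ k ih =>
    rw [Representation.character] at ih ⊢
    have h : ∀ i, ann i ∘ₗ tensorRep G (k + 1) g ∘ₗ cre i =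
        ent (g : SU2) i i • tensorRep G k g := fun i => by
      refine LinearMap.ext fun x => ?_
      rw [LinearMap.comp_apply, LinearMap.comp_apply, tensorRep_cre]
      obtain rfl | rfl := fin_two_cases i <;> simp
    rw [trace_succ, Fin.sum_univ_two, pow_succ', ← ih, tr, add_mul, h, h,
      LinearMap.map_smul, LinearMap.map_smul]
    rfl

theorem tr_inv (g : SU2) : tr g⁻¹ = tr g := by
  have h : ((g⁻¹ : SU2) : Matrix (Fin 2) (Fin 2) ℂ) = (g : Matrix (Fin 2) (Fin 2) ℂ).adjugate := by
    have h1 : (g : Matrix (Fin 2) (Fin 2) ℂ) * ((g⁻¹ : SU2) : Matrix (Fin 2) (Fin 2) ℂ) = 1 := by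
      exact congrArg (fun x : SU2 => (x : Matrix (Fin 2) (Fin 2) ℂ)) (mul_inv_cancel g)
    have h2 : (g : Matrix (Fin 2) (Fin 2) ℂ).adjugate * (g : Matrix (Fin 2) (Fin 2) ℂ) = 1 := by
      rw [Matrix.adjugate_mul, (Matrix.mem_specialUnitaryGroup_iff.1 g.2).2, one_smul]
    rw [← one_mul ((g⁻¹ : SU2) : Matrix (Fin 2) (Fin 2) ℂ), ← h2, Matrix.mul_assoc, h1, mul_one]
  rw [tr, ent, ent, h, Matrix.adjugate_fin_two]
  simp [tr, ent, add_comm]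

/-- Orthogonality of characters. As g and g⁻¹ have the same trace, only a + b matters. -/
theorem homDim_eq_sum [Fintype G] (a b : ℕ) :
    (homDim G a b : ℂ) = (Nat.card G : ℂ)⁻¹ * ∑ g : G, tr g ^ (a + b) := by
  have hG : (Nat.card G : ℂ) ≠ 0 := Nat.cast_ne_zero.2 Nat.card_pos.ne'
  have : Invertible (Nat.card G : ℂ) := invertibleOfNonzero hG
  rw [homDim, ← Representation.card_inv_mul_sum_char_mul_char_eq_finrank]
  congr 1
  refine Finset.sum_congr rfl fun g _ => ?_
  rw [character_tensorRep, character_tensorRep, pow_add, mul_comm]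
  congr 2
  exact tr_inv (g : SU2)

end

/-! ### Traces of group elements read off from their orders in the quotient -/

section

variable {G : Subgroup SU2}

/-! ### Elements of `SU₂` and their powers -/

/-- The underlying matrix. -/
abbrev mat (g : SU2) : Matrix (Fin 2) (Fin 2) ℂ := g

/-- Cayley–Hamilton with determinant one. Higher powers of g also become αg - β with polynomials in
the trace. If the power is scalar and g is not, then α = 0, which is an equation for the trace. -/
theorem mat_sq (g : SU2) : mat g ^ 2 = tr g • mat g - 1 := by
  have h : mat g 0 0 * mat g 1 1 - mat g 0 1 * mat g 1 0 = 1 := ent_det g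
  have ht : tr g = mat g 0 0 + mat g 1 1 := rfl
  rw [sq]
  ext i j
  fin_cases i <;> fin_cases j <;>
    simp only [Matrix.mul_apply, Fin.sum_univ_two, ht, Matrix.sub_apply, Matrix.smul_apply,
      smul_eq_mul, Matrix.one_apply, Fin.zero_eta, Fin.mk_one, Fin.isValue, if_true, zero_ne_one,
      one_ne_zero, if_false] <;>
    first | linear_combination -h | linear_combination 0 * h

theorem mat_pow_three (g : SU2) : mat g ^ 3 = (tr g ^ 2 - 1) • mat g - tr g • 1 := by
  rw [pow_succ, mat_sq, sub_mul, smul_mul_assoc, ← sq, mat_sq, one_mul]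
  module

theorem mat_pow_four (g : SU2) :
    mat g ^ 4 = (tr g ^ 3 - 2 * tr g) • mat g - (tr g ^ 2 - 1) • 1 := by
  rw [pow_succ, mat_pow_three, sub_mul, smul_mul_assoc, ← sq, mat_sq, smul_mul_assoc, one_mul]
  module

theorem mat_pow_five (g : SU2) :
    mat g ^ 5 = (tr g ^ 4 - 3 * tr g ^ 2 + 1) • mat g - (tr g ^ 3 - 2 * tr g) • 1 := by
  rw [pow_succ, mat_pow_four, sub_mul, smul_mul_assoc, ← sq, mat_sq, smul_mul_assoc, one_mul]
  module

theorem eq_one_or_neg_one_of_smul {g : SU2} {α β : ℂ} (hα : α ≠ 0)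
    (h : α • mat g = β • (1 : Matrix (Fin 2) (Fin 2) ℂ)) : mat g = 1 ∨ mat g = -1 := by
  have h1 : mat g = (α⁻¹ * β) • (1 : Matrix (Fin 2) (Fin 2) ℂ) := by
    rw [mul_smul, ← h, smul_smul, inv_mul_cancel₀ hα, one_smul]
  have h2 := (Matrix.mem_specialUnitaryGroup_iff.1 g.2).2
  change (mat g).det = 1 at h2
  rw [h1, Matrix.det_smul, Matrix.det_one, mul_one, Fintype.card_fin] at h2
  rcases sq_eq_one_iff.1 h2 with h3 | h3
  · left; rw [h1, h3, one_smul]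
  · right; rw [h1, h3, neg_one_smul]

/-! ### Double covers -/

/-- The class of an element, which determines its order in the groups under consideration. -/
def cl {H : Type*} [Group H] [DecidableEq H] (h : H) : Fin 4 :=
  if h = 1 then 0 else if h ^ 2 = 1 then 1 else if h ^ 3 = 1 then 2 else 3

/-- A homomorphism onto `H` with kernel `{1, -1}`. -/
structure Cover (G : Subgroup SU2) (H : Type) [Group H] where
  π : G →* H
  surj : Function.Surjective π
  ker_iff : ∀ g, π g = 1 ↔ mat g = 1 ∨ mat g = -1
  neg_one : ∃ g : G, mat g = -1

theorem IsDoubleCoverOf.exists_cover {H : Type} [Group H] (h : IsDoubleCoverOf G H) :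
    Nonempty (Cover G H) := by
  obtain ⟨π, hs, hk⟩ := h
  have h1 : ∀ g, π g = 1 → mat g = 1 ∨ mat g = -1 := fun g hg => by
    have : mat g ∈ ({1, -1} : Set (Matrix (Fin 2) (Fin 2) ℂ)) := by
      rw [← hk]
      exact ⟨g, hg, rfl⟩
    exact this
  have h2 : (-1 : Matrix (Fin 2) (Fin 2) ℂ) ∈ ({1, -1} : Set (Matrix (Fin 2) (Fin 2) ℂ)) :=
    Or.inr rfl
  rw [← hk] at h2
  obtain ⟨z, hz, hz'⟩ := h2
  refine ⟨⟨π, hs, fun g => ⟨h1 g, ?_⟩, ⟨z, hz'⟩⟩⟩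
  rintro (hg | hg)
  · have : g = 1 := Subtype.ext (Subtype.ext hg)
    rw [this, map_one]
  · have : g = z := Subtype.ext (Subtype.ext (hg.trans hz'.symm))
    rw [this]
    exact hz

namespace Cover

variable {H : Type} [Group H] (c : Cover G H)

theorem smul_eq {g : G} (hg : c.π g ≠ 1) {α β : ℂ}
    (h : α • mat g = β • (1 : Matrix (Fin 2) (Fin 2) ℂ)) : α = 0 := by
  by_contra hα
  exact hg ((c.ker_iff g).2 (eq_one_or_neg_one_of_smul hα h))

theorem pow_eq {g : G} {n : ℕ} (h : c.π g ^ n = 1) :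
    ∃ ε : ℂ, mat g ^ n = ε • (1 : Matrix (Fin 2) (Fin 2) ℂ) := by
  rw [← map_pow] at h
  rcases (c.ker_iff _).1 h with h | h
  · exact ⟨1, by rw [one_smul, ← h]; rfl⟩
  · exact ⟨-1, by rw [neg_one_smul, ← h]; rfl⟩

theorem tr_sq_of_eq_one {g : G} (h : c.π g = 1) : tr g ^ 2 = 4 := by
  rcases (c.ker_iff _).1 h with h | h
  · have : tr g = 2 := by rw [tr, ent, ent, show (g : SU2).1 = 1 from h]; simp; norm_num
    rw [this]; norm_num
  · have : tr g = -2 := by rw [tr, ent, ent, show (g : SU2).1 = -1 from h]; simp; norm_num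
    rw [this]; norm_num

theorem tr_sq_of_sq_eq_one {g : G} (h1 : c.π g ≠ 1) (h : c.π g ^ 2 = 1) : tr g ^ 2 = 0 := by
  obtain ⟨ε, hε⟩ := c.pow_eq h
  rw [mat_sq] at hε
  have := c.smul_eq h1 (α := tr g) (β := ε + 1)
    (by linear_combination (norm := module) hε)
  rw [this]; norm_num

theorem tr_sq_of_pow_three_eq_one {g : G} (h1 : c.π g ≠ 1) (h : c.π g ^ 3 = 1) : tr g ^ 2 = 1 := by
  obtain ⟨ε, hε⟩ := c.pow_eq h
  rw [mat_pow_three] at hε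
  have := c.smul_eq h1 (α := tr g ^ 2 - 1) (β := ε + tr g)
    (by linear_combination (norm := module) hε)
  exact sub_eq_zero.1 this

theorem tr_sq_of_pow_four_eq_one {g : G} (h1 : c.π g ≠ 1) (h2 : c.π g ^ 2 ≠ 1)
    (h : c.π g ^ 4 = 1) : tr g ^ 2 = 2 := by
  obtain ⟨ε, hε⟩ := c.pow_eq h
  rw [mat_pow_four] at hε
  have h3 := c.smul_eq h1 (α := tr g ^ 3 - 2 * tr g) (β := ε + (tr g ^ 2 - 1))
    (by linear_combination (norm := module) hε)
  -- Trace zero would give g² = -1, so that the square of the image would be trivial.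
  have h4 : tr g ≠ 0 := fun h0 => by
    apply h2
    rw [← map_pow, c.ker_iff]
    right
    have := mat_sq g
    rw [h0, zero_smul, zero_sub] at this
    exact this
  have h5 : tr g * (tr g ^ 2 - 2) = 0 := by linear_combination h3
  exact sub_eq_zero.1 ((mul_eq_zero.1 h5).resolve_left h4)

theorem tr_sq_of_pow_five_eq_one {g : G} (h1 : c.π g ≠ 1) (h : c.π g ^ 5 = 1) :
    (tr g ^ 2) ^ 2 = 3 * tr g ^ 2 - 1 := by
  obtain ⟨ε, hε⟩ := c.pow_eq h
  rw [mat_pow_five] at hε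
  have := c.smul_eq h1 (α := tr g ^ 4 - 3 * tr g ^ 2 + 1) (β := ε + (tr g ^ 3 - 2 * tr g))
    (by linear_combination (norm := module) hε)
  linear_combination this

theorem tr_neg {g g' : SU2} (h : mat g = -mat g') : tr g = -tr g' := by
  rw [tr, tr, ent, ent, ent, ent, show g.1 = -g'.1 from h]
  simp [add_comm]

/-- The square of the trace as a function on `H`. -/
def t (h : H) : ℂ := tr (c.surj h).choose ^ 2

/-- Two lifts of an element of H differ by a sign, so the squared trace does not depend on the
chosen lift. -/
theorem t_π (g : G) : c.t (c.π g) = tr g ^ 2 := by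
  set g' := (c.surj (c.π g)).choose with hg'
  have h1 : c.π g' = c.π g := (c.surj (c.π g)).choose_spec
  have h2 : c.π (g' * g⁻¹) = 1 := by rw [map_mul, map_inv, h1, mul_inv_cancel]
  have h3 : mat g' = mat (g' * g⁻¹ : G) * mat g := by
    rw [← Submonoid.coe_mul, ← Subgroup.coe_mul, inv_mul_cancel_right]
  change tr g' ^ 2 = tr g ^ 2
  rcases (c.ker_iff _).1 h2 with h | h
  · rw [h, one_mul] at h3
    rw [show (g' : SU2) = g from Subtype.ext h3]
  · rw [h, neg_one_mul] at h3
    rw [tr_neg h3, neg_sq]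

include c in
theorem finite [Finite H] : Finite G := by
  have hker : Finite {g : G // c.π g = 1} := by
    refine Finite.of_injective (β := ({1, -1} : Set (Matrix (Fin 2) (Fin 2) ℂ)))
      (fun g => ⟨mat g.1, (c.ker_iff _).1 g.2⟩) fun g g' h => ?_
    have h' := congrArg
      (fun y : ({1, -1} : Set (Matrix (Fin 2) (Fin 2) ℂ)) => (y : Matrix (Fin 2) (Fin 2) ℂ)) h
    exact Subtype.ext (Subtype.ext (Subtype.ext h'))
  refine Finite.of_injective (β := H × {g : G // c.π g = 1})
    (fun g => (c.π g, ⟨g * (c.surj (c.π g)).choose⁻¹, by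
      rw [map_mul, map_inv, (c.surj (c.π g)).choose_spec, mul_inv_cancel]⟩)) fun g g' h => ?_
  have h1 : c.π g = c.π g' := congrArg Prod.fst h
  have h2 := congrArg (fun p => (p.2 : G)) h
  simp only [h1] at h2
  exact mul_right_cancel h2

theorem sum_comp [Fintype G] [Fintype H] [DecidableEq H] (F : H → ℂ) : ∑ g, F (c.π g) =
    (Finset.univ.filter fun g => c.π g = 1).card * ∑ h, F h := by
  rw [← Finset.sum_fiberwise_of_maps_to (t := Finset.univ) (g := c.π) fun _ _ => Finset.mem_univ _,
    Finset.mul_sum]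
  refine Finset.sum_congr rfl fun h _ => ?_
  rw [Finset.sum_congr rfl fun g hg => by rw [(Finset.mem_filter.1 hg).2], Finset.sum_const,
    nsmul_eq_mul, MonoidHom.card_fiber_eq_of_mem_range c.π (c.surj h) (c.surj 1)]

/-- All fibres of the cover have the same size, which cancels in the average over G. The identity is
kept free of denominators. -/
theorem card_mul_homDim [Fintype H] [DecidableEq H] {a b m : ℕ} (hab : a + b = 2 * m) :
    (Fintype.card H * homDim G a b : ℂ) = ∑ h, c.t h ^ m := by
  have := c.finite
  have : Fintype G := Fintype.ofFinite G
  have h1 := c.sum_comp fun _ => 1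
  have h2 := c.sum_comp fun h => c.t h ^ m
  have h3 : ∑ g : G, tr g ^ (a + b) = ∑ g, c.t (c.π g) ^ m :=
    Finset.sum_congr rfl fun g _ => by rw [c.t_π, ← pow_mul, hab]
  simp only [Finset.sum_const, Finset.card_univ, nsmul_eq_mul, mul_one] at h1
  have h0 : (Fintype.card G : ℂ) ≠ 0 := Nat.cast_ne_zero.2 Fintype.card_ne_zero
  rw [homDim_eq_sum, h3, h2, Nat.card_eq_fintype_card, h1]
  rw [h1] at h0
  have h4 := left_ne_zero_of_mul h0
  have h5 := right_ne_zero_of_mul h0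
  field_simp

theorem sum_pow [Fintype H] [DecidableEq H] (m : ℕ) : ∑ h, c.t h ^ m = 4 ^ m +
    (Finset.univ.filter fun h : H => cl h = 1).card * 0 ^ m +
    (Finset.univ.filter fun h : H => cl h = 2).card +
    ∑ h ∈ Finset.univ.filter (fun h : H => cl h = 3), c.t h ^ m := by
  rw [← Finset.sum_fiberwise_of_maps_to (t := Finset.univ) (g := cl) fun _ _ => Finset.mem_univ _,
    Fin.sum_univ_four]
  have hcl : ∀ h : H, (cl h = 0 → h = 1) ∧ (cl h = 1 → h ≠ 1 ∧ h ^ 2 = 1) ∧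
      (cl h = 2 → h ≠ 1 ∧ h ^ 3 = 1) := fun h => by
    unfold cl
    split_ifs with h1 h2 h3 <;> simp_all
  have h0 : Finset.univ.filter (fun h : H => cl h = 0) = {1} := by
    ext h
    simp only [Finset.mem_filter, Finset.mem_univ, true_and, Finset.mem_singleton]
    exact ⟨(hcl h).1, fun h => by rw [h]; simp [cl]⟩
  have e0 : c.t 1 = 4 := by
    obtain ⟨g, hg⟩ := c.surj 1
    rw [← hg, c.t_π, c.tr_sq_of_eq_one hg]
  have e1 : ∀ h ∈ Finset.univ.filter (fun h : H => cl h = 1), c.t h ^ m = 0 ^ m := fun h hh => by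
    obtain ⟨h1, h2⟩ := (hcl h).2.1 (Finset.mem_filter.1 hh).2
    obtain ⟨g, rfl⟩ := c.surj h
    rw [c.t_π, c.tr_sq_of_sq_eq_one h1 h2]
  have e2 : ∀ h ∈ Finset.univ.filter (fun h : H => cl h = 2), c.t h ^ m = 1 := fun h hh => by
    obtain ⟨h1, h2⟩ := (hcl h).2.2 (Finset.mem_filter.1 hh).2
    obtain ⟨g, rfl⟩ := c.surj h
    rw [c.t_π, c.tr_sq_of_pow_three_eq_one h1 h2, one_pow]
  rw [h0, Finset.sum_singleton, e0, Finset.sum_congr rfl e1, Finset.sum_congr rfl e2]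
  simp

end Cover

theorem cl_three {H : Type*} [Group H] [DecidableEq H] {h : H} (hh : cl h = 3) :
    h ≠ 1 ∧ h ^ 2 ≠ 1 := by
  constructor
  · rintro rfl
    simp [cl] at hh
  · intro h2
    unfold cl at hh
    split_ifs at hh <;> simp at hh

theorem homDim_tetrahedral (c : Cover G (alternatingGroup (Fin 4))) {a b m : ℕ}
    (hab : a + b = 2 * m) : 12 * homDim G a b = 4 ^ m + 3 * 0 ^ m + 8 := by
  have hc : ∀ j, (Finset.univ.filter fun h : alternatingGroup (Fin 4) => cl h = j).card =
      ![1, 3, 8, 0] j := by decide +kernel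
  have hcard : Fintype.card (alternatingGroup (Fin 4)) = 12 := by decide +kernel
  have h := (c.card_mul_homDim hab).trans (c.sum_pow m)
  rw [hc, hc, Finset.card_eq_zero.1 (hc 3), Finset.sum_empty, hcard] at h
  simp only [Matrix.cons_val] at h
  rw [add_zero] at h
  exact_mod_cast h

theorem homDim_octahedral (c : Cover G (Equiv.Perm (Fin 4))) {a b m : ℕ}
    (hab : a + b = 2 * m) : 24 * homDim G a b = 4 ^ m + 9 * 0 ^ m + 8 + 6 * 2 ^ m := by
  have hc : ∀ j, (Finset.univ.filter fun h : Equiv.Perm (Fin 4) => cl h = j).card =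
      ![1, 9, 8, 6] j := by decide +kernel
  have hfour : ∀ h : Equiv.Perm (Fin 4), cl h = 3 → h ^ 4 = 1 := by decide +kernel
  have hcard : Fintype.card (Equiv.Perm (Fin 4)) = 24 := by decide +kernel
  have e3 : ∀ h ∈ Finset.univ.filter (fun h : Equiv.Perm (Fin 4) => cl h = 3),
      c.t h ^ m = 2 ^ m := fun h hh => by
    have h1 := (Finset.mem_filter.1 hh).2
    obtain ⟨g, rfl⟩ := c.surj h
    rw [c.t_π, c.tr_sq_of_pow_four_eq_one (cl_three h1).1 (cl_three h1).2 (hfour _ h1)]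
  have h := (c.card_mul_homDim hab).trans (c.sum_pow m)
  rw [Finset.sum_congr rfl e3, Finset.sum_const, hc, hc, hc, hcard, nsmul_eq_mul] at h
  simp only [Matrix.cons_val] at h
  exact_mod_cast h

/-- The power sums of the roots of `w ^ 2 - 3 * w + 1`. -/
def powSum : ℕ → ℤ
  | 0 => 2
  | 1 => 3
  | m + 2 => 3 * powSum (m + 1) - powSum m

theorem pow_add_pow_eq_powSum {w : ℂ} (hw : w ^ 2 = 3 * w - 1) (m : ℕ) :
    w ^ m + (3 - w) ^ m = powSum m := by
  induction m using Nat.twoStepInduction with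
  | zero => norm_num [powSum]
  | one => norm_num [powSum]
  | more m h1 h2 =>
    rw [powSum]
    push_cast
    rw [← h1, ← h2]
    linear_combination (w ^ m + (3 - w) ^ m) * hw

/-- For an element of order five the squared trace is a root w of w² = 3w - 1, and that of its
square is the other root 3 - w. Squaring permutes the 24 elements of order five, so together they
contribute 12 times the power sum of the two roots. -/
theorem homDim_icosahedral (c : Cover G (alternatingGroup (Fin 5))) {a b m : ℕ}
    (hab : a + b = 2 * m) : (60 * homDim G a b : ℤ) = 4 ^ m + 15 * 0 ^ m + 20 + 12 * powSum m := by
  have hc : ∀ j, (Finset.univ.filter fun h : alternatingGroup (Fin 5) => cl h = j).card =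
      ![1, 15, 20, 24] j := by decide +kernel
  have hfive : ∀ h : alternatingGroup (Fin 5), cl h = 3 →
      h ^ 5 = 1 ∧ cl (h ^ 2) = 3 ∧ cl (h ^ 3) = 3 := by decide +kernel
  have hcard : Fintype.card (alternatingGroup (Fin 5)) = 60 := by decide +kernel
  have e3 : ∀ h ∈ Finset.univ.filter (fun h : alternatingGroup (Fin 5) => cl h = 3),
      c.t h ^ m + c.t (h ^ 2) ^ m = powSum m := fun h hh => by
    have h1 := (Finset.mem_filter.1 hh).2
    obtain ⟨g, rfl⟩ := c.surj h
    have h2 := c.tr_sq_of_pow_five_eq_one (cl_three h1).1 (hfive _ h1).1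
    have h3 : tr (g ^ 2 : G) = tr g ^ 2 - 2 := by
      have h4 : mat (g ^ 2 : G) = tr g • mat g - 1 := mat_sq g
      rw [tr, ent, ent, show (g ^ 2 : G).1.1 = tr g • mat g - 1 from h4]
      simp only [Matrix.sub_apply, Matrix.smul_apply, Matrix.one_apply, if_true, smul_eq_mul, mat]
      rw [tr, ent, ent]
      ring
    rw [← map_pow, c.t_π, c.t_π, ← pow_add_pow_eq_powSum h2, h3]
    congr 2
    linear_combination h2
  have e4 : ∑ h ∈ Finset.univ.filter (fun h : alternatingGroup (Fin 5) => cl h = 3),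
      c.t (h ^ 2) ^ m = ∑ h ∈ Finset.univ.filter (fun h : alternatingGroup (Fin 5) => cl h = 3),
      c.t h ^ m := by
    -- Since h⁶ = h, cubing is inverse to squaring.
    have h6 : ∀ h : alternatingGroup (Fin 5), cl h = 3 → (h ^ 2) ^ 3 = h ∧ (h ^ 3) ^ 2 = h :=
      fun h hh => by
        rw [← pow_mul, ← pow_mul, pow_succ h 5, (hfive h hh).1, one_mul]
        exact ⟨rfl, rfl⟩
    refine Finset.sum_nbij' (fun h => h ^ 2) (fun h => h ^ 3) ?_ ?_ ?_ ?_ fun _ _ => rfl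
    · intro h hh
      exact Finset.mem_filter.2 ⟨Finset.mem_univ _, (hfive h (Finset.mem_filter.1 hh).2).2.1⟩
    · intro h hh
      exact Finset.mem_filter.2 ⟨Finset.mem_univ _, (hfive h (Finset.mem_filter.1 hh).2).2.2⟩
    · exact fun h hh => (h6 h (Finset.mem_filter.1 hh).2).1
    · exact fun h hh => (h6 h (Finset.mem_filter.1 hh).2).2
  have e5 := Finset.sum_congr rfl e3
  rw [Finset.sum_add_distrib, e4, Finset.sum_const, hc, nsmul_eq_mul] at e5
  have h := (c.card_mul_homDim hab).trans (c.sum_pow m)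
  rw [hc, hc, hcard] at h
  simp only [Matrix.cons_val] at h e5
  have h' : (60 * homDim G a b : ℂ) = 4 ^ m + 15 * 0 ^ m + 20 + 12 * powSum m := by
    push_cast at h e5
    linear_combination h + e5 / 2
  exact_mod_cast h'

end

section

variable {G : Subgroup SU2}

/-! ### The new parts for the binary polyhedral groups -/

theorem gram_eq_sum (a b r n : ℕ) (hr : r < 2) :
    gram G a b (2 * n + r) = ∑ i ∈ Finset.range (n + 1), newGram G a b (2 * i + r) := by
  induction n with
  | zero => simp [gram_lt_two a b hr]
  | succ n ih =>
    rw [Finset.sum_range_succ, ← ih, show 2 * (n + 1) + r = 2 * n + r + 2 by ring, gram_add_two]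

theorem homDim_even (n b : ℕ) :
    homDim G (2 * n) b = ∑ i ∈ Finset.range (n + 1), newGram G (2 * n) b (2 * i) := by
  rw [homDim_eq_gram]
  exact gram_eq_sum (2 * n) b 0 n (by norm_num)

theorem homDim_odd (n b : ℕ) :
    homDim G (2 * n + 1) b = ∑ i ∈ Finset.range (n + 1), newGram G (2 * n + 1) b (2 * i + 1) := by
  rw [homDim_eq_gram]
  exact gram_eq_sum (2 * n + 1) b 1 n (by norm_num)

/-- A Gram–Schmidt process in the natural numbers. Once the lower nodes are known, the scalar
product with degree c gives the multiplicity in higher degrees of the node that is new in degree c.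
The square of a vector, minus the known contributions, is the sum of the squares of the new
multiplicities. For two nodes that are new in the same degree only the sum of their multiplicities
is visible. -/
theorem newGram_of_tetrahedral (H : ∀ a b m, a + b = 2 * m → 12 * homDim G a b = 4 ^ m + 3 * 0 ^ m + 8) :
    newGram G 1 1 1 = 1 ∧ newGram G 2 2 2 = 1 ∧ newGram G 3 3 3 = 2 ∧ newGram G 4 4 4 = 2 ∧
      newGram G 5 5 5 = 0 := by
  have e0 := fun b => homDim_even (G := G) 0 b
  have e1 := fun b => homDim_even (G := G) 1 b
  have e2 := fun b => homDim_even (G := G) 2 b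
  have o0 := fun b => homDim_odd (G := G) 0 b
  have o1 := fun b => homDim_odd (G := G) 1 b
  have o2 := fun b => homDim_odd (G := G) 2 b
  norm_num [Finset.sum_range_succ] at e0 e1 e2 o0 o1 o2
  have h00 := H 0 0 0 rfl
  have h02 := H 0 2 1 rfl
  have h04 := H 0 4 2 rfl
  have h22 := H 2 2 2 rfl
  have h24 := H 2 4 3 rfl
  have h44 := H 4 4 4 rfl
  have h11 := H 1 1 1 rfl
  have h13 := H 1 3 2 rfl
  have h15 := H 1 5 3 rfl
  have h33 := H 3 3 3 rfl
  have h35 := H 3 5 4 rfl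
  have h55 := H 5 5 5 rfl
  norm_num at h00 h02 h04 h22 h24 h44 h11 h13 h15 h33 h35 h55
  obtain ⟨u0, u00, hu0⟩ := exists_vector_of_newGram (G := G) (c := 0) (by rw [← e0]; omega)
  obtain ⟨u1, u11, hu1⟩ := exists_vector_of_newGram (G := G) (c := 1) (by rw [← o0]; omega)
  rw [e0, hu0, u00] at h02 h04
  rw [o0, hu1, u11] at h13 h15
  have u02 : u0 2 = 1 := by omega
  have u04 : u0 4 = 2 := by omega
  have u13 : u1 3 = 2 := by omega
  have u15 : u1 5 = 6 := by omega
  rw [e1, hu0, u02] at h22 h24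
  rw [u04] at h24
  rw [o1, hu1, u13] at h33 h35
  rw [u15] at h35
  obtain ⟨u2, u22, hu2⟩ := exists_vector_of_newGram (G := G) (c := 2) (by omega)
  have n3 : newGram G 3 3 3 = 2 := by omega
  obtain ⟨p, q, p3, q3, hpq⟩ := exists_vectors_of_newGram n3
  rw [hu2, u22] at h24
  rw [hpq, p3, q3] at h35
  have u24 : u2 4 = 4 := by omega
  rw [e2, hu0, hu2, u04, u24] at h44
  rw [o2, hu1, hpq, u15] at h55
  refine ⟨by rw [hu1, u11], by rw [hu2, u22], n3, by omega, ?_⟩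
  -- By convexity these two multiplicities already account for the whole remainder 50 in degree
  -- five.
  have hs : p 5 + q 5 = 10 := by omega
  have : 50 ≤ p 5 * p 5 + q 5 * q 5 := by
    zify at hs ⊢
    nlinarith [sq_nonneg ((p 5 : ℤ) - q 5)]
  omega

theorem newGram_of_octahedral
    (H : ∀ a b m, a + b = 2 * m → 24 * homDim G a b = 4 ^ m + 9 * 0 ^ m + 8 + 6 * 2 ^ m) :
    newGram G 1 1 1 = 1 ∧ newGram G 2 2 2 = 1 ∧ newGram G 3 3 3 = 1 ∧ newGram G 4 4 4 = 2 ∧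
      newGram G 5 5 5 = 1 ∧ newGram G 6 6 6 = 1 ∧ newGram G 7 7 7 = 0 := by
  have e0 := fun b => homDim_even (G := G) 0 b
  have e1 := fun b => homDim_even (G := G) 1 b
  have e2 := fun b => homDim_even (G := G) 2 b
  have e3 := fun b => homDim_even (G := G) 3 b
  have o0 := fun b => homDim_odd (G := G) 0 b
  have o1 := fun b => homDim_odd (G := G) 1 b
  have o2 := fun b => homDim_odd (G := G) 2 b
  have o3 := fun b => homDim_odd (G := G) 3 b
  norm_num [Finset.sum_range_succ] at e0 e1 e2 e3 o0 o1 o2 o3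
  have h00 := H 0 0 0 rfl
  have h02 := H 0 2 1 rfl
  have h04 := H 0 4 2 rfl
  have h06 := H 0 6 3 rfl
  have h22 := H 2 2 2 rfl
  have h24 := H 2 4 3 rfl
  have h26 := H 2 6 4 rfl
  have h44 := H 4 4 4 rfl
  have h46 := H 4 6 5 rfl
  have h66 := H 6 6 6 rfl
  have h11 := H 1 1 1 rfl
  have h13 := H 1 3 2 rfl
  have h15 := H 1 5 3 rfl
  have h17 := H 1 7 4 rfl
  have h33 := H 3 3 3 rfl
  have h35 := H 3 5 4 rfl
  have h37 := H 3 7 5 rfl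
  have h55 := H 5 5 5 rfl
  have h57 := H 5 7 6 rfl
  have h77 := H 7 7 7 rfl
  norm_num at h00 h02 h04 h06 h22 h24 h26 h44 h46 h66 h11 h13 h15 h17 h33 h35 h37 h55 h57 h77
  obtain ⟨u0, u00, hu0⟩ := exists_vector_of_newGram (G := G) (c := 0) (by rw [← e0]; omega)
  obtain ⟨u1, u11, hu1⟩ := exists_vector_of_newGram (G := G) (c := 1) (by rw [← o0]; omega)
  rw [e0, hu0, u00] at h02 h04 h06
  rw [o0, hu1, u11] at h13 h15 h17
  have u02 : u0 2 = 1 := by omega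
  have u04 : u0 4 = 2 := by omega
  have u06 : u0 6 = 5 := by omega
  have u13 : u1 3 = 2 := by omega
  have u15 : u1 5 = 5 := by omega
  have u17 : u1 7 = 15 := by omega
  rw [e1, hu0, u02] at h22 h24 h26
  rw [u04] at h24
  rw [u06] at h26
  rw [o1, hu1, u13] at h33 h35 h37
  rw [u15] at h35
  rw [u17] at h37
  obtain ⟨u2, u22, hu2⟩ := exists_vector_of_newGram (G := G) (c := 2) (by omega)
  obtain ⟨u3, u33, hu3⟩ := exists_vector_of_newGram (G := G) (c := 3) (by omega)
  rw [hu2, u22] at h24 h26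
  rw [hu3, u33] at h35 h37
  have u24 : u2 4 = 3 := by omega
  have u26 : u2 6 = 10 := by omega
  have u35 : u3 5 = 5 := by omega
  have u37 : u3 7 = 21 := by omega
  rw [e2, hu0, hu2, u04, u24] at h44 h46
  rw [u06, u26] at h46
  rw [o2, hu1, hu3, u15, u35] at h55 h57
  rw [u17, u37] at h57
  have n4 : newGram G 4 4 4 = 2 := by omega
  obtain ⟨p, q, p4, q4, hpq⟩ := exists_vectors_of_newGram n4
  obtain ⟨u5, u55, hu5⟩ := exists_vector_of_newGram (G := G) (c := 5) (by omega)
  rw [hpq, p4, q4] at h46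
  rw [hu5, u55] at h57
  have u57 : u5 7 = 7 := by omega
  rw [e3, hu0, hu2, hpq, u06, u26] at h66
  rw [o3, hu1, hu3, hu5, u17, u37, u57] at h77
  have hs : p 6 + q 6 = 11 := by omega
  have h6 : p 6 * p 6 + q 6 * q 6 + newGram G 6 6 6 = 62 := by omega
  refine ⟨by rw [hu1, u11], by rw [hu2, u22], by rw [hu3, u33], n4, by rw [hu5, u55], ?_, by omega⟩
  -- Two numbers with sum 11 and squares summing to at most 62 are 5 and 6, with square sum 61, so
  -- exactly 1 is left for the new part.
  obtain ⟨x, hx⟩ : ∃ x, x = p 6 := ⟨_, rfl⟩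
  have hq : q 6 = 11 - x := by omega
  have hx11 : x ≤ 11 := by omega
  rw [hq, ← hx] at h6
  interval_cases x <;> omega

theorem newGram_of_icosahedral (H : ∀ a b m, a + b = 2 * m →
      (60 * homDim G a b : ℤ) = 4 ^ m + 15 * 0 ^ m + 20 + 12 * powSum m) :
    newGram G 1 1 1 = 1 ∧ newGram G 2 2 2 = 1 ∧ newGram G 3 3 3 = 1 ∧ newGram G 4 4 4 = 1 ∧
      newGram G 5 5 5 = 1 ∧ newGram G 6 6 6 = 2 ∧ newGram G 7 7 7 = 1 ∧ newGram G 8 8 8 = 0 := by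
  have e0 := fun b => homDim_even (G := G) 0 b
  have e1 := fun b => homDim_even (G := G) 1 b
  have e2 := fun b => homDim_even (G := G) 2 b
  have e3 := fun b => homDim_even (G := G) 3 b
  have e4 := fun b => homDim_even (G := G) 4 b
  have o0 := fun b => homDim_odd (G := G) 0 b
  have o1 := fun b => homDim_odd (G := G) 1 b
  have o2 := fun b => homDim_odd (G := G) 2 b
  have o3 := fun b => homDim_odd (G := G) 3 b
  norm_num [Finset.sum_range_succ] at e0 e1 e2 e3 e4 o0 o1 o2 o3
  have h00 := H 0 0 0 rfl
  have h02 := H 0 2 1 rfl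
  have h04 := H 0 4 2 rfl
  have h06 := H 0 6 3 rfl
  have h08 := H 0 8 4 rfl
  have h22 := H 2 2 2 rfl
  have h24 := H 2 4 3 rfl
  have h26 := H 2 6 4 rfl
  have h28 := H 2 8 5 rfl
  have h44 := H 4 4 4 rfl
  have h46 := H 4 6 5 rfl
  have h48 := H 4 8 6 rfl
  have h66 := H 6 6 6 rfl
  have h68 := H 6 8 7 rfl
  have h88 := H 8 8 8 rfl
  have h11 := H 1 1 1 rfl
  have h13 := H 1 3 2 rfl
  have h15 := H 1 5 3 rfl
  have h17 := H 1 7 4 rfl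
  have h33 := H 3 3 3 rfl
  have h35 := H 3 5 4 rfl
  have h37 := H 3 7 5 rfl
  have h55 := H 5 5 5 rfl
  have h57 := H 5 7 6 rfl
  have h77 := H 7 7 7 rfl
  norm_num [powSum] at h00 h02 h04 h06 h08 h22 h24 h26 h28 h44 h46 h48 h66 h68 h88
  norm_num [powSum] at h11 h13 h15 h17 h33 h35 h37 h55 h57 h77
  norm_cast at h00 h02 h04 h06 h08 h22 h24 h26 h28 h44 h46 h48 h66 h68 h88
  norm_cast at h11 h13 h15 h17 h33 h35 h37 h55 h57 h77
  obtain ⟨u0, u00, hu0⟩ := exists_vector_of_newGram (G := G) (c := 0) (by rw [← e0]; omega)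
  obtain ⟨u1, u11, hu1⟩ := exists_vector_of_newGram (G := G) (c := 1) (by rw [← o0]; omega)
  rw [e0, hu0, u00] at h02 h04 h06 h08
  rw [o0, hu1, u11] at h13 h15 h17
  have u02 : u0 2 = 1 := by omega
  have u04 : u0 4 = 2 := by omega
  have u06 : u0 6 = 5 := by omega
  have u08 : u0 8 = 14 := by omega
  have u13 : u1 3 = 2 := by omega
  have u15 : u1 5 = 5 := by omega
  have u17 : u1 7 = 14 := by omega
  rw [e1, hu0, u02] at h22 h24 h26 h28
  rw [u04] at h24
  rw [u06] at h26
  rw [u08] at h28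
  rw [o1, hu1, u13] at h33 h35 h37
  rw [u15] at h35
  rw [u17] at h37
  obtain ⟨u2, u22, hu2⟩ := exists_vector_of_newGram (G := G) (c := 2) (by omega)
  obtain ⟨u3, u33, hu3⟩ := exists_vector_of_newGram (G := G) (c := 3) (by omega)
  rw [hu2, u22] at h24 h26 h28
  rw [hu3, u33] at h35 h37
  have u24 : u2 4 = 3 := by omega
  have u26 : u2 6 = 9 := by omega
  have u28 : u2 8 = 28 := by omega
  have u35 : u3 5 = 4 := by omega
  have u37 : u3 7 = 14 := by omega
  rw [e2, hu0, hu2, u04, u24] at h44 h46 h48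
  rw [u06, u26] at h46
  rw [u08, u28] at h48
  rw [o2, hu1, hu3, u15, u35] at h55 h57
  rw [u17, u37] at h57
  obtain ⟨u4, u44, hu4⟩ := exists_vector_of_newGram (G := G) (c := 4) (by omega)
  obtain ⟨u5, u55, hu5⟩ := exists_vector_of_newGram (G := G) (c := 5) (by omega)
  rw [hu4, u44] at h46 h48
  rw [hu5, u55] at h57
  have u46 : u4 6 = 5 := by omega
  have u48 : u4 8 = 21 := by omega
  have u57 : u5 7 = 7 := by omega
  rw [e3, hu0, hu2, hu4, u06, u26, u46] at h66 h68
  rw [u08, u28, u48] at h68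
  rw [o3, hu1, hu3, hu5, u17, u37, u57] at h77
  have n6 : newGram G 6 6 6 = 2 := by omega
  obtain ⟨p, q, p6, q6, hpq⟩ := exists_vectors_of_newGram n6
  rw [hpq, p6, q6] at h68
  rw [e4, hu0, hu2, hu4, hpq, u08, u28, u48] at h88
  have hs : p 8 + q 8 = 15 := by omega
  have h8 : p 8 * p 8 + q 8 * q 8 + newGram G 8 8 8 = 113 := by omega
  refine ⟨by rw [hu1, u11], by rw [hu2, u22], by rw [hu3, u33], by rw [hu4, u44], by rw [hu5, u55],
    n6, by omega, ?_⟩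
  -- Two numbers with sum 15 have square sum at least 113, attained by 7 and 8, so nothing is left
  -- for the new part.
  obtain ⟨x, hx⟩ : ∃ x, x = p 8 := ⟨_, rfl⟩
  have hq : q 8 = 15 - x := by omega
  have hx11 : x ≤ 15 := by omega
  rw [hq, ← hx] at h8
  interval_cases x <;> omega

end

section

variable {G : Subgroup SU2}

/-! ### Separation of the two new summands for the binary tetrahedral group -/

theorem finrank_TP (k : ℕ) : Module.finrank ℂ (TP k) = 2 ^ k := by
  rw [Module.finrank_eq_card_basis (tensorBasis k)]
  simp

instance (k : ℕ) : Module.Finite ℂ (TP k) := Module.Finite.of_basis (tensorBasis k)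

theorem oldSpace_two (h : MultFree G 1 1) : oldSpace G 2 = LinearMap.range (cup (k := 0)) := by
  refine le_antisymm (fun x hx => ?_) ?_
  · rw [← dec_sum (G := G) x]
    refine sum_mem fun i _ => ?_
    by_cases hi : (dec G 2).μ i ∈ newNodes G 2
    · rw [mem_oldSpace_iff.1 hx i hi, map_zero]
      exact zero_mem _
    · have h0 : (dec G 2).μ i ∈ Lam G 0 := by
        rw [← μ_mem_old_iff] at hi
        rwa [← oldNodes_add_two]
      obtain ⟨f, g, hfg⟩ := exists_retraction h0
      obtain ⟨a, ha, hb⟩ := exists_bend (((dec G 2).ι i).comp g)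
      rw [(Z_one_eq_bot h).1] at ha
      obtain ⟨c, rfl⟩ := Algebra.mem_bot.1 ha
      have := hb (f ((dec G 2).π i x))
      refine ⟨c • f ((dec G 2).π i x), ?_⟩
      rw [AlgHom.commutes, Module.algebraMap_end_apply] at this
      rw [map_smul]
      refine this.trans ?_
      change (dec G 2).ι i (g (f ((dec G 2).π i x))) = _
      rw [hfg]
  · rintro _ ⟨x, rfl⟩
    exact hom_mem_oldSpace (cupHom G 0) x

theorem isCompl_oldSpace_newSpace (G : Subgroup SU2) (k : ℕ) :
    IsCompl (oldSpace G k) (newSpace G k) := by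
  refine ⟨Submodule.disjoint_def.2 fun x => oldSpace_inf_newSpace, codisjoint_iff.2 ?_⟩
  refine eq_top_iff.2 fun x _ => ?_
  rw [← sub_add_cancel x (newProj G k x)]
  exact Submodule.add_mem_sup (sub_newProj_mem_oldSpace x) (newProj_mem_newSpace x)

theorem cup_injective (k : ℕ) : Function.Injective (cup (k := k)) := by
  refine (injective_iff_map_eq_zero _).2 fun x hx => ?_
  have := congrArg (fun y => ann 0 (ann 1 y)) hx
  simpa [cup_apply] using this

theorem finrank_oldSpace_two (h : MultFree G 1 1) : Module.finrank ℂ (oldSpace G 2) = 1 := by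
  rw [oldSpace_two h, LinearMap.finrank_range_of_inj (cup_injective 0), finrank_TP, pow_zero]

theorem finrank_newSpace_two (h : MultFree G 1 1) : Module.finrank ℂ (newSpace G 2) = 3 := by
  have := Submodule.finrank_add_eq_of_isCompl (isCompl_oldSpace_newSpace G 2)
  rw [finrank_oldSpace_two h, finrank_TP] at this
  omega

/-- With a single new summand the new part is irreducible, so a non-zero map into it is onto. -/
theorem range_eq_newSpace {k l : ℕ} (h : MultFree G k 1)
    (ψ : (tensorRep G l).IntertwiningMap (tensorRep G k)) (hψ : ∀ x, ψ x ∈ newSpace G k)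
    (h0 : ψ ≠ 0) : LinearMap.range ψ.toLinearMap = newSpace G k := by
  refine le_antisymm (by rintro _ ⟨x, rfl⟩; exact hψ x) fun y hy => ?_
  obtain ⟨x, hx⟩ := (hom_ne_zero_iff ψ).1 h0
  obtain ⟨i, hi⟩ := exists_π_ne_zero (G := G) hx
  have hin : (dec G k).μ i ∈ newNodes G k := by
    by_contra hn
    exact hi (mem_newSpace_iff.1 (hψ x) i hn)
  have hs : Subsingleton (NewIdx G k) := (Nat.card_eq_one_iff_unique.1 h.card).1
  have hp : ∀ z ∈ newSpace G k, (dec G k).ι i ((dec G k).π i z) = z := fun z hz => by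
    rw [← proj_apply]
    conv_rhs => rw [← newProj_of_mem_newSpace hz, newProj_eq_sum,
      Fintype.sum_subsingleton _ (⟨i, hin⟩ : NewIdx G k)]
  obtain ⟨j, hj⟩ : ∃ j, ((dec G k).π i) (ψ ((dec G l).ι j ((dec G l).π j x))) ≠ 0 := by
    by_contra! hc
    apply hi
    rw [← dec_sum (G := G) x, map_sum, map_sum]
    exact Finset.sum_eq_zero fun j _ => hc j
  have hsurj : Function.Surjective (((dec G k).π i).comp (ψ.comp ((dec G l).ι j))) := by
    rcases Representation.IsIrreducible.bijective_or_eq_zero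
      (((dec G k).π i).comp (ψ.comp ((dec G l).ι j))) with hf | hf
    · exact hf.2
    · exact absurd (congrArg (fun f => f ((dec G l).π j x)) hf) hj
  obtain ⟨w, hw⟩ := hsurj ((dec G k).π i y)
  refine ⟨(dec G l).ι j w, ?_⟩
  change ψ ((dec G l).ι j w) = y
  rw [← hp y hy, ← hw]
  exact (hp _ (hψ _)).symm

theorem finrank_range_embed {k : ℕ} {f : Module.End ℂ (TP k)} (hf : IsIdempotentElem f) :
    Module.finrank ℂ (LinearMap.range (embed k f)) = 2 * Module.finrank ℂ (LinearMap.range f) := by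
  have h1 := (LinearMap.IsIdempotentElem.isProj_range _ hf).trace
  have h2 := (LinearMap.IsIdempotentElem.isProj_range _ (hf.map (embed k))).trace
  rw [trace_embed, h1] at h2
  exact_mod_cast h2.symm

theorem embed_injective (k : ℕ) : Function.Injective (embed k) := by
  intro a b h
  refine LinearMap.ext fun x => ?_
  have := congrArg (fun F => ann 0 (F (cre 0 x))) h
  simpa [embed_cre] using this

/-- Bending ψ gives `cap` ∘ (b ⊗ 1), and b acts on a new summand as a scalar. So on P ⊗ V, with P
this summand, `cap` is up to scalars the only map to V^{⊗k}. -/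
theorem MultFree.hom_eq_smul {k c : ℕ} (h : MultFree G (k + 1) c) (i : NewIdx G (k + 1))
    (ψ : (tensorRep G (k + 2)).IntertwiningMap (tensorRep G k)) :
    ∃ r : ℂ, ∀ x, ψ (embed (k + 1) (proj G (k + 1) i) x) =
      r • cap (embed (k + 1) (proj G (k + 1) i) x) := by
  obtain ⟨b, hb, hbψ⟩ := exists_bend' ψ
  obtain ⟨r, hr⟩ := h.mul_proj hb i
  refine ⟨r, fun x => ?_⟩
  rw [← hbψ, ← Module.End.mul_apply, ← map_mul, hr, map_smul, LinearMap.smul_apply, map_smul]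

/-- Let P be the summand and suppose that P ⊗ V has no new part. Its only map to V^{⊗2}, up to
scalars, is `cap`, which is then injective on it, so the image of `cap` has dimension 2 dim P. Since
`newProj` acts on this image by a scalar, the image lies in the old part, of dimension 1, or is the
whole new part, of dimension 3. Neither is possible for a positive even dimension. -/
theorem embed_proj_mul_newProj_ne_zero (h1 : MultFree G 1 1) (h2 : MultFree G 2 1) {c : ℕ}
    (h3 : MultFree G 3 c) (i : NewIdx G 3) : embed 3 (proj G 3 i) * newProj G 4 ≠ 0 := by
  intro h0
  set F := embed 3 (proj G 3 i) with hF
  have hFZ : F ∈ Z G 4 := embed_mem_Z (proj_mem_Z (G := G) i.1)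
  have hFF : F * F = F := by rw [hF, ← map_mul, proj_mul_self]
  set ψ := (capHom G 2).comp (homOfMemZ hFZ) with hψ
  have hψa : ∀ x, ψ x = cap (F x) := fun x => rfl
  have hinj : ∀ x ∈ LinearMap.range F, cap x = 0 → x = 0 := by
    rintro _ ⟨x, rfl⟩ hx
    have : F x ∈ newSpace G 4 := mem_newSpace_iff_hom.2 fun φ => by
      obtain ⟨r, hr⟩ := h3.hom_eq_smul i φ
      rw [hr, hx, smul_zero]
    rw [← hFF, Module.End.mul_apply, ← newProj_of_mem_newSpace this, ← Module.End.mul_apply, h0]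
    rfl
  have hrange : LinearMap.range ψ.toLinearMap = (LinearMap.range F).map cap := by
    rw [← LinearMap.range_comp]
    rfl
  have hfin : Module.finrank ℂ (LinearMap.range ψ.toLinearMap) =
      2 * Module.finrank ℂ (LinearMap.range (proj G 3 i)) := by
    rw [← finrank_range_embed (proj_mul_self (i : (dec G 3).I)), hrange, ← LinearMap.range_domRestrict]
    exact (LinearEquiv.ofInjective (cap.domRestrict (LinearMap.range F))
      ((injective_iff_map_eq_zero _).2 fun x hx => Subtype.ext (hinj x x.2 hx))).finrank_eq.symm
  have hF0 : F ≠ 0 := fun h => proj_ne_zero (i : (dec G 3).I) (embed_injective 3 (by rw [← hF, h, map_zero]))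
  have hψ0 : ψ ≠ 0 := by
    intro h
    apply hF0
    refine LinearMap.ext fun x => hinj _ ⟨x, rfl⟩ ?_
    rw [← hψa, h]
    rfl
  obtain ⟨r, hr⟩ := h3.hom_eq_smul i ((homOfMemZ newProj_mem_Z).comp (capHom G 2))
  have hr' : ∀ x, newProj G 2 (ψ x) = r • ψ x := hr
  by_cases hr0 : r = 0
  · have hle : LinearMap.range ψ.toLinearMap ≤ oldSpace G 2 := by
      rintro _ ⟨x, rfl⟩
      have := sub_newProj_mem_oldSpace (G := G) (ψ x)
      rwa [hr', hr0, zero_smul, sub_zero] at this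
    have h4 := Submodule.finrank_mono hle
    rw [finrank_oldSpace_two h1, hfin] at h4
    have h5 : Module.finrank ℂ (LinearMap.range ψ.toLinearMap) = 0 := by omega
    rw [Submodule.finrank_eq_zero, LinearMap.range_eq_bot] at h5
    exact hψ0 (Representation.IntertwiningMap.ext h5)
  · have h4 := range_eq_newSpace h2 ψ (fun x => by
      have := newProj_mem_newSpace (G := G) (ψ x)
      rw [hr'] at this
      rwa [Submodule.smul_mem_iff _ hr0] at this) hψ0
    rw [h4, finrank_newSpace_two h1] at hfin
    omega

/-- Old vectors tensored with V are old, so a new vector must lie in the previous new part tensored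
with V. -/
theorem embed_newProj_of_mem_newSpace {k : ℕ} {y : TP (k + 3)} (hy : y ∈ newSpace G (k + 3)) :
    embed (k + 2) (newProj G (k + 2)) y = y := by
  have h1 : embed (k + 2) (newProj G (k + 2)) y ∈ newSpace G (k + 3) :=
    Z_mem_newSpace (embed_mem_Z newProj_mem_Z) hy
  have h2 : y - embed (k + 2) (newProj G (k + 2)) y =
      cre 0 (ann 0 y - newProj G (k + 2) (ann 0 y)) +
        cre 1 (ann 1 y - newProj G (k + 2) (ann 1 y)) := by
    rw [embed_apply, map_sub, map_sub]
    nth_rewrite 1 [← cre_ann y]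
    abel
  have h3 : y - embed (k + 2) (newProj G (k + 2)) y ∈ oldSpace G (k + 3) := by
    rw [h2]
    exact add_mem (cre_mem_oldSpace (sub_newProj_mem_oldSpace _) 0)
      (cre_mem_oldSpace (sub_newProj_mem_oldSpace _) 1)
  exact (sub_eq_zero.1 (oldSpace_inf_newSpace h3 (sub_mem hy h1))).symm

/-- If a acted on n as r, then b would act as 1 - r, and ba = 0 would force r(1 - r) = 0. -/
theorem not_scalar_of_add_eq {A : Type*} [Ring A] [Algebra ℂ A] {a b n : A} (ha : a * n ≠ 0)
    (hb : b * n ≠ 0) (hab : a * n + b * n = n) (hba : b * a = 0) (r : ℂ) : a * n ≠ r • n := by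
  intro hr
  have h1 : b * n = (1 - r) • n := by
    rw [sub_smul, one_smul, ← hr]
    exact eq_sub_of_add_eq' hab
  have h0 : b * (a * n) = 0 := by rw [← mul_assoc, hba, zero_mul]
  rw [hr, mul_smul_comm, h1, smul_smul] at h0
  rcases smul_eq_zero.1 h0 with h | h
  · rcases mul_eq_zero.1 h with h | h
    · exact ha (by rw [hr, h, zero_smul])
    · exact hb (by rw [h1, h, zero_smul])
  · exact ha (by rw [h, mul_zero])

theorem Z_four_eq_adjoin_e (h1 : MultFree G 1 1) (h2 : MultFree G 2 1) (h3 : MultFree G 3 2)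
    (h4 : MultFree G 4 2) :
    Z G 4 = Algebra.adjoin ℂ ((Zin G 3 : Set (Module.End ℂ (TP 4))) ∪ {e 3}) := by
  obtain ⟨i, j, hij⟩ : ∃ i j : NewIdx G 3, i ≠ j := by
    have : Nontrivial (NewIdx G 3) := by
      rw [← Finite.one_lt_card_iff_nontrivial, h3.card]
      norm_num
    exact exists_pair_ne _
  have hs : embed 3 (newProj G 3) * newProj G 4 = newProj G 4 :=
    LinearMap.ext fun x => embed_newProj_of_mem_newSpace (k := 1) (newProj_mem_newSpace x)
  rw [h3.newProj_eq_of_two hij, map_add, add_mul] at hs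
  have h0 : embed 3 (proj G 3 j) * embed 3 (proj G 3 i) = 0 := by
    rw [← map_mul, proj_mul_ne fun h => hij (Subtype.ext h).symm, map_zero]
  exact h4.Z_eq_of_separating (d := embed 3 (proj G 3 i))
    (adjoin_le_Z (by rintro _ rfl; exact e_mem_Z G 3)) (Zin_le_adjoin _) (mem_adjoin_of_mem rfl)
    (Zin_le_adjoin _ ⟨_, proj_mem_Z _, rfl⟩)
    (not_scalar_of_add_eq (embed_proj_mul_newProj_ne_zero h1 h2 h3 i)
      (embed_proj_mul_newProj_ne_zero h1 h2 h3 j) hs h0)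

end

section

variable {G : Subgroup SU2}

/-! ### The individual groups -/

/-- The number ñ enters as the order of ζ², which is what distinguishes the weights of words of a
fixed degree. -/
theorem coe_sq_pow_eq_one_iff {n : ℕ} {ζ : Circle} (hζ : IsPrimitiveRoot ζ n) (d : ℕ) :
    ((ζ : ℂ) ^ 2) ^ d = 1 ↔ tilde n ∣ d := by
  have h1 : ((ζ : ℂ) ^ 2) ^ d = 1 ↔ ζ ^ (2 * d) = 1 := by
    rw [← pow_mul, ← Circle.coe_pow, Circle.coe_eq_one]
  rw [h1, hζ.pow_eq_one_iff_dvd, tilde]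
  split_ifs with h
  · obtain ⟨m, rfl⟩ := h.two_dvd
    rw [Nat.mul_div_cancel_left m two_pos]
    exact Nat.mul_dvd_mul_iff_left two_pos
  · exact (Nat.coprime_two_right.2 (Nat.not_even_iff_odd.1 h)).dvd_mul_left

theorem orderGT_of_lt {n m : ℕ} {ζ : Circle} (hζ : IsPrimitiveRoot ζ n) (h : m < tilde n) :
    OrderGT ζ m := fun d h1 h2 h3 =>
  absurd (Nat.le_of_dvd h1 ((coe_sq_pow_eq_one_iff hζ d).1 h3)) (by omega)

theorem coe_sq_pow_tilde {n m : ℕ} {ζ : Circle} (hζ : IsPrimitiveRoot ζ n) (h : m = tilde n) :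
    ((ζ : ℂ) ^ 2) ^ m = 1 := (coe_sq_pow_eq_one_iff hζ m).2 (by rw [h])

theorem tilde_two_mul (n : ℕ) : tilde (2 * n) = n := by
  rw [tilde, if_pos (even_two_mul n), Nat.mul_div_cancel_left n two_pos]

theorem two_le_tilde {n : ℕ} (hn : 3 ≤ n) : 2 ≤ tilde n := by
  rw [tilde]
  split_ifs with h
  · obtain ⟨m, rfl⟩ := h.two_dvd
    omega
  · omega

theorem coe_pow_ne_one {ζ : Circle} (hζ : ∀ m : ℕ, 0 < m → ζ ^ m ≠ 1) {m : ℕ} (hm : 0 < m) :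
    (ζ : ℂ) ^ m ≠ 1 := by
  rw [← Circle.coe_pow, Ne, Circle.coe_eq_one]
  exact hζ m hm

theorem orderGT_of_infinite {ζ : Circle} (hζ : ∀ m : ℕ, 0 < m → ζ ^ m ≠ 1) (m : ℕ) :
    OrderGT ζ m := fun d h1 _ => by
  rw [← pow_mul]
  exact coe_pow_ne_one hζ (by omega)

theorem pow_eq_neg_one {n : ℕ} (hn : 0 < n) {ζ : Circle} (hζ : IsPrimitiveRoot ζ (2 * n)) :
    (ζ : ℂ) ^ n = -1 := by
  have h1 : ((ζ : ℂ) ^ n) ^ 2 = 1 := by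
    rw [← pow_mul, mul_comm, ← Circle.coe_pow, hζ.pow_eq_one, Circle.coe_one]
  rcases sq_eq_sq_iff_eq_or_eq_neg.1 (h1.trans (one_pow 2).symm) with h | h
  · rw [← Circle.coe_pow, Circle.coe_eq_one, hζ.pow_eq_one_iff_dvd] at h
    exact absurd (Nat.le_of_dvd hn h) (by omega)
  · exact h

theorem eig_const_one {n : ℕ} (hn : 0 < n) {ζ : Circle} (hζ : IsPrimitiveRoot ζ (2 * n)) :
    eig ζ (fun _ : Fin n => 1) = -1 := by
  rw [eig, ones_const_one, coe_sq_pow_tilde hζ (tilde_two_mul n).symm, mul_one, inv_pow,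
    pow_eq_neg_one hn hζ]
  norm_num

theorem multFree_tetrahedral (hG : IsDoubleCoverOf G (alternatingGroup (Fin 4))) :
    MultFree G 1 1 ∧ MultFree G 2 1 ∧ MultFree G 3 2 ∧ MultFree G 4 2 ∧ newNodes G 5 = ∅ := by
  obtain ⟨c⟩ := hG.exists_cover
  obtain ⟨h1, h2, h3, h4, h5⟩ := newGram_of_tetrahedral (G := G) fun a b m => homDim_tetrahedral c
  exact ⟨.of_newGram h1 (by norm_num), .of_newGram h2 (by norm_num), .of_newGram h3 (by norm_num),
    .of_newGram h4 (by norm_num), newNodes_eq_empty_of_newGram h5⟩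

theorem multFree_octahedral (hG : IsDoubleCoverOf G (Equiv.Perm (Fin 4))) :
    MultFree G 1 1 ∧ MultFree G 2 1 ∧ MultFree G 3 1 ∧ MultFree G 4 2 ∧ MultFree G 5 1 ∧
      MultFree G 6 1 ∧ newNodes G 7 = ∅ := by
  obtain ⟨c⟩ := hG.exists_cover
  obtain ⟨h1, h2, h3, h4, h5, h6, h7⟩ :=
    newGram_of_octahedral (G := G) fun a b m => homDim_octahedral c
  exact ⟨.of_newGram h1 (by norm_num), .of_newGram h2 (by norm_num), .of_newGram h3 (by norm_num),
    .of_newGram h4 (by norm_num), .of_newGram h5 (by norm_num), .of_newGram h6 (by norm_num),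
    newNodes_eq_empty_of_newGram h7⟩

theorem multFree_icosahedral (hG : IsDoubleCoverOf G (alternatingGroup (Fin 5))) :
    MultFree G 1 1 ∧ MultFree G 2 1 ∧ MultFree G 3 1 ∧ MultFree G 4 1 ∧ MultFree G 5 1 ∧
      MultFree G 6 2 ∧ MultFree G 7 1 ∧ newNodes G 8 = ∅ := by
  obtain ⟨c⟩ := hG.exists_cover
  obtain ⟨h1, h2, h3, h4, h5, h6, h7, h8⟩ :=
    newGram_of_icosahedral (G := G) fun a b m => homDim_icosahedral c
  exact ⟨.of_newGram h1 (by norm_num), .of_newGram h2 (by norm_num), .of_newGram h3 (by norm_num),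
    .of_newGram h4 (by norm_num), .of_newGram h5 (by norm_num), .of_newGram h6 (by norm_num),
    .of_newGram h7 (by norm_num), newNodes_eq_empty_of_newGram h8⟩

theorem IsDoubleCoverOf.neg_one_mem {H : Type} [Group H] (h : IsDoubleCoverOf G H) :
    ∃ g : G, ((g : SU2) : Matrix (Fin 2) (Fin 2) ℂ) = -1 := by
  obtain ⟨c⟩ := h.exists_cover
  exact c.neg_one

theorem multFree_one_of_not_isCyclicType (Γ : McKayGroup) (h : ¬ Γ.IsCyclicType) :
    MultFree Γ.toSubgroup 1 1 := by
  cases Γ with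
  | SU => exact multFree_of_top
  | C n ζ hn hζ => exact absurd trivial h
  | D n ζ hn hζ =>
    exact multFree_one_of_dihedral rfl (orderGT_of_lt hζ (by rw [tilde_two_mul]; omega))
      fun r => nonconst_mem_oldSpace_one
  | T G hG => exact (multFree_tetrahedral hG).1
  | O G hG => exact (multFree_octahedral hG).1
  | I G hG => exact (multFree_icosahedral hG).1
  | Cinf ζ hζ => exact absurd trivial h
  | Dinf ζ hζ =>
    exact multFree_one_of_dihedral rfl (orderGT_of_infinite hζ _)
      fun r => nonconst_mem_oldSpace_one

theorem exists_neg_one_of_not_isCyclicType (Γ : McKayGroup) (h : ¬ Γ.IsCyclicType) :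
    ∃ g : Γ.toSubgroup, ((g : SU2) : Matrix (Fin 2) (Fin 2) ℂ) = -1 := by
  cases Γ with
  | SU => exact neg_one_mem_top
  | C n ζ hn hζ => exact absurd trivial h
  | D n ζ hn hζ => exact neg_one_mem_dihedral rfl
  | T G hG => exact hG.neg_one_mem
  | O G hG => exact hG.neg_one_mem
  | I G hG => exact hG.neg_one_mem
  | Cinf ζ hζ => exact absurd trivial h
  | Dinf ζ hζ => exact neg_one_mem_dihedral rfl

theorem exists_multFree (Γ : McKayGroup) {k : ℕ} (hk : 1 ≤ k) (hkd : (k : ℕ∞) < Γ.diam)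
    (hC : ∀ n ζ hn hζ, Γ = .C n ζ hn hζ → k + 1 ≠ tilde n) :
    ∃ c, MultFree Γ.toSubgroup (k + 1) c := by
  cases Γ with
  | SU => exact ⟨1, multFree_of_top⟩
  | C n ζ hn hζ =>
    change (k : ℕ∞) < (tilde n : ℕ) at hkd
    have h1 : k < tilde n := by exact_mod_cast hkd
    have h2 := hC n ζ hn hζ rfl
    exact ⟨2, multFree_of_cyclic (zpowers_eq_closure ζ) (orderGT_of_lt hζ (by omega))⟩
  | D n ζ hn hζ =>
    change (k : ℕ∞) < (n : ℕ) at hkd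
    have h1 : k < n := by exact_mod_cast hkd
    obtain rfl | ⟨k, rfl⟩ : k = 1 ∨ ∃ l, k = l + 2 := by
      rcases hk.eq_or_lt with h | h
      · exact .inl h.symm
      · exact .inr ⟨k - 2, by omega⟩
    · rcases h1.nat_succ_le.eq_or_lt with rfl | h2
      · exact ⟨3, multFree_two_three_of_dihedral rfl (orderGT_of_lt hζ (by rw [tilde_two_mul]; omega))
          (coe_sq_pow_tilde hζ (tilde_two_mul _).symm)⟩
      · exact ⟨2, multFree_two_two_of_dihedral rfl
          (orderGT_of_lt hζ (by rw [tilde_two_mul]; omega))⟩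
    · rcases h1.nat_succ_le.eq_or_lt with rfl | h2
      · exact ⟨2, multFree_two_of_dihedral rfl (orderGT_of_lt hζ (by rw [tilde_two_mul]; omega))
          (coe_sq_pow_tilde hζ (tilde_two_mul _).symm)⟩
      · exact ⟨1, multFree_one_of_dihedral rfl (orderGT_of_lt hζ (by rw [tilde_two_mul]; omega))
          (nonconst_mem_oldSpace_of_dihedral rfl)⟩
  | T G hG =>
    change (k : ℕ∞) < (4 : ℕ∞) at hkd
    have h1 : k < 4 := by exact_mod_cast hkd
    obtain ⟨-, h2, h3, h4, -⟩ := multFree_tetrahedral hG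
    interval_cases k
    exacts [⟨_, h2⟩, ⟨_, h3⟩, ⟨_, h4⟩]
  | O G hG =>
    change (k : ℕ∞) < (6 : ℕ∞) at hkd
    have h1 : k < 6 := by exact_mod_cast hkd
    obtain ⟨-, h2, h3, h4, h5, h6, -⟩ := multFree_octahedral hG
    interval_cases k
    exacts [⟨_, h2⟩, ⟨_, h3⟩, ⟨_, h4⟩, ⟨_, h5⟩, ⟨_, h6⟩]
  | I G hG =>
    change (k : ℕ∞) < (7 : ℕ∞) at hkd
    have h1 : k < 7 := by exact_mod_cast hkd
    obtain ⟨-, h2, h3, h4, h5, h6, h7, -⟩ := multFree_icosahedral hG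
    interval_cases k
    exacts [⟨_, h2⟩, ⟨_, h3⟩, ⟨_, h4⟩, ⟨_, h5⟩, ⟨_, h6⟩, ⟨_, h7⟩]
  | Cinf ζ hζ => exact ⟨2, multFree_of_cyclic (zpowers_eq_closure ζ) (orderGT_of_infinite hζ _)⟩
  | Dinf ζ hζ =>
    obtain rfl | ⟨k, rfl⟩ : k = 1 ∨ ∃ l, k = l + 2 := by
      rcases hk.eq_or_lt with h | h
      · exact .inl h.symm
      · exact .inr ⟨k - 2, by omega⟩
    · exact ⟨2, multFree_two_two_of_dihedral rfl (orderGT_of_infinite hζ _)⟩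
    · exact ⟨1, multFree_one_of_dihedral rfl (orderGT_of_infinite hζ _)
        (nonconst_mem_oldSpace_of_dihedral rfl)⟩

/-- The non-cyclic groups contain -1, which separates even from odd degrees. For a cyclic group the
odd powers ζ^{2d+1} with d ≤ k must avoid 1: this is automatic for even n and for n = ∞, while for
odd n it needs 2k + 1 < n. -/
theorem notMem_Lam_of_mem_newNodes (Γ : McKayGroup) {k : ℕ}
    (hC : ∀ n ζ hn hζ, Γ = .C n ζ hn hζ → Odd n → 2 * (k + 1) ≤ n)
    {μ : Node Γ.toSubgroup} (hμ : μ ∈ newNodes Γ.toSubgroup (k + 1)) : μ ∉ Lam Γ.toSubgroup k := by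
  by_cases h : Γ.IsCyclicType
  · cases Γ with
    | C n ζ hn hζ =>
      refine notMem_Lam_of_cyclic (zpowers_eq_closure ζ) (fun d hd h1 => ?_) hμ
      rw [← Circle.coe_pow, Circle.coe_eq_one, hζ.pow_eq_one_iff_dvd] at h1
      rcases Nat.even_or_odd n with hn' | hn'
      · have := hn'.two_dvd.trans h1
        omega
      · have h2 := hC n ζ hn hζ rfl hn'
        have := Nat.le_of_dvd (by omega) h1
        omega
    | Cinf ζ hζ =>
      exact notMem_Lam_of_cyclic (zpowers_eq_closure ζ)
        (fun d _ => coe_pow_ne_one hζ (Nat.succ_pos _)) hμ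
    | _ => exact absurd h id
  · obtain ⟨g, hg⟩ := exists_neg_one_of_not_isCyclicType Γ h
    exact notMem_Lam_of_neg_one hg hμ.1

theorem newNodes_eq_empty_of_diam_le (Γ : McKayGroup) {k : ℕ} (hk : Γ.diam ≤ (k : ℕ∞)) :
    newNodes Γ.toSubgroup (k + 1) = ∅ := by
  have key : ∀ (G : Subgroup SU2) (d : ℕ), 1 ≤ d → d ≤ k → newNodes G (d + 1) = ∅ →
      newNodes G (k + 1) = ∅ := by
    intro G d hd hdk h
    obtain ⟨d, rfl⟩ := Nat.exists_eq_add_of_le' hd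
    obtain ⟨l, rfl⟩ := Nat.exists_eq_add_of_le' (hd.trans hdk)
    exact newNodes_eq_empty_of_le h (by omega)
  cases Γ with
  | SU => exact absurd (top_le_iff.1 hk) (ENat.natCast_ne_top k)
  | C n ζ hn hζ =>
    change ((tilde n : ℕ) : ℕ∞) ≤ k at hk
    have h1 : tilde n ≤ k := by exact_mod_cast hk
    obtain ⟨m, hm⟩ := Nat.exists_eq_add_of_le' (one_le_two.trans (two_le_tilde hn))
    exact key _ (m + 1) (by omega) (by omega)
      (newNodes_eq_empty_of_cyclic (zpowers_eq_closure ζ) (coe_sq_pow_tilde hζ hm.symm))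
  | D n ζ hn hζ =>
    change ((n : ℕ) : ℕ∞) ≤ k at hk
    have h1 : n ≤ k := by exact_mod_cast hk
    obtain ⟨m, rfl⟩ := Nat.exists_eq_add_of_le' hn
    exact key _ (m + 2) (by omega) (by omega)
      (newNodes_eq_empty_of_dihedral rfl (coe_sq_pow_tilde hζ (tilde_two_mul _).symm))
  | T G hG =>
    change (4 : ℕ∞) ≤ k at hk
    exact key _ 4 (by norm_num) (by exact_mod_cast hk) (multFree_tetrahedral hG).2.2.2.2
  | O G hG =>
    change (6 : ℕ∞) ≤ k at hk
    exact key _ 6 (by norm_num) (by exact_mod_cast hk) (multFree_octahedral hG).2.2.2.2.2.2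
  | I G hG =>
    change (7 : ℕ∞) ≤ k at hk
    exact key _ 7 (by norm_num) (by exact_mod_cast hk) (multFree_icosahedral hG).2.2.2.2.2.2.2
  | Cinf ζ hζ => exact absurd (top_le_iff.1 hk) (ENat.natCast_ne_top k)
  | Dinf ζ hζ => exact absurd (top_le_iff.1 hk) (ENat.natCast_ne_top k)

/-- Outside the branch and exceptional degrees there is one new summand, except for the cyclic
groups and for the binary tetrahedral group at k = 3, where two summands have to be separated. -/
theorem Z_eq_adjoin_e (Γ : McKayGroup) {k : ℕ} (hk : 1 ≤ k) (hkd : (k : ℕ∞) < Γ.diam)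
    (hbr : Γ.br ≠ some k) (hC : ∀ n ζ hn hζ, Γ = .C n ζ hn hζ → k + 1 ≠ tilde n)
    (hD : ∀ n ζ hn hζ, Γ = .D n ζ hn hζ → k + 1 ≠ n) :
    Z Γ.toSubgroup (k + 1) = Algebra.adjoin ℂ ((Zin Γ.toSubgroup k : Set _) ∪ {e k}) := by
  cases Γ with
  | SU => exact multFree_of_top.Z_eq_adjoin_e
  | C n ζ hn hζ =>
    change (k : ℕ∞) < (tilde n : ℕ) at hkd
    have h1 : k < tilde n := by exact_mod_cast hkd
    have h2 := hC n ζ hn hζ rfl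
    obtain ⟨k, rfl⟩ := Nat.exists_eq_add_of_le' hk
    exact Z_eq_adjoin_e_of_cyclic (zpowers_eq_closure ζ) (orderGT_of_lt hζ (by omega))
  | D n ζ hn hζ =>
    change (k : ℕ∞) < (n : ℕ) at hkd
    have h1 : k < n := by exact_mod_cast hkd
    have h2 := hD n ζ hn hζ rfl
    have h3 : k ≠ 1 := fun h => hbr (by rw [h]; rfl)
    obtain ⟨k, rfl⟩ := Nat.exists_eq_add_of_le' (show 2 ≤ k by omega)
    exact (multFree_one_of_dihedral rfl (orderGT_of_lt hζ (by rw [tilde_two_mul]; omega))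
      (nonconst_mem_oldSpace_of_dihedral rfl)).Z_eq_adjoin_e
  | T G hG =>
    change (k : ℕ∞) < (4 : ℕ∞) at hkd
    have h0 : k < 4 := by exact_mod_cast hkd
    obtain ⟨h1, h2, h3, h4, -⟩ := multFree_tetrahedral hG
    interval_cases k
    exacts [h2.Z_eq_adjoin_e, absurd rfl hbr, Z_four_eq_adjoin_e h1 h2 h3 h4]
  | O G hG =>
    change (k : ℕ∞) < (6 : ℕ∞) at hkd
    have h1 : k < 6 := by exact_mod_cast hkd
    obtain ⟨-, h2, h3, h4, h5, h6, -⟩ := multFree_octahedral hG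
    interval_cases k
    exacts [h2.Z_eq_adjoin_e, h3.Z_eq_adjoin_e, absurd rfl hbr, h5.Z_eq_adjoin_e, h6.Z_eq_adjoin_e]
  | I G hG =>
    change (k : ℕ∞) < (7 : ℕ∞) at hkd
    have h1 : k < 7 := by exact_mod_cast hkd
    obtain ⟨-, h2, h3, h4, h5, h6, h7, -⟩ := multFree_icosahedral hG
    interval_cases k
    exacts [h2.Z_eq_adjoin_e, h3.Z_eq_adjoin_e, h4.Z_eq_adjoin_e, h5.Z_eq_adjoin_e, absurd rfl hbr,
      h7.Z_eq_adjoin_e]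
  | Cinf ζ hζ =>
    obtain ⟨k, rfl⟩ := Nat.exists_eq_add_of_le' hk
    exact Z_eq_adjoin_e_of_cyclic (zpowers_eq_closure ζ) (orderGT_of_infinite hζ _)
  | Dinf ζ hζ =>
    have h3 : k ≠ 1 := fun h => hbr (by rw [h]; rfl)
    obtain ⟨k, rfl⟩ := Nat.exists_eq_add_of_le' (show 2 ≤ k by omega)
    exact (multFree_one_of_dihedral rfl (orderGT_of_infinite hζ _)
      (nonconst_mem_oldSpace_of_dihedral rfl)).Z_eq_adjoin_e

theorem multFree_two_of_br (Γ : McKayGroup) {k : ℕ} (hbr : Γ.br = some k)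
    (hD : ∀ ζ hn hζ, Γ ≠ .D 2 ζ hn hζ) : MultFree Γ.toSubgroup (k + 1) 2 := by
  cases Γ with
  | SU => exact absurd hbr (by simp [McKayGroup.br])
  | C n ζ hn hζ =>
    obtain rfl : 0 = k := Option.some_injective _ hbr
    have := two_le_tilde hn
    exact multFree_of_cyclic (zpowers_eq_closure ζ) (orderGT_of_lt hζ (by omega))
  | D n ζ hn hζ =>
    obtain rfl : 1 = k := Option.some_injective _ hbr
    have h2 : n ≠ 2 := by
      rintro rfl
      exact hD ζ hn hζ rfl
    exact multFree_two_two_of_dihedral rfl (orderGT_of_lt hζ (by rw [tilde_two_mul]; omega))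
  | T G hG =>
    obtain rfl : 2 = k := Option.some_injective _ hbr
    exact (multFree_tetrahedral hG).2.2.1
  | O G hG =>
    obtain rfl : 3 = k := Option.some_injective _ hbr
    exact (multFree_octahedral hG).2.2.2.1
  | I G hG =>
    obtain rfl : 5 = k := Option.some_injective _ hbr
    exact (multFree_icosahedral hG).2.2.2.2.2.1
  | Cinf ζ hζ =>
    obtain rfl : 0 = k := Option.some_injective _ hbr
    exact multFree_of_cyclic (zpowers_eq_closure ζ) (orderGT_of_infinite hζ _)
  | Dinf ζ hζ =>
    obtain rfl : 1 = k := Option.some_injective _ hbr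
    exact multFree_two_two_of_dihedral rfl (orderGT_of_infinite hζ _)

theorem newNodes_eq_lines_of_dihedral {ζ : Circle} {k : ℕ} (hζ : IsPrimitiveRoot ζ (2 * (k + 3)))
    (hG : G = Subgroup.closure {gElt ζ, hElt}) (h : MultFree G (k + 3) 2) :
    newNodes G (k + 3) = {μ | IsLine ζ (-1) (Complex.I ^ (k + 3)) μ ∨
      IsLine ζ (-1) (-Complex.I ^ (k + 3)) μ} := by
  have h' := coe_sq_pow_tilde hζ (tilde_two_mul _).symm
  rw [newNodes_eq_lines hG h.2 (fun a => pairVec (sgn a) fun _ => 1)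
    (fun a => pairVec_const_mem_newSpace hG _ (orderGT_of_lt hζ (by rw [tilde_two_mul]; omega)))
    (fun a => pairVec_ne_zero _ _) (fun _ => -1) (fun a => Complex.I ^ (k + 3) * sgn a)
    (fun a b _ hd => ?_) (fun a g hg => ?_)
    (fun a g hg => tensorRep_hElt_pairVec hg (sgn_mul_self a) _)]
  · ext μ
    rw [Set.mem_ofPred_eq, Set.mem_ofPred_eq, Fin.exists_fin_two, sgn_zero, sgn_one, mul_one,
      mul_neg_one]
  · by_contra hab
    exact sgn_ne hab (mul_left_cancel₀ (pow_ne_zero _ Complex.I_ne_zero) hd)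
  · rw [tensorRep_gElt_pairVec hg (eig_flip_const h'), eig_const_one (Nat.succ_pos _) hζ]

theorem newNodes_two_eq_lines_of_dihedral {ζ : Circle} (hζ : IsPrimitiveRoot ζ (2 * 2))
    (hG : G = Subgroup.closure {gElt ζ, hElt}) (h : MultFree G 2 3) :
    newNodes G 2 = {μ | IsLine ζ 1 (-1) μ ∨ IsLine ζ (-1) (-1) μ ∨ IsLine ζ (-1) 1 μ} := by
  have h' := coe_sq_pow_tilde hζ (tilde_two_mul _).symm
  have he : eig ζ w01 = 1 := by
    have h0 : (ζ : ℂ) ≠ 0 := Circle.coe_ne_zero ζ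
    have h1 : ones w01 = 1 := rfl
    rw [eig, h1, pow_one, inv_pow, inv_mul_cancel₀ (pow_ne_zero 2 h0)]
  rw [newNodes_eq_lines hG h.2
    (Fin.cons (pairVec 1 w01) fun a => pairVec (sgn a) fun _ => 1)
    (Fin.cases (pairVec_w01_mem_newSpace (hElt_mem hG)) fun a => pairVec_const_mem_newSpace hG _
      (orderGT_of_lt hζ (by rw [tilde_two_mul]; omega)))
    (Fin.cases (pairVec_ne_zero _ _) fun a => pairVec_ne_zero _ _)
    (Fin.cons 1 fun _ => -1) (Fin.cons (-1) fun a => -sgn a) ?_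
    (Fin.cases (fun g hg => ?_) fun a g hg => ?_) (Fin.cases (fun g hg => ?_) fun a g hg => ?_)]
  · ext μ
    rw [Set.mem_ofPred_eq, Set.mem_ofPred_eq, Fin.exists_fin_succ, Fin.exists_fin_two]
    simp only [Fin.cons_zero, Fin.cons_succ, sgn_zero, sgn_one, neg_neg]
  · refine Fin.cases (Fin.cases (fun _ _ => rfl) fun b hc _ => ?_)
      fun a => Fin.cases (fun hc _ => ?_) fun b _ hd => ?_
    · rw [Fin.cons_zero, Fin.cons_succ] at hc
      norm_num at hc
    · rw [Fin.cons_zero, Fin.cons_succ] at hc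
      norm_num at hc
    · rw [Fin.cons_succ, Fin.cons_succ, neg_inj] at hd
      by_contra hab
      exact sgn_ne (fun h => hab (congrArg Fin.succ h)) hd
  · rw [Fin.cons_zero, Fin.cons_zero, tensorRep_gElt_pairVec hg (eig_flip_w01 ζ), he]
  · rw [Fin.cons_succ, Fin.cons_succ, tensorRep_gElt_pairVec hg (eig_flip_const h'),
      eig_const_one two_pos hζ]
  · rw [Fin.cons_zero, Fin.cons_zero, tensorRep_hElt_pairVec hg (one_mul 1), Complex.I_sq, mul_one]
  · rw [Fin.cons_succ, Fin.cons_succ, tensorRep_hElt_pairVec hg (sgn_mul_self a), Complex.I_sq,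
      neg_one_mul]

end

end McKay

end

theorem mainTheorem6 (Γ : McKay.McKayGroup) (G : Subgroup McKay.SU2) (hG : G = Γ.toSubgroup) :
    -- `Z_1 = ℂ 1 ≅ Z_0` for the non-cyclic groups
    (¬ Γ.IsCyclicType → McKay.Z G 1 = ⊥ ∧ Nonempty (McKay.Z G 1 ≃ₐ[ℂ] McKay.Z G 0)) ∧
    -- (a)
    (∀ k : ℕ, 1 ≤ k → (k : ℕ∞) < Γ.diam →
      (∀ n ζ hn hζ, Γ = .C n ζ hn hζ → k + 1 ≠ McKay.tilde n) →
        Subalgebra.toSubmodule (McKay.Z G (k + 1)) =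
          McKay.ZeZ G k ⊔ (McKay.endNew G (k + 1)).toSubmodule ∧
        Disjoint (McKay.ZeZ G k) (McKay.endNew G (k + 1)).toSubmodule ∧
        (∀ a ∈ McKay.ZeZ G k, ∀ b ∈ McKay.endNew G (k + 1), a * b = 0 ∧ b * a = 0) ∧
        (∀ a ∈ McKay.endNew G (k + 1), ∀ b ∈ McKay.endNew G (k + 1), a * b = b * a) ∧
        Module.finrank ℂ (McKay.endNew G (k + 1)) = (McKay.newNodes G (k + 1)).ncard ∧
        ((∀ n ζ hn hζ, Γ = .C n ζ hn hζ → Odd n → 2 * (k + 1) ≤ n) →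
          Module.finrank ℂ (McKay.endNew G (k + 1)) =
            {μ : McKay.Node G |
              (McKay.repGraph G).dist (McKay.Node.zero G) μ = k + 1}.ncard)) ∧
    -- (b)
    (∀ k : ℕ, Γ.diam ≤ (k : ℕ∞) →
      Subalgebra.toSubmodule (McKay.Z G (k + 1)) = McKay.ZeZ G k) ∧
    -- (c)
    (∀ k : ℕ, 1 ≤ k → (k : ℕ∞) < Γ.diam → Γ.br ≠ some k →
      (∀ n ζ hn hζ, Γ = .C n ζ hn hζ → k + 1 ≠ McKay.tilde n) →
      (∀ n ζ hn hζ, Γ = .D n ζ hn hζ → k + 1 ≠ n) →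
        McKay.Z G (k + 1) = Algebra.adjoin ℂ ((McKay.Zin G k : Set _) ∪ {McKay.e k})) ∧
    -- (d)
    (∀ k : ℕ, Γ.br = some k → (∀ ζ hn hζ, Γ ≠ .D 2 ζ hn hζ) →
      (McKay.newNodes G (k + 1)).ncard = 2 ∧
      ∀ μ ∈ McKay.newNodes G (k + 1), ∃ f, McKay.IsProjOnto G (k + 1) μ f ∧
        McKay.Z G (k + 1) = Algebra.adjoin ℂ ((McKay.Zin G k : Set _) ∪ {McKay.e k, f})) ∧
    -- (e)
    (∀ n ζ hn hζ, Γ = .C n ζ hn hζ → ∀ k : ℕ, k + 1 = McKay.tilde n →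
      McKay.Z G (k + 1) = Algebra.adjoin ℂ ((McKay.Zin G k : Set _) ∪ {McKay.e k} ∪
        {E | ∃ p ∈ ({fun _ => 0, fun _ => 1} : Set (Fin (k + 1) → Fin 2)),
          ∃ q ∈ ({fun _ => 0, fun _ => 1} : Set (Fin (k + 1) → Fin 2)),
            E = McKay.matrixUnit p q})) ∧
    -- (f)
    (∀ n ζ hn hζ, Γ = .D n ζ hn hζ → 2 < n → ∀ k : ℕ, k + 1 = n →
      McKay.newNodes G (k + 1) =
        {μ | McKay.IsLine ζ (-1) (Complex.I ^ n) μ ∨ McKay.IsLine ζ (-1) (-Complex.I ^ n) μ} ∧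
      (McKay.newNodes G (k + 1)).ncard = 2 ∧
      ∀ μ ∈ McKay.newNodes G (k + 1), ∃ f, McKay.IsProjOnto G (k + 1) μ f ∧
        McKay.Z G (k + 1) = Algebra.adjoin ℂ ((McKay.Zin G k : Set _) ∪ {McKay.e k, f})) ∧
    -- (g)
    (∀ ζ hn hζ, Γ = .D 2 ζ hn hζ →
      McKay.newNodes G 2 =
        {μ | McKay.IsLine ζ 1 (-1) μ ∨ McKay.IsLine ζ (-1) (-1) μ ∨ McKay.IsLine ζ (-1) 1 μ} ∧
      (McKay.newNodes G 2).ncard = 3 ∧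
      ∀ μ₁ ∈ McKay.newNodes G 2, ∀ μ₂ ∈ McKay.newNodes G 2, μ₁ ≠ μ₂ →
        ∃ f₁ f₂, McKay.IsProjOnto G 2 μ₁ f₁ ∧ McKay.IsProjOnto G 2 μ₂ f₂ ∧
          McKay.Z G 2 = Algebra.adjoin ℂ ((McKay.Zin G 1 : Set _) ∪ {McKay.e 1, f₁, f₂})) := by
  subst hG
  refine ⟨fun h => McKay.Z_one_eq_bot (McKay.multFree_one_of_not_isCyclicType Γ h),
    fun k hk hkd hC => ?_, fun k hk => McKay.Z_eq_ZeZ_of_empty (McKay.newNodes_eq_empty_of_diam_le Γ hk),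
    fun k => McKay.Z_eq_adjoin_e Γ, fun k hbr hD => ?_, fun n ζ hn hζ hΓ k hk => ?_,
    fun n ζ hn hζ hΓ hn2 k hk => ?_, fun ζ hn hζ hΓ => ?_⟩
  · obtain ⟨c, hc⟩ := McKay.exists_multFree Γ hk hkd hC
    have hfin := hc.finrank_endNew.trans hc.2.symm
    refine ⟨McKay.Z_eq_ZeZ_sup_endNew _ k, McKay.disjoint_ZeZ_endNew _ k,
      fun a ha b hb => McKay.ZeZ_mul_endNew ha hb, fun a ha b hb => hc.endNew_comm ha hb, hfin,
      fun h => hfin.trans ?_⟩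
    obtain ⟨k, rfl⟩ := Nat.exists_eq_add_of_le' hk
    rw [← McKay.setOf_dist_eq fun μ => McKay.notMem_Lam_of_mem_newNodes Γ h]
  · have h := McKay.multFree_two_of_br Γ hbr hD
    exact ⟨h.2, fun μ hμ => h.exists_proj_of_two hμ⟩
  · subst hΓ
    exact McKay.Z_eq_adjoin_matrixUnit_of_cyclic (McKay.zpowers_eq_closure ζ)
      (McKay.orderGT_of_lt hζ (by omega)) (McKay.coe_sq_pow_tilde hζ hk)
  · subst hΓ hk
    obtain ⟨k, rfl⟩ := Nat.exists_eq_add_of_le' (show 2 ≤ k by omega)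
    have h := McKay.multFree_two_of_dihedral (k := k) (ζ := ζ) rfl
      (McKay.orderGT_of_lt hζ (by rw [McKay.tilde_two_mul]; omega))
      (McKay.coe_sq_pow_tilde hζ (McKay.tilde_two_mul _).symm)
    exact ⟨McKay.newNodes_eq_lines_of_dihedral hζ rfl h, h.2, fun μ hμ => h.exists_proj_of_two hμ⟩
  · subst hΓ
    have h := McKay.multFree_two_three_of_dihedral (ζ := ζ) rfl
      (McKay.orderGT_of_lt hζ (by rw [McKay.tilde_two_mul]; omega))
      (McKay.coe_sq_pow_tilde hζ (McKay.tilde_two_mul _).symm)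
    exact ⟨McKay.newNodes_two_eq_lines_of_dihedral hζ rfl h, h.2,
      fun μ₁ h₁ μ₂ h₂ => h.exists_proj_of_three h₁ h₂⟩
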